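/- **Setting.** Let $(\mathbb K,\otimes,0,1)$ with $0\ne 1$ and let $\oplus^i$ be pairwise distinct operators such that every $(\mathbb K,\oplus^i,\otimes)$ is a commutative semiring with the same $0$ and $1$; assume $a\otimes a=a$ for all $a$. Let $\mathcal H=(\mathcal V,\mathcal E)$ be a finite hypergraph with $\mathcal V=\bigcup\mathcal E$, and let $\alpha$ be an aggregation ordering: a sequence of pairs (attribute, operator) with distinct attributes from $\mathcal V$ and operators from $\{\oplus^i\}\cup\{\otimes\}$. $V(\alpha)$ is the set of its attributes, $V(-\alpha)=\mathcal V\setminus V(\alpha)$ the set of output attributes, $\mathsf{PA}(\alpha)$ the set of attributes aggregated by $\otimes$ (product attributes); the other attributes of $V(\alpha)$ are semiring attributes; $\alpha_F$ is $\alpha$ restricted to $F$. Assume, for every $F\in\mathcal E$ with $\alpha_F$ nonempty, that the last aggregation in $\alpha_F$ is not a product. An instance gives every attribute a finite nonempty domain and every $F\in\mathcal E$ a $\mathbb K$-annotated relation $R_F$ (absent tuples have annotation $0$); $Q_{\mathcal H,\alpha}=\sum_{\alpha_1}\cdots\sum_{\alpha_{|\alpha|}}\Join_{F\in\mathcal E}R_F$,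 and $\alpha\equiv_{\mathcal H}\beta$ means that $V(\alpha)=V(\beta)$ and that $Q_{\mathcal H,\alpha}$ and $Q_{\mathcal H,\beta}$ agree on every instance. **AGHDs.** A product partition $P$ partitions, for every product attribute $a$, the edges containing $a$; $\mathcal H_P$ is $\mathcal H$ with a separate copy of $a$ for each block, every edge using the copy of its block. A GHD of a hypergraph is a finite tree with bags (sets of vertices) such that every edge lies in a bag and the nodes whose bags contain a given vertex form a subtree. An AGHD of $Q_{\mathcal H,\alpha}$ is $(\mathcal T,\chi,P)$ where $(\mathcal T,\chi)$ is a rooted GHD of $\mathcal H_P$. It is compatible with $\beta$ if, whenever the topmost node of a copy of $a$ is a proper ancestor of the topmost node of a copy of $b\neq a$, either $a$ is an output attribute or $a$ occurs before $b$ in $\beta$; it is valid if it is compatible with some $\beta\equiv_{\mathcal H}\alpha$. A function $\gamma:2^{\mathcal V}\to\mathbb R$ is node-monotone if $A\subseteq B$ implies $\gamma(A)\le\gamma(B)$; the $\gamma$-width is the maximum of $\gamma$ over the bags, copies being replaced by their attributes. **Splitting.** For a connected component $C$ of $\mathcal H\setminus(V(-\alpha)\cup\mathsf{PA}(\alpha))$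 let $\mathcal E_C$ be the set of edges meeting $C$, $C^{++}=\bigcup\mathcal E_C$, $C^+=C\cup(\mathsf{PA}(\alpha)\cap C^{++})$. For an ordering $\alpha$, let $\alpha^O=\{\text{attribute of }\alpha_1\}$ if $\alpha_1$ is a product aggregation; otherwise $\alpha^O$ is the set of attributes $A$ of $\alpha$ such that every $B$ before $A$ in $\alpha$ has the same operator as $A$, or is not connected to $A$ within $\{A,B\}$ together with the semiring attributes not before $B$. Put $\alpha^C=\alpha_{C^+\setminus\alpha_{C^+}^O}$. An AGHD of $Q_{\mathcal H,\alpha}$ is decomposable (recursively) if there is a subtree $\mathcal T_0$ containing the root whose bags have union $V(-\alpha)$, and for each such $C$ exactly one of the subtrees of $\mathcal T\setminus\mathcal T_0$ is a decomposable AGHD of $Q_{(C^{++},\mathcal E_C),\alpha^C}$. The characteristic hypergraphs $H(\mathcal H,\alpha)$ are the family (one member per position in the recursion) consisting of $$\mathcal H_0=\bigl(V(-\alpha),\{F\in\mathcal E: F\subseteq V(-\alpha)\}\cup\{V(-\alpha)\cap C^{++}: C\}\bigr)$$ and, for every $C$, of the members of $H(\mathcal H_C^+,\alpha^C)$, where $\mathcal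 H_C^+=(C^{++},\mathcal E_C\cup\{V(-\alpha)\cap C^{++}\})$. **Theorem.** 1. Every decomposable AGHD of $Q_{\mathcal H,\alpha}$ is compatible with some ordering $\beta\equiv_{\mathcal H}\alpha$. 2. For every valid AGHD of $Q_{\mathcal H,\alpha}$ there is a decomposable AGHD of $Q_{\mathcal H,\alpha}$ whose $\gamma$-width is no larger, simultaneously for all node-monotone $\gamma$. 3. Let $(\mathcal H_i)_i$ be the characteristic hypergraphs. Any GHDs $G_i$ of the $\mathcal H_i$ can be connected to form a decomposable AGHD $G$ of $Q_{\mathcal H,\alpha}$ (the nodes of $G$ are the disjoint union of the nodes of the $G_i$, with the same bags up to copies and the same tree edges inside each $G_i$). Conversely, the nodes of any decomposable AGHD $G$ of $Q_{\mathcal H,\alpha}$ can be partitioned into subtrees $G_i$ that are GHDs of the $\mathcal H_i$. In both cases $\gamma\text{-width}(G)=\max_i\gamma\text{-width}(G_i)$ for all node-monotone $\gamma$. -/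

import Mathlib

/-! ### Operators, aggregation orderings and queries -/

/-- A family of additive operators on `K` sharing the product, the zero and the one of `K`, such that
each of them forms a commutative semiring with the product (`0` is absorbing and `1` is neutral for
the product by `CommMonoidWithZero K`).  Different indices are different operators. -/
structure OperatorSet (ι K : Type*) [CommMonoidWithZero K] where
  add : ι → K → K → K
  add_assoc : ∀ i x y z, add i (add i x y) z = add i x (add i y z)
  add_comm : ∀ i x y, add i x y = add i y x
  add_zero : ∀ i x, add i x 0 = x
  mul_add : ∀ i x y z, x * add i y z = add i (x * y) (x * z)
  add_injective : Function.Injective add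

instance OperatorSet.instAssociative {ι K : Type*} [CommMonoidWithZero K] (O : OperatorSet ι K)
    (i : ι) : Std.Associative (O.add i) := ⟨O.add_assoc i⟩

instance OperatorSet.instCommutative {ι K : Type*} [CommMonoidWithZero K] (O : OperatorSet ι K)
    (i : ι) : Std.Commutative (O.add i) := ⟨O.add_comm i⟩

/-- An aggregation operator: one of the semiring additions, or the product. -/
inductive AggOp (ι : Type*) where
  | sum (i : ι) : AggOp ι
  | prod : AggOp ι

/-- Sequences of attribute-operator pairs; the head is the outermost aggregation. -/
abbrev AggOrdering (V ι : Type*) := List (V × AggOp ι)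

namespace AggOrdering

variable {V ι : Type*}

/-- The aggregated attributes `V(α)`. -/
def attrs (α : AggOrdering V ι) : Set V := {a | ∃ o, (a, o) ∈ α}

/-- The product attributes `PA(α)`. -/
def productAttrs (α : AggOrdering V ι) : Set V := {a | (a, AggOp.prod) ∈ α}

/-- The semiring attributes: those aggregated by an operator other than the product. -/
def semiringAttrs (α : AggOrdering V ι) : Set V := {a | ∃ i, (a, AggOp.sum i) ∈ α}

open Classical in
/-- The restriction of `α` to the attributes in `s`, in the same order. -/
noncomputable def restrict (α : AggOrdering V ι) (s : Set V) : AggOrdering V ι :=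
  α.filter (fun p => decide (p.1 ∈ s))

/-- `α` is an aggregation ordering on `H`: it aggregates attributes of `H`, each at most once. -/
def IsOrderingOn (α : AggOrdering V ι) (H : Hypergraph V) : Prop :=
  (α.map Prod.fst).Nodup ∧ α.attrs ⊆ H.vertexSet

/-- `a` occurs before `b` in `α`. -/
def Precedes (α : AggOrdering V ι) (a b : V) : Prop := [a, b].Sublist (α.map Prod.fst)

end AggOrdering

section Query

variable {V ι K : Type*} [CommMonoidWithZero K]

/- Annotated relations over an attribute set `F` are functions from the tuples over `F` to `K`, an
absent tuple having annotation `0`.  Every attribute `a` has a finite nonempty domain `D a`.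
Intermediate results are written as functions of a tuple over all attributes; the result does not
depend on the coordinates that are not (or no longer) attributes of the relation. -/

/-- The join of the relations `R F`, for `F` an edge of `H`. -/
noncomputable def joinAnnotation (H : Hypergraph V) {D : V → Type}
    (R : ∀ F : Set V, (∀ a : F, D a) → K) (x : ∀ a, D a) : K :=
  ∏ᶠ F ∈ H.edgeSet, R F (fun a => x a)

open Classical in
/-- Aggregating one attribute. For the product aggregation the factors of absent tuples are `0`. -/
noncomputable def aggregate (O : OperatorSet ι K) {D : V → Type} [∀ a, Fintype (D a)]
    (p : V × AggOp ι) (f : (∀ a, D a) → K) (x : ∀ a, D a) : K :=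
  match p.2 with
  | AggOp.sum i => Finset.univ.fold (O.add i) 0 (fun d : D p.1 => f (Function.update x p.1 d))
  | AggOp.prod => ∏ d : D p.1, f (Function.update x p.1 d)

/-- The query `Q_{H, α}`: the join, followed by the aggregations of `α`, the last one first. -/
noncomputable def ajarQuery (O : OperatorSet ι K) (H : Hypergraph V) (α : AggOrdering V ι)
    {D : V → Type} [∀ a, Fintype (D a)] (R : ∀ F : Set V, (∀ a : F, D a) → K) :
    (∀ a, D a) → K :=
  α.foldr (aggregate O) (joinAnnotation H R)

/-- `α ≡_H β`: both queries have the same output attributes and the same output on every instance. -/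
def OrderEquiv (O : OperatorSet ι K) (H : Hypergraph V) (α β : AggOrdering V ι) : Prop :=
  α.attrs = β.attrs ∧
    ∀ (D : V → Type) [∀ a, Fintype (D a)] [∀ a, Nonempty (D a)]
      (R : ∀ F : Set V, (∀ a : F, D a) → K), ajarQuery O H α R = ajarQuery O H β R

end Query

/-! ### Connectivity -/

section Connectivity

variable {X : Type*}

/-- There is an `r`-path from `a` to `b` all of whose points lie in `U`. -/
def ConnectedIn (r : X → X → Prop) (U : Set X) (a b : X) : Prop :=
  a ∈ U ∧ Relation.ReflTransGen (fun x y => x ∈ U ∧ y ∈ U ∧ r x y) a b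

/-- `S` is nonempty and connected. -/
def IsConnectedSet (r : X → X → Prop) (S : Set X) : Prop :=
  S.Nonempty ∧ ∀ a ∈ S, ∀ b ∈ S, ConnectedIn r S a b

/-- `C` is a connected component of the restriction of `r` to `U`. -/
def IsComponentOf (r : X → X → Prop) (U C : Set X) : Prop :=
  ∃ a ∈ U, C = {b | ConnectedIn r U a b}

end Connectivity

/-! ### Decompositions of hypergraphs -/

/-- A tree with a bag attached to every node. -/
structure BagTree (W N : Type*) where
  tree : SimpleGraph N
  isTree : tree.IsTree
  bag : N → Set W

/-- The subtree of `G` with node set `S` is a generalized hypertree decomposition of `H`. -/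
structure IsGHDOn {W N : Type*} (H : Hypergraph W) (G : BagTree W N) (S : Set N) : Prop where
  subtree : IsConnectedSet G.tree.Adj S
  bag_subset : ∀ t ∈ S, G.bag t ⊆ H.vertexSet
  cover : ∀ F ∈ H.edgeSet, ∃ t ∈ S, F ⊆ G.bag t
  running : ∀ a ∈ H.vertexSet, IsConnectedSet G.tree.Adj {t | t ∈ S ∧ a ∈ G.bag t}

/-- `G` is a generalized hypertree decomposition of `H`. -/
def IsGHD {W N : Type*} (H : Hypergraph W) (G : BagTree W N) : Prop := IsGHDOn H G Set.univ

/-- `γ` is monotone on the sets of attributes of `H`. -/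
def NodeMonotone {V : Type*} (H : Hypergraph V) (γ : Set V → ℝ) : Prop :=
  ∀ A B : Set V, A ⊆ B → B ⊆ H.vertexSet → γ A ≤ γ B

/-- The `γ`-width of the subtree with node set `S`: the maximum of `γ` over its bags. -/
noncomputable def BagTree.widthOn {V N : Type*} (G : BagTree V N) (γ : Set V → ℝ) (S : Set N) : ℝ :=
  ⨆ t : S, γ (G.bag t)

/-- The `γ`-width. -/
noncomputable def BagTree.width {V N : Type*} (G : BagTree V N) (γ : Set V → ℝ) : ℝ :=
  G.widthOn γ Set.univ

/-- A rooted tree whose bags consist of copies `(a, i)` of attributes, with a labelling that says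
which copy of the attribute `a` is used by the edge `F`. -/
structure CopyTree (V N : Type*) extends BagTree (V × ℕ) N where
  root : N
  label : V → Set V → ℕ

/-- The labelling `P` is a product partition: for a product attribute `a`, the edges containing `a`
are partitioned according to their label `P a F`; any other attribute has a single copy. -/
def IsProductPartition {V ι : Type*} (H : Hypergraph V) (α : AggOrdering V ι)
    (P : V → Set V → ℕ) : Prop :=
  ∀ a, a ∉ α.productAttrs → ∀ F ∈ H.edgeSet, ∀ F' ∈ H.edgeSet, a ∈ F → a ∈ F' → P a F = P a F'

/-- The edge `F` with each attribute replaced by the copy that `F` uses. -/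
def copyEdge {V : Type*} (P : V → Set V → ℕ) (F : Set V) : Set (V × ℕ) :=
  (fun a => (a, P a F)) '' F

/-- The product partition hypergraph (every attribute of `H` is meant to lie in some edge). -/
def partitionHypergraph {V : Type*} (H : Hypergraph V) (P : V → Set V → ℕ) : Hypergraph (V × ℕ) where
  vertexSet := ⋃ F ∈ H.edgeSet, copyEdge P F
  edgeSet := copyEdge P '' H.edgeSet
  subset_vertexSet_of_mem_edgeSet' := by
    rintro _ ⟨F, hF, rfl⟩
    exact Set.subset_biUnion_of_mem (u := fun F => copyEdge P F) hF

namespace CopyTree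

variable {V N ι K : Type*}

/-- The same tree, with every copy in a bag replaced by the attribute it is a copy of. -/
def base (G : CopyTree V N) : BagTree V N where
  tree := G.tree
  isTree := G.isTree
  bag := fun t => Prod.fst '' G.bag t

/-- The subtree with node set `S` (and the labelling) is an AGHD for the query given by `H, α`. -/
def IsAGHDOn (H : Hypergraph V) (α : AggOrdering V ι) (G : CopyTree V N) (S : Set N) : Prop :=
  IsProductPartition H α G.label ∧ IsGHDOn (partitionHypergraph H G.label) G.toBagTree S

/-- `G` is an AGHD for the query given by `H, α`. -/
def IsAGHD (H : Hypergraph V) (α : AggOrdering V ι) (G : CopyTree V N) : Prop :=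
  G.IsAGHDOn H α Set.univ

/-- `s` is an ancestor of `t`, or equal to it: it lies on the path from the root to `t`. -/
def AncestorOrEq (G : CopyTree V N) (s t : N) : Prop :=
  ∀ p : G.tree.Walk G.root t, s ∈ p.support

/-- `t` is the topmost node whose bag contains the copy `w`. -/
def IsTop (G : CopyTree V N) (w : V × ℕ) (t : N) : Prop :=
  w ∈ G.bag t ∧ ∀ s, w ∈ G.bag s → G.AncestorOrEq t s

/-- If the top node of some copy of `a` is a proper ancestor of the top node of some copy of another
attribute `b`, then `a` is an output attribute or `a` occurs before `b` in `β`. -/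
def Compatible (G : CopyTree V N) (β : AggOrdering V ι) : Prop :=
  ∀ a b : V, a ≠ b → ∀ (i j : ℕ) (s t : N), G.IsTop (a, i) s → G.IsTop (b, j) t →
    s ≠ t → G.AncestorOrEq s t → a ∉ β.attrs ∨ β.Precedes a b

/-- `G` is an AGHD that is compatible with some ordering equivalent to `α`. -/
def IsValid [CommMonoidWithZero K] (O : OperatorSet ι K) (H : Hypergraph V)
    (α : AggOrdering V ι) (G : CopyTree V N) : Prop :=
  G.IsAGHD H α ∧ ∃ β : AggOrdering V ι, β.IsOrderingOn H ∧ OrderEquiv O H α β ∧ G.Compatible β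

end CopyTree

/-! ### Splitting a query along its components -/

section Splitting

variable {V ι : Type*}

/-- The output attributes `V(-α)`. -/
def outputAttrs (H : Hypergraph V) (α : AggOrdering V ι) : Set V := H.vertexSet \ α.attrs

/-- `C` is a connected component of `H` without the output and the product attributes. -/
def IsQueryComponent (H : Hypergraph V) (α : AggOrdering V ι) (C : Set V) : Prop :=
  IsComponentOf H.Adj (H.vertexSet \ (outputAttrs H α ∪ α.productAttrs)) C

/-- The hypergraph whose edges are the edges of `H` that meet `C`, on the union of these edges. -/
def edgesMeeting (H : Hypergraph V) (C : Set V) : Hypergraph V where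
  vertexSet := ⋃₀ {F | F ∈ H.edgeSet ∧ (F ∩ C).Nonempty}
  edgeSet := {F | F ∈ H.edgeSet ∧ (F ∩ C).Nonempty}
  subset_vertexSet_of_mem_edgeSet' := fun _ hF => Set.subset_sUnion_of_mem hF

/-- `C⁺`: the component `C` with the product attributes that share an edge with it. -/
def componentPlus (H : Hypergraph V) (α : AggOrdering V ι) (C : Set V) : Set V :=
  C ∪ (α.productAttrs ∩ (edgesMeeting H C).vertexSet)

/-- `α^O`. If the first aggregation is a product, only its attribute. Otherwise the attributes `A`
that can be commuted to the beginning: every earlier `B` has the same operator as `A`, or `A` and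
`B` are not connected through semiring attributes that are not earlier than `B`. -/
def frontAttrs (H : Hypergraph V) (α : AggOrdering V ι) : Set V :=
  match α with
  | [] => ∅
  | (a, AggOp.prod) :: _ => {a}
  | (a, AggOp.sum i) :: l =>
    {A | ∃ o, (A, o) ∈ (a, AggOp.sum i) :: l ∧
      ∀ (l₁ l₂ : AggOrdering V ι) (B : V) (o' : AggOp ι),
        (a, AggOp.sum i) :: l = l₁ ++ (B, o') :: l₂ → (A, o) ∈ l₂ →
          o' = o ∨
          ¬ ConnectedIn H.Adj (AggOrdering.semiringAttrs ((B, o') :: l₂) ∪ {A, B}) A B}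

/-- The ordering of the query attached to the component `C`: `α` on `C⁺`, without `(α_{C⁺})^O`. -/
noncomputable def componentOrdering (H : Hypergraph V) (α : AggOrdering V ι) (C : Set V) :
    AggOrdering V ι :=
  α.restrict (componentPlus H α C \ frontAttrs H (α.restrict (componentPlus H α C)))

/-- The decomposable AGHDs: `IsDecomposableOn G H α S r` says that the subtree of `G` with node set
`S` and root `r` is a decomposable AGHD for the query given by `H, α`.  Here `T₀` is a subtree that
contains the root and whose bags have the output attributes as their union, and `sub C hC`, with
root `rt C hC`, is the subtree in `S \ T₀` that belongs to the component `C`; it is the only one in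
which attributes of `C` occur. -/
inductive IsDecomposableOn {N : Type*} (G : CopyTree V N) :
    Hypergraph V → AggOrdering V ι → Set N → N → Prop
  | intro (H : Hypergraph V) (α : AggOrdering V ι) (S : Set N) (r : N) (T₀ : Set N)
      (aghd : G.IsAGHDOn H α S)
      (T₀_subset : T₀ ⊆ S) (root_mem : r ∈ T₀) (T₀_connected : IsConnectedSet G.tree.Adj T₀)
      (T₀_bags : ⋃ t ∈ T₀, G.base.bag t = outputAttrs H α)
      (sub : ∀ C, IsQueryComponent H α C → Set N) (rt : ∀ C, IsQueryComponent H α C → N)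
      (sub_component : ∀ C hC, IsComponentOf G.tree.Adj (S \ T₀) (sub C hC))
      (sub_root : ∀ C hC, rt C hC ∈ sub C hC ∧ ∃ g ∈ T₀, G.tree.Adj g (rt C hC))
      (sub_unique : ∀ C hC B, IsComponentOf G.tree.Adj (S \ T₀) B →
        (∃ t ∈ B, ∃ a ∈ C, a ∈ G.base.bag t) → B = sub C hC)
      (sub_decomposable : ∀ C hC, IsDecomposableOn G (edgesMeeting H C)
        (componentOrdering H α C) (sub C hC) (rt C hC)) :
      IsDecomposableOn G H α S r

/-- `G` is a decomposable AGHD for the query given by `H, α`. -/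
def CopyTree.IsDecomposable {N : Type*} (H : Hypergraph V) (α : AggOrdering V ι)
    (G : CopyTree V N) : Prop :=
  IsDecomposableOn G H α Set.univ G.root

/-! ### Characteristic hypergraphs -/

/-- The output attributes that lie in edges meeting the component `C`. -/
def interfaceEdge (H : Hypergraph V) (α : AggOrdering V ι) (C : Set V) : Set V :=
  outputAttrs H α ∩ (edgesMeeting H C).vertexSet

/-- `H₀`: the output attributes with the edges inside them and the interface edges. -/
def outputHypergraph (H : Hypergraph V) (α : AggOrdering V ι) : Hypergraph V where
  vertexSet := outputAttrs H α
  edgeSet := {F | F ∈ H.edgeSet ∧ F ⊆ outputAttrs H α} ∪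
    {F | ∃ C, IsQueryComponent H α C ∧ F = interfaceEdge H α C}
  subset_vertexSet_of_mem_edgeSet' := by
    rintro F (⟨_, hF⟩ | ⟨C, _, rfl⟩)
    · exact hF
    · exact Set.inter_subset_left

/-- `H_C⁺`: the edges that meet `C`, and the interface edge of `C`. -/
def componentHypergraph (H : Hypergraph V) (α : AggOrdering V ι) (C : Set V) : Hypergraph V where
  vertexSet := (edgesMeeting H C).vertexSet
  edgeSet := (edgesMeeting H C).edgeSet ∪ {interfaceEdge H α C}
  subset_vertexSet_of_mem_edgeSet' := by
    rintro F (hF | rfl)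
    · exact (edgesMeeting H C).subset_vertexSet_of_mem_edgeSet' hF
    · exact Set.inter_subset_right

/-- The characteristic hypergraphs form a family, indexed by the positions in the recursion: a
position is the list of the components chosen successively. -/
def IsCharPosition (H : Hypergraph V) (α : AggOrdering V ι) : List (Set V) → Prop
  | [] => True
  | C :: l => IsQueryComponent H α C ∧
      IsCharPosition (componentHypergraph H α C) (componentOrdering H α C) l

/-- The characteristic hypergraph at a position. -/
noncomputable def charHypergraph (H : Hypergraph V) (α : AggOrdering V ι) : List (Set V) → Hypergraph V
  | [] => outputHypergraph H α
  | C :: l => charHypergraph (componentHypergraph H α C) (componentOrdering H α C) l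

/-- The index set of the family of characteristic hypergraphs. -/
abbrev CharIndex (H : Hypergraph V) (α : AggOrdering V ι) : Type _ :=
  {l : List (Set V) // IsCharPosition H α l}

end Splitting

/-! Two facts about orderings carry the proof. The first is commutation. Neighbouring aggregations
may be exchanged if they use the same operator, or if their attributes are not connected through the
semiring attributes aggregated inside them (`ajarQuery_swap`). In the second case the inner result
is a product of two factors, each independent of one of the two attributes. A product aggregation
distributes over both factors, and by idempotence a factor without the attribute is unaffected, so
only semiring attributes can obstruct the factorization. Hence an ordering may be permuted as long
as all `Forced` pairs keep their order (`ajarQuery_eq_of_perm`).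

The second fact is rigidity. Let the attributes of a connected set `U` take two values, and let the
join be supported on the two constant tuples, with annotations `p` and `q`. If all attributes of `U`
except the outermost one are semiring attributes, the query returns the outermost operator applied
to `p` and `q`; if a product lies further inside, it returns `0`. So equivalent orderings have the
same operator at the first attribute of `U`, and they agree on whether the only product attribute of
`U` comes first (`OrderEquiv.sameOp_of_first`, `OrderEquiv.isFirst_product_iff`).

Decomposable AGHDs are compatible with an equivalent ordering: rational ranks are built along the
recursion which increase along `Above` (the order of topmost nodes) and along `Forced`; sorting `α`
by rank gives the ordering. Neither relation leads from the rest of a component to its front, and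
forced pairs of the rest stay forced in the smaller query (`IsAdmissible.forced_sub`). A product
attribute may belong to several components, so its rank is prescribed in advance; a semiring
attribute belongs to only one, so the ranks of the components fit together
(`IsDecomposableOn.exists_rank`).

Partition and gluing: the interface edge of a component lies in the bags at both ends of the tree
edge that leads to its subtree, so cutting these edges leaves GHDs of the characteristic hypergraphs
(`IsDecomposableOn.exists_partition`). Conversely, GHDs are joined at bags that contain the
interface edges, and the copies of an attribute are numbered by the position at which it becomes an
output attribute (`exists_gluing`).

From valid to decomposable: every characteristic hypergraph has a GHD on the given tree with smaller
bags (`IsValidBelow.exists_isGHD`), and these are glued. The point is that the topmost node that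
meets a component `C` contains its whole interface edge. If a copy of an interface attribute `y`
began strictly below that node, compatibility would put an attribute of `C` before `y`, which
rigidity excludes (`SameFirst.not_precedes_front`). -/

open AggOrdering

/-! ### Connected sets -/

section ConnectedSets

variable {X : Type*} {r r' : X → X → Prop} {U W S T : Set X} {a b c : X}

theorem ConnectedIn.right_mem (h : ConnectedIn r U a b) : b ∈ U := by
  obtain ⟨ha, h⟩ := h
  cases h with
  | refl => exact ha
  | tail _ h => exact h.2.1

theorem ConnectedIn.refl (ha : a ∈ U) : ConnectedIn r U a a := ⟨ha, .refl⟩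

theorem ConnectedIn.trans (h : ConnectedIn r U a b) (h' : ConnectedIn r U b c) :
    ConnectedIn r U a c := ⟨h.1, h.2.trans h'.2⟩

theorem ConnectedIn.of_rel (ha : a ∈ U) (hb : b ∈ U) (h : r a b) : ConnectedIn r U a b :=
  ⟨ha, .single ⟨ha, hb, h⟩⟩

theorem ConnectedIn.symm (hr : ∀ x y, r x y → r y x) (h : ConnectedIn r U a b) :
    ConnectedIn r U b a := by
  refine ⟨h.right_mem, ?_⟩
  have : ∀ x, Relation.ReflTransGen (fun x y => x ∈ U ∧ y ∈ U ∧ r x y) a x →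
      Relation.ReflTransGen (fun x y => x ∈ U ∧ y ∈ U ∧ r x y) x a := by
    intro x hx
    induction hx with
    | refl => exact .refl
    | tail _ h ih => exact .head ⟨h.2.1, h.1, hr _ _ h.2.2⟩ ih
  exact this b h.2

theorem ConnectedIn.mono (h : ConnectedIn r U a b) (hUW : U ⊆ W)
    (hr : ∀ x ∈ U, ∀ y ∈ U, r x y → r' x y) : ConnectedIn r' W a b :=
  ⟨hUW h.1, Relation.ReflTransGen.mono
    (fun x y hxy => ⟨hUW hxy.1, hUW hxy.2.1, hr x hxy.1 y hxy.2.1 hxy.2.2⟩) _ _ h.2⟩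

theorem ConnectedIn.subset (h : ConnectedIn r U a b) (hUW : U ⊆ W) : ConnectedIn r W a b :=
  h.mono hUW fun _ _ _ _ h => h

theorem ConnectedIn.mem_of_closed (h : ConnectedIn r U a b) (Z : Set X) (ha : a ∈ Z)
    (hZ : ∀ x ∈ Z, x ∈ U → ∀ y ∈ U, r x y → y ∈ Z) : b ∈ Z := by
  obtain ⟨_, h⟩ := h
  induction h with
  | refl => exact ha
  | tail _ h ih => exact hZ _ ih h.1 _ h.2.1 h.2.2

theorem ConnectedIn.inter_of_closed (h : ConnectedIn r U a b) (Z : Set X) (ha : a ∈ Z)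
    (hZ : ∀ x ∈ Z, x ∈ U → ∀ y ∈ U, r x y → y ∈ Z) : ConnectedIn r (U ∩ Z) a b :=
  h.mem_of_closed {x | ConnectedIn r (U ∩ Z) a x} (.refl ⟨h.1, ha⟩) fun x hx hxU y hy hxy =>
    ConnectedIn.trans hx (.of_rel hx.right_mem ⟨hy, hZ x hx.right_mem.2 hxU y hy hxy⟩ hxy)

theorem IsConnectedSet.of_center (hr : ∀ x y, r x y → r y x) (h : ∀ b ∈ S, ConnectedIn r S a b)
    (ha : a ∈ S) : IsConnectedSet r S :=
  ⟨⟨a, ha⟩, fun x hx y hy => ((h x hx).symm hr).trans (h y hy)⟩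

theorem IsConnectedSet.union (hr : ∀ x y, r x y → r y x) (hS : IsConnectedSet r S)
    (hT : IsConnectedSet r T) (h : (S ∩ T).Nonempty) : IsConnectedSet r (S ∪ T) := by
  obtain ⟨a, haS, haT⟩ := h
  refine .of_center hr (a := a) ?_ (Or.inl haS)
  rintro b (hb | hb)
  · exact (hS.2 a haS b hb).subset Set.subset_union_left
  · exact (hT.2 a haT b hb).subset Set.subset_union_right

theorem IsConnectedSet.mono_rel (hS : IsConnectedSet r S)
    (hr : ∀ x ∈ S, ∀ y ∈ S, r x y → r' x y) : IsConnectedSet r' S :=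
  ⟨hS.1, fun a ha b hb => (hS.2 a ha b hb).mono subset_rfl hr⟩

theorem isConnectedSet_singleton (a : X) : IsConnectedSet r {a} :=
  ⟨⟨a, rfl⟩, by rintro _ rfl _ rfl; exact .refl rfl⟩

theorem IsConnectedSet.insert (hr : ∀ x y, r x y → r y x) (hS : IsConnectedSet r S)
    (hb : b ∈ S) (h : r b a) : IsConnectedSet r (insert a S) := by
  refine .of_center hr (a := b) ?_ (Or.inr hb)
  rintro c (rfl | hc)
  · exact .of_rel (Or.inr hb) (Or.inl rfl) h
  · exact (hS.2 b hb c hc).subset (Set.subset_insert _ _)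

theorem isComponentOf_iff (hr : ∀ x y, r x y → r y x) : IsComponentOf r U S ↔
    IsConnectedSet r S ∧ S ⊆ U ∧ ∀ x ∈ S, ∀ y ∈ U, r x y → y ∈ S := by
  constructor
  · rintro ⟨a, ha, rfl⟩
    refine ⟨.of_center hr (a := a) (fun b hb => ?_) (.refl ha), fun b hb => hb.right_mem,
      fun x hx y hy hxy => ConnectedIn.trans hx (.of_rel hx.right_mem hy hxy)⟩
    have := ConnectedIn.inter_of_closed hb {b | ConnectedIn r U a b} (.refl ha)
      fun x hx hxU y hy hxy => ConnectedIn.trans hx (.of_rel hxU hy hxy)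
    exact this.subset Set.inter_subset_right
  · rintro ⟨⟨⟨a, ha⟩, hS⟩, hSU, hcl⟩
    refine ⟨a, hSU ha, Set.ext fun b => ⟨fun hb => (hS a ha b hb).subset hSU, fun hb => ?_⟩⟩
    exact hb.mem_of_closed S ha fun x hx _ y hy hxy => hcl x hx y hy hxy

theorem exists_isComponentOf (ha : a ∈ U) : ∃ C, IsComponentOf r U C ∧ a ∈ C :=
  ⟨_, ⟨a, ha, rfl⟩, .refl ha⟩

theorem IsConnectedSet.subset_of_closed (hS : IsConnectedSet r S) (ha : a ∈ S) (ha' : a ∈ T)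
    (hT : ∀ x ∈ T, ∀ y ∈ S, r x y → y ∈ T) : S ⊆ T := fun b hb =>
  (hS.2 a ha b hb).mem_of_closed T ha' fun x hx _ y hy hxy => hT x hx y hy hxy

theorem IsComponentOf.subset_of_connected (hr : ∀ x y, r x y → r y x) (hT : IsComponentOf r U T)
    (hS : IsConnectedSet r S) (hSU : S ⊆ U) (h : (S ∩ T).Nonempty) : S ⊆ T := by
  obtain ⟨a, haS, haT⟩ := h
  exact hS.subset_of_closed haS haT fun x hx y hy hxy =>
    ((isComponentOf_iff hr).1 hT).2.2 x hx y (hSU hy) hxy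

theorem IsComponentOf.eq_of_inter_nonempty (hr : ∀ x y, r x y → r y x) (hS : IsComponentOf r U S)
    (hT : IsComponentOf r U T) (h : (S ∩ T).Nonempty) : S = T := by
  have hS' := (isComponentOf_iff hr).1 hS
  have hT' := (isComponentOf_iff hr).1 hT
  exact (hT.subset_of_connected hr hS'.1 hS'.2.1 h).antisymm
    (hS.subset_of_connected hr hT'.1 hT'.2.1 (by rwa [Set.inter_comm]))

end ConnectedSets

/-! ### Subtrees -/

section Subtrees

variable {N : Type*} {T : SimpleGraph N} {S S' : Set N}

theorem connectedIn_iff_exists_walk {a b : N} :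
    ConnectedIn T.Adj S a b ↔ ∃ p : T.Walk a b, ∀ x ∈ p.support, x ∈ S := by
  constructor
  · intro h
    refine h.mem_of_closed {b | ∃ p : T.Walk a b, ∀ x ∈ p.support, x ∈ S}
      ⟨.nil, by simpa using h.1⟩ ?_
    rintro x ⟨p, hp⟩ - y hy hxy
    refine ⟨p.concat hxy, fun z hz => ?_⟩
    rw [SimpleGraph.Walk.support_concat] at hz
    rcases (by simpa using hz : z ∈ p.support ∨ z = y) with hz | rfl
    · exact hp z hz
    · exact hy
  · rintro ⟨p, hp⟩
    induction p with
    | nil => exact .refl (hp _ (by simp))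
    | cons h p ih =>
      have := ih fun x hx => hp x (by simp [hx])
      exact ConnectedIn.trans (.of_rel (hp _ (by simp)) this.1 h) this

theorem SimpleGraph.IsTree.path_eq (hT : T.IsTree) {a b : N} {p q : T.Walk a b} (hp : p.IsPath)
    (hq : q.IsPath) : p = q :=
  congrArg Subtype.val ((hT.isAcyclic.subsingleton_path a b).elim ⟨p, hp⟩ ⟨q, hq⟩)

theorem SimpleGraph.IsTree.support_subset (hT : T.IsTree) {a b : N} {p : T.Walk a b}
    (hp : p.IsPath) (q : T.Walk a b) : p.support ⊆ q.support := by
  classical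
  rw [hT.path_eq hp q.bypass_isPath]
  exact q.support_bypass_subset_support

theorem SimpleGraph.IsTree.exists_isPath (hT : T.IsTree) (a b : N) :
    ∃ p : T.Walk a b, p.IsPath := by
  obtain ⟨p, hp, -⟩ := hT.existsUnique_path a b
  exact ⟨p, hp⟩

/-- In a tree the path between two nodes runs inside every walk between them, hence inside both
subtrees. -/
theorem IsConnectedSet.inter (hT : T.IsTree) (hS : IsConnectedSet T.Adj S)
    (hS' : IsConnectedSet T.Adj S') (h : (S ∩ S').Nonempty) : IsConnectedSet T.Adj (S ∩ S') := by
  refine ⟨h, fun a ha b hb => ?_⟩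
  obtain ⟨p, hp⟩ := hT.exists_isPath a b
  obtain ⟨q, hq⟩ := connectedIn_iff_exists_walk.1 (hS.2 a ha.1 b hb.1)
  obtain ⟨q', hq'⟩ := connectedIn_iff_exists_walk.1 (hS'.2 a ha.2 b hb.2)
  exact connectedIn_iff_exists_walk.2 ⟨p, fun x hx =>
    ⟨hq x (hT.support_subset hp q hx), hq' x (hT.support_subset hp q' hx)⟩⟩

theorem isConnectedSet_univ (hT : T.IsTree) : IsConnectedSet T.Adj Set.univ := by
  obtain ⟨a⟩ := hT.connected.nonempty
  refine ⟨⟨a, trivial⟩, fun a _ b _ => connectedIn_iff_exists_walk.2 ?_⟩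
  obtain ⟨p, -⟩ := hT.exists_isPath a b
  exact ⟨p, fun _ _ => trivial⟩

end Subtrees

/-! ### Ancestors -/

namespace CopyTree

variable {V N : Type*} {G : CopyTree V N} {r s t u : N}

theorem ancestorOrEq_refl (G : CopyTree V N) (s : N) : G.AncestorOrEq s s :=
  fun p => p.end_mem_support

theorem root_ancestorOrEq (G : CopyTree V N) (s : N) : G.AncestorOrEq G.root s :=
  fun p => p.start_mem_support

theorem AncestorOrEq.trans (h : G.AncestorOrEq s t) (h' : G.AncestorOrEq t u) :
    G.AncestorOrEq s u := fun p => by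
  classical
  exact p.support_takeUntil_subset_support (h' p) (h (p.takeUntil t (h' p)))

theorem ancestorOrEq_of_isPath {p : G.tree.Walk G.root t} (hp : p.IsPath) (hs : s ∈ p.support) :
    G.AncestorOrEq s t := fun q => G.isTree.support_subset hp q hs

theorem AncestorOrEq.dist_lt (h : G.AncestorOrEq s t) (hne : s ≠ t) :
    G.tree.dist G.root s < G.tree.dist G.root t := by
  classical
  obtain ⟨p, hp⟩ := G.isTree.connected.exists_walk_length_eq_dist G.root t
  rw [← hp]
  exact (SimpleGraph.dist_le _).trans_lt (p.length_takeUntil_lt_length (h p) hne)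

theorem AncestorOrEq.antisymm (h : G.AncestorOrEq s t) (h' : G.AncestorOrEq t s) : s = t := by
  by_contra hne
  exact (h.dist_lt hne).asymm (h'.dist_lt (Ne.symm hne))

theorem ancestorOrEq_of_mem_dropUntil [DecidableEq N] {p : G.tree.Walk G.root t} (hp : p.IsPath)
    (hs : s ∈ p.support) (hu : u ∈ (p.dropUntil s hs).support) : G.AncestorOrEq s u := by
  have h : ((p.takeUntil s hs).append ((p.dropUntil s hs).takeUntil u hu)).IsPath := by
    rw [← p.take_spec hs, ← (p.dropUntil s hs).take_spec hu, SimpleGraph.Walk.append_assoc] at hp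
    exact hp.of_append_left
  exact ancestorOrEq_of_isPath h (by simp)

/-- All ancestors of `u` lie on the single path from the root to `u`. -/
theorem AncestorOrEq.total (h : G.AncestorOrEq s u) (h' : G.AncestorOrEq t u) :
    G.AncestorOrEq s t ∨ G.AncestorOrEq t s := by
  classical
  obtain ⟨p, hp⟩ := G.isTree.exists_isPath G.root u
  have ht := h' p
  rw [← p.take_spec (h p), SimpleGraph.Walk.mem_support_append_iff] at ht
  rcases ht with ht | ht
  · exact Or.inr (ancestorOrEq_of_isPath (hp.takeUntil (h p)) ht)
  · exact Or.inl (ancestorOrEq_of_mem_dropUntil hp (h p) ht)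

theorem ancestorOrEq_or_of_adj (h : G.tree.Adj s t) : G.AncestorOrEq s t ∨ G.AncestorOrEq t s := by
  obtain ⟨p, hp⟩ := G.isTree.exists_isPath G.root s
  by_cases ht : t ∈ p.support
  · exact Or.inr (ancestorOrEq_of_isPath hp ht)
  · exact Or.inl (ancestorOrEq_of_isPath (hp.concat ht h) (by simp [SimpleGraph.Walk.support_concat]))

theorem isConnectedSet_descendants (G : CopyTree V N) (r : N) :
    IsConnectedSet G.tree.Adj {t | G.AncestorOrEq r t} := by
  classical
  refine .of_center (a := r) (fun _ _ h => h.symm) (fun t ht => ?_) (G.ancestorOrEq_refl r)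
  obtain ⟨p, hp⟩ := G.isTree.exists_isPath G.root t
  exact connectedIn_iff_exists_walk.2
    ⟨p.dropUntil r (ht p), fun x hx => ancestorOrEq_of_mem_dropUntil hp (ht p) hx⟩

/-- The path from the root to `s`, continued to `t` inside `S`, has to pass `r`; on its first part
it can meet `r` only if `r = s`. -/
theorem AncestorOrEq.mem_of_between {S : Set N} (h : G.AncestorOrEq s r) (h' : G.AncestorOrEq r t)
    (hS : IsConnectedSet G.tree.Adj S) (hs : s ∈ S) (ht : t ∈ S) : r ∈ S := by
  obtain ⟨q, hq⟩ := connectedIn_iff_exists_walk.1 (hS.2 s hs t ht)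
  obtain ⟨p, hp⟩ := G.isTree.exists_isPath G.root s
  have hr := h' (p.append q)
  rw [SimpleGraph.Walk.mem_support_append_iff] at hr
  rcases hr with hr | hr
  · rwa [(ancestorOrEq_of_isPath hp hr).antisymm h]
  · exact hq r hr

/-- A connected set of nodes has a topmost node. -/
theorem exists_top {S : Set N} (hS : IsConnectedSet G.tree.Adj S) :
    ∃ r ∈ S, ∀ t ∈ S, G.AncestorOrEq r t := by
  obtain ⟨r, hr, hmin⟩ := WellFounded.has_min
    (InvImage.wf (fun t => G.tree.dist G.root t) wellFounded_lt) S hS.1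
  refine ⟨r, hr, fun t ht => ?_⟩
  refine (hS.2 r hr t ht).mem_of_closed {t | G.AncestorOrEq r t} (G.ancestorOrEq_refl r) ?_
  intro x hx _ y hy hxy
  rcases ancestorOrEq_or_of_adj hxy with h | h
  · exact AncestorOrEq.trans hx h
  -- Here `y` is above `x`, hence comparable with `r`; it cannot be strictly above `r`, the node of
  -- `S` nearest to the root.
  · rcases AncestorOrEq.total hx h with h' | h'
    · exact h'
    · by_cases hyr : y = r
      · exact hyr ▸ G.ancestorOrEq_refl r
      · exact absurd (h'.dist_lt hyr) (hmin y hy)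

end CopyTree

/-! ### Orderings -/

namespace AggOrdering

variable {V ι : Type*} {α : AggOrdering V ι} {a b c : V} {o o' : AggOp ι} {s U : Set V}

theorem mem_attrs_iff : a ∈ α.attrs ↔ a ∈ α.map Prod.fst := by
  simp [attrs]

theorem mem_attrs_cons : a ∈ attrs ((b, o) :: α) ↔ a = b ∨ a ∈ α.attrs := by
  simp [mem_attrs_iff]

theorem semiringAttrs_subset : α.semiringAttrs ⊆ α.attrs := fun _ ⟨_, h⟩ => ⟨_, h⟩

theorem productAttrs_subset : α.productAttrs ⊆ α.attrs := fun _ h => ⟨_, h⟩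

theorem mem_attrs_cases (h : a ∈ α.attrs) : a ∈ α.semiringAttrs ∨ a ∈ α.productAttrs := by
  obtain ⟨o, h⟩ := h
  cases o with
  | sum i => exact Or.inl ⟨i, h⟩
  | prod => exact Or.inr h

theorem op_eq (hα : (α.map Prod.fst).Nodup) (h : (a, o) ∈ α) (h' : (a, o') ∈ α) : o = o' :=
  congrArg Prod.snd (List.inj_on_of_nodup_map hα h h' rfl)

theorem notMem_productAttrs (hα : (α.map Prod.fst).Nodup) (h : a ∈ α.semiringAttrs) :
    a ∉ α.productAttrs := fun h' => by
  obtain ⟨i, h⟩ := h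
  cases op_eq hα h h'

theorem precedes_cons : Precedes ((c, o) :: α) a b ↔ (a = c ∧ b ∈ α.attrs) ∨ α.Precedes a b := by
  rw [Precedes, List.map_cons, List.cons_sublist_cons', mem_attrs_iff, Precedes,
    List.singleton_sublist, or_comm]

theorem Precedes.left_mem (h : α.Precedes a b) : a ∈ α.attrs :=
  mem_attrs_iff.2 (h.subset (by simp))

theorem Precedes.right_mem (h : α.Precedes a b) : b ∈ α.attrs :=
  mem_attrs_iff.2 (h.subset (by simp))

theorem Precedes.ne (hα : (α.map Prod.fst).Nodup) (h : α.Precedes a b) : a ≠ b := by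
  rintro rfl
  simpa using hα.sublist h

theorem nodup_cons (hα : (List.map Prod.fst ((c, o) :: α)).Nodup) :
    c ∉ α.attrs ∧ (α.map Prod.fst).Nodup := by
  rw [mem_attrs_iff]
  simpa using hα

theorem Precedes.trans (hα : (α.map Prod.fst).Nodup) (h : α.Precedes a b) (h' : α.Precedes b c) :
    α.Precedes a c := by
  induction α with
  | nil => cases h
  | cons p α ih =>
    obtain ⟨d, o⟩ := p
    obtain ⟨hd, hα⟩ := nodup_cons hα
    rw [precedes_cons] at h h' ⊢
    rcases h with ⟨rfl, hb⟩ | h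
    · rcases h' with ⟨rfl, hc⟩ | h'
      · exact absurd hb hd
      · exact Or.inl ⟨rfl, h'.right_mem⟩
    · rcases h' with ⟨rfl, hc⟩ | h'
      · exact absurd h.right_mem hd
      · exact Or.inr (ih hα h h')

theorem Precedes.asymm (hα : (α.map Prod.fst).Nodup) (h : α.Precedes a b) : ¬ α.Precedes b a :=
  fun h' => (h.trans hα h').ne hα rfl

theorem precedes_total (ha : a ∈ α.attrs) (hb : b ∈ α.attrs) (hne : a ≠ b) :
    α.Precedes a b ∨ α.Precedes b a := by
  induction α with
  | nil => simp [mem_attrs_iff] at ha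
  | cons p α ih =>
    obtain ⟨d, o⟩ := p
    simp only [precedes_cons]
    rw [mem_attrs_cons] at ha hb
    grind

theorem nodup_sublist {β : AggOrdering V ι} (h : β.Sublist α) (hα : (α.map Prod.fst).Nodup) :
    (β.map Prod.fst).Nodup := hα.sublist (h.map _)

theorem Precedes.of_sublist {β : AggOrdering V ι} (h : β.Sublist α) (hb : β.Precedes a b) :
    α.Precedes a b := List.Sublist.trans hb (h.map _)

theorem precedes_of_sublist {β : AggOrdering V ι} (hα : (α.map Prod.fst).Nodup) (h : β.Sublist α)
    (ha : a ∈ β.attrs) (hb : b ∈ β.attrs) (hab : α.Precedes a b) : β.Precedes a b := by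
  rcases precedes_total ha hb (hab.ne hα) with h' | h'
  · exact h'
  · exact absurd (h'.of_sublist h) (hab.asymm hα)

theorem precedes_of_split {l₁ l₂ : AggOrdering V ι} (hα : (α.map Prod.fst).Nodup)
    (h : α = l₁ ++ (b, o) :: l₂) : α.Precedes b a ↔ a ∈ attrs l₂ := by
  subst h
  constructor
  · intro h
    induction l₁ with
    | nil =>
      rcases precedes_cons.1 h with h | h
      · exact h.2
      · exact h.right_mem
    | cons p l₁ ih =>
      obtain ⟨hp, hα⟩ := nodup_cons (c := p.1) (o := p.2) hα
      rcases precedes_cons.1 h with h | h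
      · exact absurd (mem_attrs_iff.2 (by simp [h.1])) hp
      · exact ih hα h
  · intro h
    exact (precedes_cons.2 (Or.inl ⟨rfl, h⟩) : Precedes ((b, o) :: l₂) b a).of_sublist
      (List.sublist_append_right _ _)

theorem mem_restrict {p : V × AggOp ι} : p ∈ α.restrict s ↔ p ∈ α ∧ p.1 ∈ s := by
  simp [restrict]

theorem restrict_sublist (α : AggOrdering V ι) (s : Set V) : (α.restrict s).Sublist α :=
  List.filter_sublist

theorem mem_attrs_restrict : a ∈ (α.restrict s).attrs ↔ a ∈ α.attrs ∧ a ∈ s := by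
  simp [attrs, mem_restrict]

theorem mem_semiringAttrs_restrict :
    a ∈ (α.restrict s).semiringAttrs ↔ a ∈ α.semiringAttrs ∧ a ∈ s := by
  simp [semiringAttrs, mem_restrict]

theorem mem_productAttrs_restrict :
    a ∈ (α.restrict s).productAttrs ↔ a ∈ α.productAttrs ∧ a ∈ s := by
  simp [productAttrs, mem_restrict]

theorem nodup_restrict (hα : (α.map Prod.fst).Nodup) (s : Set V) :
    ((α.restrict s).map Prod.fst).Nodup := nodup_sublist (restrict_sublist α s) hα

theorem precedes_restrict (hα : (α.map Prod.fst).Nodup) :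
    (α.restrict s).Precedes a b ↔ α.Precedes a b ∧ a ∈ s ∧ b ∈ s := by
  constructor
  · intro h
    exact ⟨h.of_sublist (restrict_sublist _ _), (mem_attrs_restrict.1 h.left_mem).2,
      (mem_attrs_restrict.1 h.right_mem).2⟩
  · rintro ⟨h, ha, hb⟩
    exact precedes_of_sublist hα (restrict_sublist _ _) (mem_attrs_restrict.2 ⟨h.left_mem, ha⟩)
      (mem_attrs_restrict.2 ⟨h.right_mem, hb⟩) h

/-- `a` is the first attribute of `α` in `U`. -/
def IsFirst (α : AggOrdering V ι) (U : Set V) (a : V) : Prop :=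
  a ∈ U ∧ a ∈ α.attrs ∧ ∀ b ∈ U, b ∈ α.attrs → b ≠ a → α.Precedes a b

theorem exists_isFirst (h : (U ∩ α.attrs).Nonempty) : ∃ a, α.IsFirst U a := by
  induction α with
  | nil => obtain ⟨a, -, ha⟩ := h; simp [mem_attrs_iff] at ha
  | cons p α ih =>
    obtain ⟨d, o⟩ := p
    by_cases hd : d ∈ U
    · refine ⟨d, hd, mem_attrs_cons.2 (Or.inl rfl), fun b _ hb hne => precedes_cons.2 ?_⟩
      exact Or.inl ⟨rfl, (mem_attrs_cons.1 hb).resolve_left hne⟩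
    · obtain ⟨a, ha, ha'⟩ := h
      obtain ⟨c, hc, hc', hc''⟩ := ih
        ⟨a, ha, (mem_attrs_cons.1 ha').resolve_left (by rintro rfl; exact hd ha)⟩
      refine ⟨c, hc, mem_attrs_cons.2 (Or.inr hc'), fun b hbU hb hne => precedes_cons.2 ?_⟩
      exact Or.inr (hc'' b hbU ((mem_attrs_cons.1 hb).resolve_left (by rintro rfl; exact hd hbU)) hne)

theorem IsFirst.unique (hα : (α.map Prod.fst).Nodup) (ha : α.IsFirst U a) (hb : α.IsFirst U b) :
    a = b := by
  by_contra h
  exact (ha.2.2 b hb.1 hb.2.1 (Ne.symm h)).asymm hα (hb.2.2 a ha.1 ha.2.1 h)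

theorem IsFirst.mono {W : Set V} (h : α.IsFirst U a) (hW : W ⊆ U) (ha : a ∈ W) : α.IsFirst W a :=
  ⟨ha, h.2.1, fun b hb => h.2.2 b (hW hb)⟩

/-- `a` and `b` are aggregated by the same operator. -/
def SameOp (α : AggOrdering V ι) (a b : V) : Prop := ∃ o, (a, o) ∈ α ∧ (b, o) ∈ α

/-- The semiring attributes after `b`. -/
def semiringAfter (α : AggOrdering V ι) (b : V) : Set V :=
  {s | s ∈ α.semiringAttrs ∧ α.Precedes b s}

theorem semiringAttrs_of_split {l₁ l₂ : AggOrdering V ι} (hα : (α.map Prod.fst).Nodup)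
    (h : α = l₁ ++ (b, o) :: l₂) : l₂.semiringAttrs = α.semiringAfter b := by
  ext s
  constructor
  · rintro ⟨i, hi⟩
    exact ⟨⟨i, by simp [h, hi]⟩, (precedes_of_split hα h).2 ⟨_, hi⟩⟩
  · rintro ⟨⟨i, hi⟩, hs⟩
    obtain ⟨o', ho'⟩ := (precedes_of_split hα h).1 hs
    refine ⟨i, ?_⟩
    rwa [op_eq hα hi (o' := o') (by simp [h, ho'])]

theorem exists_split (h : (a, o) ∈ α) : ∃ l₁ l₂ : AggOrdering V ι, α = l₁ ++ (a, o) :: l₂ :=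
  List.append_of_mem h

end AggOrdering

/-! ### The front of an ordering -/

section Front

variable {V ι : Type*} {H : Hypergraph V} {α : AggOrdering V ι} {a A : V} {i : ι}

theorem mem_frontAttrs_sum {l : AggOrdering V ι} (h : α = (a, AggOp.sum i) :: l)
    (hα : (α.map Prod.fst).Nodup) :
    A ∈ frontAttrs H α ↔ A ∈ α.attrs ∧ ∀ B, α.Precedes B A → α.SameOp B A ∨
      ¬ ConnectedIn H.Adj (α.semiringAfter B ∪ {A, B}) A B := by
  -- Since `B` is in the set anyway, it does not matter whether `B` itself is counted among the
  -- semiring attributes.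
  have key : ∀ (l₁ l₂ : AggOrdering V ι) (B : V) (o' : AggOp ι), α = l₁ ++ (B, o') :: l₂ →
      semiringAttrs ((B, o') :: l₂) ∪ {A, B} = α.semiringAfter B ∪ {A, B} := by
    intro l₁ l₂ B o' h
    rw [← semiringAttrs_of_split hα h]
    ext x
    simp only [semiringAttrs, List.mem_cons, Prod.mk.injEq, Set.mem_union, Set.mem_ofPred_eq,
      Set.mem_insert_iff, Set.mem_singleton_iff]
    grind
  have hdef : A ∈ frontAttrs H α ↔ ∃ o, (A, o) ∈ α ∧
      ∀ (l₁ l₂ : AggOrdering V ι) (B : V) (o' : AggOp ι), α = l₁ ++ (B, o') :: l₂ → (A, o) ∈ l₂ →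
          o' = o ∨ ¬ ConnectedIn H.Adj (semiringAttrs ((B, o') :: l₂) ∪ {A, B}) A B := by
    subst h
    rfl
  rw [hdef]
  constructor
  · rintro ⟨o, hA, h⟩
    refine ⟨⟨o, hA⟩, fun B hB => ?_⟩
    obtain ⟨o', hB'⟩ := hB.left_mem
    obtain ⟨l₁, l₂, hl⟩ := exists_split hB'
    obtain ⟨o'', hA'⟩ := (precedes_of_split hα hl).1 hB
    obtain rfl : o'' = o := op_eq hα (by simp [hl, hA']) hA
    rcases h l₁ l₂ B o' hl hA' with rfl | h
    · exact Or.inl ⟨_, hB', hA⟩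
    · rw [key l₁ l₂ B o' hl] at h
      exact Or.inr h
  · rintro ⟨⟨o, hA⟩, h⟩
    refine ⟨o, hA, fun l₁ l₂ B o' hl hA' => ?_⟩
    rcases h B ((precedes_of_split hα hl).2 ⟨_, hA'⟩) with ⟨o'', h1, h2⟩ | h
    · left
      rw [op_eq hα (o := o') (o' := o'') (by simp [hl]) h1, op_eq hα h2 hA]
    · rw [key l₁ l₂ B o' hl]
      exact Or.inr h

theorem frontAttrs_subset (hα : (α.map Prod.fst).Nodup) : frontAttrs H α ⊆ α.attrs := by
  intro A hA
  match α, hA with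
  | (a, AggOp.prod) :: l, hA => exact mem_attrs_cons.2 (Or.inl hA)
  | (a, AggOp.sum i) :: l, hA => exact ((mem_frontAttrs_sum rfl hα).1 hA).1

end Front

/-! ### Admissible queries and their components -/

section Admissible

variable {V ι : Type*}

/-- The standing assumptions on a query. -/
structure IsAdmissible (H : Hypergraph V) (α : AggOrdering V ι) : Prop where
  nodup : (α.map Prod.fst).Nodup
  attrs_subset : α.attrs ⊆ H.vertexSet
  finite : H.vertexSet.Finite
  cover : ∀ a ∈ H.vertexSet, ∃ F ∈ H.edgeSet, a ∈ F
  exists_semiring : ∀ F ∈ H.edgeSet, ∀ a ∈ F, a ∈ α.productAttrs →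
    ∃ z ∈ F, z ∈ α.semiringAttrs ∧ α.Precedes a z

/-- The condition on last aggregations is only used in this form: a product attribute of an edge is
followed by a semiring attribute of the same edge. So an edge with an aggregated attribute meets a
component, and the condition passes to the queries of the components. -/
theorem IsAdmissible.of_last {H : Hypergraph V} (hfin : H.vertexSet.Finite)
    (hcover : ∀ a ∈ H.vertexSet, ∃ F ∈ H.edgeSet, a ∈ F)
    {α : AggOrdering V ι} (hα : α.IsOrderingOn H)
    (hlast : ∀ F ∈ H.edgeSet, ∀ p, (α.restrict F).getLast? = some p → p.2 ≠ AggOp.prod) :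
    IsAdmissible H α := by
  refine ⟨hα.1, hα.2, hfin, hcover, fun F hF a haF ha => ?_⟩
  have hmem : (a, AggOp.prod) ∈ α.restrict F := mem_restrict.2 ⟨ha, haF⟩
  obtain ⟨p, hp⟩ : ∃ p, (α.restrict F).getLast? = some p :=
    ⟨_, List.getLast?_eq_getLast_of_ne_nil (List.ne_nil_of_mem hmem)⟩
  obtain ⟨l, hl⟩ := List.getLast?_eq_some_iff.1 hp
  have hp' := hlast F hF p hp
  obtain ⟨z, o⟩ := p
  have hz : (z, o) ∈ α.restrict F := by simp [hl]
  have hz' := mem_restrict.1 hz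
  refine ⟨z, hz'.2, ?_, ?_⟩
  · cases o with
    | sum i => exact ⟨i, hz'.1⟩
    | prod => exact absurd rfl hp'
  · have hal : (a, AggOp.prod) ∈ l := by
      rw [hl] at hmem
      rcases List.mem_append.1 hmem with h | h
      · exact h
      · cases List.mem_singleton.1 h
        exact absurd rfl hp'
    obtain ⟨l₁, l₂, rfl⟩ := exists_split hal
    refine Precedes.of_sublist (restrict_sublist α F) ?_
    refine (precedes_of_split (nodup_restrict hα.1 F) (l₁ := l₁) (l₂ := l₂ ++ [(z, o)])
      (o := AggOp.prod) (by simp [hl])).2 ?_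
    exact ⟨o, by simp⟩

theorem Hypergraph.adj_symm' (H : Hypergraph V) : ∀ x y, H.Adj x y → H.Adj y x :=
  fun _ _ h => h.symm

variable {H : Hypergraph V} {α : AggOrdering V ι} {C : Set V} {a : V} {F : Set V}

theorem IsAdmissible.mem_outputAttrs_iff (_hH : IsAdmissible H α) (ha : a ∈ H.vertexSet) :
    a ∈ outputAttrs H α ↔ a ∉ α.semiringAttrs ∧ a ∉ α.productAttrs := by
  refine ⟨fun h => ⟨fun h' => h.2 (semiringAttrs_subset h'), fun h' => h.2 (productAttrs_subset h')⟩,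
    fun h => ⟨ha, fun h' => ?_⟩⟩
  rcases mem_attrs_cases h' with h' | h'
  exacts [h.1 h', h.2 h']

theorem IsAdmissible.queryBase_eq (hH : IsAdmissible H α) :
    H.vertexSet \ (outputAttrs H α ∪ α.productAttrs) = α.semiringAttrs := by
  ext x
  constructor
  · rintro ⟨hx, hx'⟩
    rw [Set.mem_union, not_or] at hx'
    by_contra h
    exact hx'.1 ((hH.mem_outputAttrs_iff hx).2 ⟨h, hx'.2⟩)
  · intro hx
    refine ⟨hH.attrs_subset (semiringAttrs_subset hx), ?_⟩
    rintro (h | h)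
    · exact h.2 (semiringAttrs_subset hx)
    · exact notMem_productAttrs hH.nodup hx h

theorem IsAdmissible.isQueryComponent_iff (hH : IsAdmissible H α) :
    IsQueryComponent H α C ↔ IsComponentOf H.Adj α.semiringAttrs C := by
  rw [IsQueryComponent, hH.queryBase_eq]

theorem IsAdmissible.isQueryComponent_iff' (hH : IsAdmissible H α) :
    IsQueryComponent H α C ↔ IsConnectedSet H.Adj C ∧ C ⊆ α.semiringAttrs ∧
      ∀ x ∈ C, ∀ y ∈ α.semiringAttrs, H.Adj x y → y ∈ C := by
  rw [hH.isQueryComponent_iff, isComponentOf_iff H.adj_symm']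

theorem IsAdmissible.connected (hH : IsAdmissible H α) (hC : IsQueryComponent H α C) :
    IsConnectedSet H.Adj C := (hH.isQueryComponent_iff'.1 hC).1

theorem IsAdmissible.subset_semiringAttrs (hH : IsAdmissible H α) (hC : IsQueryComponent H α C) :
    C ⊆ α.semiringAttrs := (hH.isQueryComponent_iff'.1 hC).2.1

theorem IsAdmissible.mem_component (hH : IsAdmissible H α) (hC : IsQueryComponent H α C)
    (hF : F ∈ H.edgeSet) (hFC : (F ∩ C).Nonempty) (ha : a ∈ F) (ha' : a ∈ α.semiringAttrs) :
    a ∈ C := by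
  obtain ⟨c, hcF, hcC⟩ := hFC
  exact (hH.isQueryComponent_iff'.1 hC).2.2 c hcC a ha' ⟨F, hF, hcF, ha⟩

theorem IsAdmissible.component_eq (_hH : IsAdmissible H α) {C' : Set V}
    (hC : IsQueryComponent H α C) (hC' : IsQueryComponent H α C') (h : (C ∩ C').Nonempty) :
    C = C' :=
  IsComponentOf.eq_of_inter_nonempty H.adj_symm' hC hC' h

theorem IsAdmissible.exists_component (hH : IsAdmissible H α) (ha : a ∈ α.semiringAttrs) :
    ∃ C, IsQueryComponent H α C ∧ a ∈ C := by
  simp only [hH.isQueryComponent_iff]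
  exact exists_isComponentOf ha

theorem IsAdmissible.component_eq_of_edge (hH : IsAdmissible H α) {C' : Set V}
    (hC : IsQueryComponent H α C) (hC' : IsQueryComponent H α C') (hF : F ∈ H.edgeSet)
    (hFC : (F ∩ C).Nonempty) (hFC' : (F ∩ C').Nonempty) : C = C' := by
  obtain ⟨x, hxF, hxC⟩ := hFC
  exact hH.component_eq hC hC'
    ⟨x, hxC, hH.mem_component hC' hF hFC' hxF (hH.subset_semiringAttrs hC hxC)⟩

theorem IsAdmissible.exists_component_of_edge (hH : IsAdmissible H α) (hF : F ∈ H.edgeSet)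
    (h : ¬ F ⊆ outputAttrs H α) : ∃ C, IsQueryComponent H α C ∧ (F ∩ C).Nonempty := by
  obtain ⟨x, hxF, hx⟩ := Set.not_subset.1 h
  have hxV := H.subset_vertexSet_of_mem_edgeSet' hF hxF
  have : ∃ z ∈ F, z ∈ α.semiringAttrs := by
    rcases mem_attrs_cases (not_not.1 fun h => hx ⟨hxV, h⟩) with h | h
    · exact ⟨x, hxF, h⟩
    · obtain ⟨z, hz, hz', -⟩ := hH.exists_semiring F hF x hxF h
      exact ⟨z, hz, hz'⟩
  obtain ⟨z, hz, hz'⟩ := this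
  obtain ⟨C, hC, hzC⟩ := hH.exists_component hz'
  exact ⟨C, hC, z, hz, hzC⟩

theorem mem_edgesMeeting_vertexSet {C : Set V} :
    a ∈ (edgesMeeting H C).vertexSet ↔ ∃ F ∈ H.edgeSet, (F ∩ C).Nonempty ∧ a ∈ F := by
  simp [edgesMeeting, and_assoc]

theorem edgesMeeting_vertexSet_subset : (edgesMeeting H C).vertexSet ⊆ H.vertexSet := by
  intro a ha
  obtain ⟨F, hF, -, haF⟩ := mem_edgesMeeting_vertexSet.1 ha
  exact H.subset_vertexSet_of_mem_edgeSet' hF haF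

theorem IsAdmissible.component_subset (hH : IsAdmissible H α) (hC : IsQueryComponent H α C) :
    C ⊆ (edgesMeeting H C).vertexSet := by
  intro a ha
  obtain ⟨F, hF, haF⟩ := hH.cover a
    (hH.attrs_subset (semiringAttrs_subset (hH.subset_semiringAttrs hC ha)))
  exact mem_edgesMeeting_vertexSet.2 ⟨F, hF, ⟨a, haF, ha⟩, haF⟩

/-- A semiring attribute on an edge that meets `C` already lies in `C`, so `C⁺` consists of all
aggregated attributes on such edges. -/
theorem IsAdmissible.mem_componentPlus_iff (hH : IsAdmissible H α) (hC : IsQueryComponent H α C) :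
    a ∈ componentPlus H α C ↔ a ∈ (edgesMeeting H C).vertexSet ∧ a ∈ α.attrs := by
  constructor
  · rintro (h | h)
    · exact ⟨hH.component_subset hC h, semiringAttrs_subset (hH.subset_semiringAttrs hC h)⟩
    · exact ⟨h.2, productAttrs_subset h.1⟩
  · rintro ⟨h, h'⟩
    rcases mem_attrs_cases h' with h' | h'
    · obtain ⟨F, hF, hFC, haF⟩ := mem_edgesMeeting_vertexSet.1 h
      exact Or.inl (hH.mem_component hC hF hFC haF h')
    · exact Or.inr ⟨h', h⟩

theorem IsAdmissible.mem_component_iff (hH : IsAdmissible H α) (hC : IsQueryComponent H α C) :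
    a ∈ C ↔ a ∈ (edgesMeeting H C).vertexSet ∧ a ∈ α.semiringAttrs := by
  refine ⟨fun h => ⟨hH.component_subset hC h, hH.subset_semiringAttrs hC h⟩, fun h => ?_⟩
  obtain ⟨F, hF, hFC, haF⟩ := mem_edgesMeeting_vertexSet.1 h.1
  exact hH.mem_component hC hF hFC haF h.2

/-- The attributes that become output attributes in the query of the component `C`. -/
def componentFront (H : Hypergraph V) (α : AggOrdering V ι) (C : Set V) : Set V :=
  frontAttrs H (α.restrict (componentPlus H α C))

theorem componentOrdering_eq : componentOrdering H α C =
    α.restrict (componentPlus H α C \ componentFront H α C) := rfl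

theorem IsAdmissible.componentFront_subset (hH : IsAdmissible H α) :
    componentFront H α C ⊆ componentPlus H α C := fun _ ha =>
  (mem_attrs_restrict.1 (frontAttrs_subset (nodup_restrict hH.nodup _) ha)).2

theorem IsAdmissible.mem_attrs_componentOrdering (hH : IsAdmissible H α)
    (hC : IsQueryComponent H α C) : a ∈ (componentOrdering H α C).attrs ↔
      a ∈ componentPlus H α C ∧ a ∉ componentFront H α C := by
  rw [componentOrdering_eq, mem_attrs_restrict]
  refine ⟨fun h => h.2, fun h => ⟨((hH.mem_componentPlus_iff hC).1 h.1).2, h⟩⟩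

theorem IsAdmissible.mem_outputAttrs_component (hH : IsAdmissible H α)
    (hC : IsQueryComponent H α C) : a ∈ outputAttrs (edgesMeeting H C) (componentOrdering H α C) ↔
      a ∈ interfaceEdge H α C ∨ a ∈ componentFront H α C := by
  rw [outputAttrs, Set.mem_sdiff, hH.mem_attrs_componentOrdering hC, interfaceEdge, outputAttrs]
  have h1 := hH.mem_componentPlus_iff hC (a := a)
  have h2 := @edgesMeeting_vertexSet_subset _ H C a
  have h3 := @IsAdmissible.componentFront_subset _ _ H α C hH a
  simp only [Set.mem_inter_iff, Set.mem_sdiff]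
  tauto

/-- Every attribute of `C⁺` is connected to every attribute of `C` through `C`. -/
theorem IsAdmissible.connectedIn_componentPlus (hH : IsAdmissible H α)
    (hC : IsQueryComponent H α C) (ha : a ∈ componentPlus H α C) {c : V} (hc : c ∈ C) :
    ConnectedIn H.Adj (C ∪ {a}) a c := by
  obtain ⟨F, hF, ⟨d, hdF, hdC⟩, haF⟩ :=
    mem_edgesMeeting_vertexSet.1 ((hH.mem_componentPlus_iff hC).1 ha).1
  exact (ConnectedIn.of_rel (r := H.Adj) (Or.inr rfl) (Or.inl hdC) ⟨F, hF, haF, hdF⟩).trans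
    (((hH.connected hC).2 d hdC c hc).subset Set.subset_union_left)

theorem IsAdmissible.semiringAfter_restrict (hH : IsAdmissible H α) (hC : IsQueryComponent H α C)
    {B : V} (hB : B ∈ componentPlus H α C) :
    (α.restrict (componentPlus H α C)).semiringAfter B = {s | s ∈ C ∧ α.Precedes B s} := by
  ext s
  simp only [semiringAfter, mem_semiringAttrs_restrict, precedes_restrict hH.nodup,
    Set.mem_ofPred_eq, hH.mem_component_iff hC, hH.mem_componentPlus_iff hC] at hB ⊢
  constructor
  · tauto
  · rintro ⟨⟨h1, h2⟩, h3⟩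
    exact ⟨⟨h2, h1, semiringAttrs_subset h2⟩, h3, hB, h1, semiringAttrs_subset h2⟩

/-- The two possible shapes of `(α_{C⁺})^O`. -/
theorem IsAdmissible.componentFront_cases (hH : IsAdmissible H α) (hC : IsQueryComponent H α C) :
    (∃ a, componentFront H α C = {a} ∧ a ∈ α.productAttrs ∧ α.IsFirst (componentPlus H α C) a) ∨
    (∃ f i, α.IsFirst (componentPlus H α C) f ∧ f ∈ componentFront H α C ∧
      (∀ A ∈ componentFront H α C, A ∈ C ∧ (A, AggOp.sum i) ∈ α) ∧
      ∀ A ∈ componentPlus H α C, A ∈ componentFront H α C ↔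
        ∀ B ∈ componentPlus H α C, α.Precedes B A → α.SameOp B A ∨
          ¬ ConnectedIn H.Adj ({s | s ∈ C ∧ α.Precedes B s} ∪ {A, B}) A B) := by
  set α' := α.restrict (componentPlus H α C) with hα'
  have hnd : (α'.map Prod.fst).Nodup := nodup_restrict hH.nodup _
  obtain ⟨c, hc⟩ := (hH.connected hC).1
  have hcp : c ∈ componentPlus H α C := Or.inl hc
  have hcm : c ∈ α'.attrs :=
    mem_attrs_restrict.2 ⟨semiringAttrs_subset (hH.subset_semiringAttrs hC hc), hcp⟩
  have hfirst : ∀ f o l, α' = (f, o) :: l → α.IsFirst (componentPlus H α C) f := by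
    intro f o l h
    have hf : f ∈ α'.attrs := ⟨o, by simp [h]⟩
    obtain ⟨hf1, hf2⟩ := mem_attrs_restrict.1 hf
    refine ⟨hf2, hf1, fun b hb hb' hne => ?_⟩
    have hb'' : b ∈ α'.attrs := mem_attrs_restrict.2 ⟨hb', hb⟩
    refine Precedes.of_sublist (restrict_sublist α (componentPlus H α C)) ?_
    rw [← hα']
    rw [h] at hb'' ⊢
    exact precedes_cons.2 (Or.inl ⟨rfl, (mem_attrs_cons.1 hb'').resolve_left hne⟩)
  rcases hl : α' with _ | ⟨⟨f, o⟩, l⟩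
  · rw [hl] at hcm
    simp [mem_attrs_iff] at hcm
  have hff := hfirst f o l hl
  have hfm : (f, o) ∈ α := (mem_restrict.1 (by rw [← hα', hl]; simp : (f, o) ∈ α.restrict _)).1
  cases o with
  | prod =>
    left
    refine ⟨f, ?_, hfm, hff⟩
    rw [componentFront, ← hα', hl]
    rfl
  | sum i =>
    right
    have hmem : ∀ A, A ∈ componentFront H α C ↔ A ∈ componentPlus H α C ∧
        ∀ B ∈ componentPlus H α C, α.Precedes B A → α.SameOp B A ∨
          ¬ ConnectedIn H.Adj ({s | s ∈ C ∧ α.Precedes B s} ∪ {A, B}) A B := by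
      intro A
      rw [componentFront, ← hα', mem_frontAttrs_sum hl hnd, hα', mem_attrs_restrict]
      constructor
      · rintro ⟨⟨-, hA⟩, h⟩
        refine ⟨hA, fun B hB hBA => ?_⟩
        rw [← hH.semiringAfter_restrict hC hB]
        rcases h B ((precedes_restrict hH.nodup).2 ⟨hBA, hB, hA⟩) with ⟨o, h1, h2⟩ | h
        · exact Or.inl ⟨o, (mem_restrict.1 h1).1, (mem_restrict.1 h2).1⟩
        · exact Or.inr h
      · rintro ⟨hA, h⟩
        refine ⟨⟨((hH.mem_componentPlus_iff hC).1 hA).2, hA⟩, fun B hBA => ?_⟩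
        obtain ⟨hBA, hB, -⟩ := (precedes_restrict hH.nodup).1 hBA
        rw [hH.semiringAfter_restrict hC hB]
        rcases h B hB hBA with ⟨o, h1, h2⟩ | h
        · exact Or.inl ⟨o, mem_restrict.2 ⟨h1, hB⟩, mem_restrict.2 ⟨h2, hA⟩⟩
        · exact Or.inr h
    have hfC : f ∈ C := (hH.mem_component_iff hC).2
      ⟨((hH.mem_componentPlus_iff hC).1 hff.1).1, ⟨i, hfm⟩⟩
    refine ⟨f, i, hff, (hmem f).2 ⟨hff.1, fun B hB hBf => ?_⟩, fun A hA => ?_, fun A hA => ?_⟩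
    · exact absurd (hff.2.2 B hB hBf.left_mem (hBf.ne hH.nodup)) (hBf.asymm hH.nodup)
    -- All of `C` other than `f` comes after `f`, so every `A` in `C⁺` is connected to `f` in the
    -- relevant set. Membership in the front then forces the operator of `f`.
    · have hA' := (hmem A).1 hA
      have hAi : (A, AggOp.sum i) ∈ α := by
        by_cases hAf : A = f
        · rwa [hAf]
        · rcases hA'.2 f hff.1 (hff.2.2 A hA'.1 ((hH.mem_componentPlus_iff hC).1 hA'.1).2 hAf) with
            ⟨o, h1, h2⟩ | h
          · rwa [op_eq hH.nodup hfm h1]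
          · refine absurd ((hH.connectedIn_componentPlus hC hA'.1 hfC).subset ?_) h
            rintro x (hx | rfl)
            · by_cases hxf : x = f
              · exact Or.inr (Or.inr hxf)
              · exact Or.inl ⟨hx, hff.2.2 x (Or.inl hx)
                  (semiringAttrs_subset (hH.subset_semiringAttrs hC hx)) hxf⟩
            · exact Or.inr (Or.inl rfl)
      exact ⟨(hH.mem_component_iff hC).2
        ⟨((hH.mem_componentPlus_iff hC).1 hA'.1).1, ⟨i, hAi⟩⟩, hAi⟩
    · rw [hmem]
      exact ⟨fun h => h.2, fun h => ⟨hA, h⟩⟩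

theorem IsAdmissible.componentFront_nonempty (hH : IsAdmissible H α)
    (hC : IsQueryComponent H α C) : (componentFront H α C).Nonempty := by
  rcases hH.componentFront_cases hC with ⟨a, h, -⟩ | ⟨f, i, -, h, -⟩
  · exact ⟨a, by simp [h]⟩
  · exact ⟨f, h⟩

/-- The front is nonempty and is removed; the length is the measure for inductions along the
recursion. -/
theorem IsAdmissible.length_componentOrdering_lt (hH : IsAdmissible H α)
    (hC : IsQueryComponent H α C) : (componentOrdering H α C).length < α.length := by
  obtain ⟨a, ha⟩ := hH.componentFront_nonempty hC
  obtain ⟨-, o, hao⟩ := (hH.mem_componentPlus_iff hC).1 (hH.componentFront_subset ha)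
  refine lt_of_le_of_ne (restrict_sublist _ _).length_le fun h => ?_
  have := (restrict_sublist _ _).eq_of_length h
  rw [← this, mem_restrict] at hao
  exact hao.2.2 ha

/-- The semiring attribute `z` after `a` in `F` survives: `a` is an earlier product attribute
adjacent to `z`, which keeps `z` out of a front of semiring attributes. -/
theorem IsAdmissible.exists_semiring_component (hH : IsAdmissible H α)
    (hC : IsQueryComponent H α C) (hF : F ∈ H.edgeSet) (hFC : (F ∩ C).Nonempty) (ha : a ∈ F)
    (ha' : a ∈ (componentOrdering H α C).productAttrs) :
    ∃ z ∈ F, z ∈ (componentOrdering H α C).semiringAttrs ∧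
      (componentOrdering H α C).Precedes a z := by
  rw [componentOrdering_eq, mem_productAttrs_restrict] at ha'
  obtain ⟨ha1, ha2, ha3⟩ := ha'
  obtain ⟨z, hz, hz', haz⟩ := hH.exists_semiring F hF a ha ha1
  have hzC := hH.mem_component hC hF hFC hz hz'
  have hz3 : z ∉ componentFront H α C := by
    intro hzf
    rcases hH.componentFront_cases hC with ⟨b, hb, hb', -⟩ | ⟨f, i, -, -, -, h⟩
    · rw [hb] at hzf
      cases hzf
      exact notMem_productAttrs hH.nodup hz' hb'
    · rcases (h z (Or.inl hzC)).1 hzf a ha2 haz with ⟨o, h1, h2⟩ | h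
      · obtain ⟨j, hj⟩ := hz'
        cases op_eq hH.nodup h1 ha1
        cases op_eq hH.nodup h2 hj
      · exact h (.of_rel (Or.inr (Or.inl rfl)) (Or.inr (Or.inr rfl)) ⟨F, hF, hz, ha⟩)
  have hz4 : z ∈ componentPlus H α C \ componentFront H α C := ⟨Or.inl hzC, hz3⟩
  exact ⟨z, hz, mem_semiringAttrs_restrict.2 ⟨hz', hz4⟩,
    (precedes_restrict hH.nodup).2 ⟨haz, ⟨ha2, ha3⟩, hz4⟩⟩

theorem IsAdmissible.meeting (hH : IsAdmissible H α) (hC : IsQueryComponent H α C) :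
    IsAdmissible (edgesMeeting H C) (componentOrdering H α C) where
  nodup := nodup_restrict hH.nodup _
  attrs_subset a ha :=
    ((hH.mem_componentPlus_iff hC).1 ((hH.mem_attrs_componentOrdering hC).1 ha).1).1
  finite := hH.finite.subset edgesMeeting_vertexSet_subset
  cover a ha := by
    obtain ⟨F, hF, hFC, haF⟩ := mem_edgesMeeting_vertexSet.1 ha
    exact ⟨F, ⟨hF, hFC⟩, haF⟩
  exists_semiring F hF a haF ha := hH.exists_semiring_component hC hF.1 hF.2 haF ha

theorem IsAdmissible.interfaceEdge_subset (hH : IsAdmissible H α) (hC : IsQueryComponent H α C) :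
    interfaceEdge H α C ⊆ outputAttrs (edgesMeeting H C) (componentOrdering H α C) :=
  fun _ ha => (hH.mem_outputAttrs_component hC).2 (Or.inl ha)

theorem IsAdmissible.withInterface (hH : IsAdmissible H α) (hC : IsQueryComponent H α C) :
    IsAdmissible (componentHypergraph H α C) (componentOrdering H α C) where
  nodup := (hH.meeting hC).nodup
  attrs_subset := (hH.meeting hC).attrs_subset
  finite := (hH.meeting hC).finite
  cover a ha := by
    obtain ⟨F, hF, haF⟩ := (hH.meeting hC).cover a ha
    exact ⟨F, Or.inl hF, haF⟩
  exists_semiring F hF a haF ha := by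
    rcases hF with hF | rfl
    · exact (hH.meeting hC).exists_semiring F hF a haF ha
    · exact absurd (productAttrs_subset ha) (hH.interfaceEdge_subset hC haF).2

/-! ### Hypergraphs that differ in edges of output attributes -/

/-- `H` and `H'` have the same vertices, and the same edges apart from those that consist of output
attributes. -/
def SameInner (α : AggOrdering V ι) (H H' : Hypergraph V) : Prop :=
  H.vertexSet = H'.vertexSet ∧
    ∀ F, ¬ F ⊆ outputAttrs H α → (F ∈ H.edgeSet ↔ F ∈ H'.edgeSet)

variable {H' : Hypergraph V}

theorem SameInner.refl (α : AggOrdering V ι) (H : Hypergraph V) : SameInner α H H :=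
  ⟨rfl, fun _ _ => Iff.rfl⟩

theorem SameInner.outputAttrs_eq (h : SameInner α H H') : outputAttrs H α = outputAttrs H' α := by
  rw [outputAttrs, outputAttrs, h.1]

theorem SameInner.symm (h : SameInner α H H') : SameInner α H' H :=
  ⟨h.1.symm, fun F hF => (h.2 F (by rwa [h.outputAttrs_eq])).symm⟩

theorem SameInner.mem_edgeSet (h : SameInner α H H') (hF : F ∈ H.edgeSet) (ha : a ∈ F)
    (ha' : a ∈ α.attrs) : F ∈ H'.edgeSet :=
  (h.2 F fun hsub => (hsub ha).2 ha').1 hF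

theorem SameInner.adj (h : SameInner α H H') {b : V} (ha : a ∈ α.attrs) (hab : H.Adj a b) :
    H'.Adj a b := by
  obtain ⟨F, hF, haF, hbF⟩ := hab
  exact ⟨F, h.mem_edgeSet hF haF ha, haF, hbF⟩

/-- A path among aggregated attributes uses no edge that consists of output attributes. This is why
components, fronts and component orderings are insensitive to such edges. -/
theorem SameInner.connectedIn (h : SameInner α H H') {U : Set V} (hU : U ⊆ α.attrs) {b : V}
    (hab : ConnectedIn H.Adj U a b) : ConnectedIn H'.Adj U a b :=
  hab.mono subset_rfl fun _ hx _ _ hxy => h.adj (hU hx) hxy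

theorem SameInner.edgesMeeting_eq (h : SameInner α H H') (hC : C ⊆ α.attrs) :
    edgesMeeting H C = edgesMeeting H' C := by
  have : {F | F ∈ H.edgeSet ∧ (F ∩ C).Nonempty} = {F | F ∈ H'.edgeSet ∧ (F ∩ C).Nonempty} := by
    ext F
    constructor
    · rintro ⟨hF, x, hxF, hxC⟩
      exact ⟨h.mem_edgeSet hF hxF (hC hxC), x, hxF, hxC⟩
    · rintro ⟨hF, x, hxF, hxC⟩
      exact ⟨h.symm.mem_edgeSet hF hxF (hC hxC), x, hxF, hxC⟩
  simp only [edgesMeeting, this]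

theorem SameInner.isQueryComponent (h : SameInner α H H') (hH : IsAdmissible H α)
    (hC : IsQueryComponent H α C) : IsQueryComponent H' α C := by
  have hb := hH.queryBase_eq
  rw [IsQueryComponent, ← h.outputAttrs_eq, ← h.1, hb, isComponentOf_iff H'.adj_symm']
  obtain ⟨h1, h2, h3⟩ := hH.isQueryComponent_iff'.1 hC
  refine ⟨h1.mono_rel fun x hx y _ hxy => h.adj (semiringAttrs_subset (h2 hx)) hxy, h2,
    fun x hx y hy hxy => h3 x hx y hy (h.symm.adj (semiringAttrs_subset (h2 hx)) hxy)⟩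

theorem SameInner.frontAttrs_subset (h : SameInner α H H') {β : AggOrdering V ι}
    (hβ : (β.map Prod.fst).Nodup) (hβα : β.attrs ⊆ α.attrs) :
    frontAttrs H β ⊆ frontAttrs H' β := by
  intro A hA
  match β, hβ, hA with
  | (a, AggOp.prod) :: l, _, hA => exact hA
  | (a, AggOp.sum i) :: l, hβ, hA =>
    rw [mem_frontAttrs_sum rfl hβ] at hA ⊢
    refine ⟨hA.1, fun B hB => (hA.2 B hB).imp_right fun hn hc => hn (h.symm.connectedIn ?_ hc)⟩
    rintro x (hx | rfl | rfl)
    · exact hβα (semiringAttrs_subset hx.1)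
    · exact hβα hB.right_mem
    · exact hβα hB.left_mem

theorem SameInner.componentPlus_eq (h : SameInner α H H') (hC : C ⊆ α.attrs) :
    componentPlus H α C = componentPlus H' α C := by
  rw [componentPlus, componentPlus, h.edgesMeeting_eq hC]

theorem SameInner.componentFront_eq (h : SameInner α H H') (hα : (α.map Prod.fst).Nodup)
    (hC : C ⊆ α.attrs) : componentFront H α C = componentFront H' α C := by
  rw [componentFront, componentFront, ← h.componentPlus_eq hC]
  have : (α.restrict (componentPlus H α C)).attrs ⊆ α.attrs := fun x hx =>
    (mem_attrs_restrict.1 hx).1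
  exact (h.frontAttrs_subset (nodup_restrict hα _) this).antisymm
    (h.symm.frontAttrs_subset (nodup_restrict hα _) this)

theorem SameInner.componentOrdering_eq (h : SameInner α H H') (hα : (α.map Prod.fst).Nodup)
    (hC : C ⊆ α.attrs) : componentOrdering H α C = componentOrdering H' α C := by
  rw [_root_.componentOrdering_eq, _root_.componentOrdering_eq, h.componentPlus_eq hC,
    h.componentFront_eq hα hC]

theorem SameInner.interfaceEdge_eq (h : SameInner α H H') (hC : C ⊆ α.attrs) :
    interfaceEdge H α C = interfaceEdge H' α C := by
  rw [interfaceEdge, interfaceEdge, h.outputAttrs_eq, h.edgesMeeting_eq hC]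

theorem SameInner.componentHypergraph_eq (h : SameInner α H H') (hC : C ⊆ α.attrs) :
    componentHypergraph H α C = componentHypergraph H' α C := by
  simp only [componentHypergraph, h.edgesMeeting_eq hC, h.interfaceEdge_eq hC]

/-- Decomposability recurses on `edgesMeeting`, the characteristic hypergraphs recurse on
`componentHypergraph`. This comparison lets both recursions be followed simultaneously. -/
theorem IsAdmissible.sameInner_component (hH : IsAdmissible H α) (hC : IsQueryComponent H α C) :
    SameInner (componentOrdering H α C) (edgesMeeting H C)
      (componentHypergraph H α C) := by
  refine ⟨rfl, fun F hF => ⟨Or.inl, ?_⟩⟩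
  rintro (h | rfl)
  · exact h
  · exact absurd (hH.interfaceEdge_subset hC) hF

theorem IsAdmissible.finite_components (hH : IsAdmissible H α) :
    {C | IsQueryComponent H α C}.Finite :=
  hH.finite.finite_subsets.subset fun _ hC =>
    (hH.subset_semiringAttrs hC).trans (semiringAttrs_subset.trans hH.attrs_subset)

theorem IsAdmissible.component_subset_attrs (hH : IsAdmissible H α)
    (hC : IsQueryComponent H α C) : C ⊆ α.attrs :=
  (hH.subset_semiringAttrs hC).trans semiringAttrs_subset

/-- There are finitely many choices of a component at each step, and every step shortens the
ordering. -/
theorem IsAdmissible.finite_charPositions {H : Hypergraph V} {α : AggOrdering V ι}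
    (hH : IsAdmissible H α) : {l | IsCharPosition H α l}.Finite := by
  induction hn : α.length using Nat.strong_induction_on generalizing H α with
  | _ n ih =>
    have : {l | IsCharPosition H α l} ⊆ {[]} ∪ ⋃ C ∈ {C | IsQueryComponent H α C},
        List.cons C '' {l | IsQueryComponent H α C ∧
          IsCharPosition (componentHypergraph H α C) (componentOrdering H α C) l} := by
      rintro (_ | ⟨C, l⟩) hl
      · exact Or.inl rfl
      · exact Or.inr (Set.mem_biUnion hl.1 ⟨l, hl, rfl⟩)
    refine Set.Finite.subset ((Set.finite_singleton _).union
      (hH.finite_components.biUnion fun C hC => Set.Finite.image _ ?_)) this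
    exact (ih _ (hn ▸ hH.length_componentOrdering_lt hC) (hH.withInterface hC) rfl).subset
      fun l hl => hl.2

end Admissible

/-! ### Commuting aggregations -/

section Coordinates

variable {V K : Type*} {D : V → Type} {f : (∀ a, D a) → K} {a : V}

/-- `f` does not depend on the coordinate `a`. -/
def Ignores (f : (∀ a, D a) → K) (a : V) : Prop :=
  ∀ x y, (∀ b, b ≠ a → x b = y b) → f x = f y

open Classical in
theorem Ignores.update (h : Ignores f a) (x : ∀ a, D a) (d : D a) :
    f (Function.update x a d) = f x := h _ _ fun _ hb => Function.update_of_ne hb _ _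

theorem DependsOn.ignores {s : Set V} (h : DependsOn f s) (ha : a ∉ s) : Ignores f a :=
  fun _ _ hxy => h fun b hb => hxy b fun hba => ha (hba ▸ hb)

theorem Hypergraph.finite_edgeSet {H : Hypergraph V} (hfin : H.vertexSet.Finite) :
    H.edgeSet.Finite :=
  hfin.finite_subsets.subset fun _ hF => H.subset_vertexSet_of_mem_edgeSet' hF

theorem dependsOn_finprod [CommMonoid K] (R : ∀ F : Set V, (∀ a : F, D a) → K) (E : Set (Set V)) :
    DependsOn (fun x : ∀ a, D a => ∏ᶠ F ∈ E, R F (fun a => x a)) (⋃₀ E) := by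
  intro x y hxy
  refine finprod_congr fun F => finprod_congr fun hF => ?_
  congr 1
  funext a
  exact hxy a ⟨F, hF, a.2⟩

end Coordinates

/-! ### Queries under exchange of aggregations -/

section Semantics

variable {V ι K : Type*} [CommMonoidWithZero K] {O : OperatorSet ι K} {D : V → Type}
  [∀ a, Fintype (D a)]

open Classical in
theorem aggregate_sum (a : V) (i : ι) (f : (∀ a, D a) → K) (x : ∀ a, D a) :
    aggregate O (a, AggOp.sum i) f x =
      Finset.univ.fold (O.add i) 0 (fun d : D a => f (Function.update x a d)) := by
  simp only [aggregate]

open Classical in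
theorem aggregate_prod (a : V) (f : (∀ a, D a) → K) (x : ∀ a, D a) :
    aggregate O (a, AggOp.prod) f x = ∏ d : D a, f (Function.update x a d) := by
  simp only [aggregate]

theorem OperatorSet.fold_mul (O : OperatorSet ι K) (i : ι) {Y : Type*} (s : Finset Y) (c : K)
    (f : Y → K) :
    s.fold (O.add i) 0 (fun d => f d * c) = s.fold (O.add i) 0 f * c := by
  have := Finset.fold_hom (op := O.add i) (op' := O.add i) (m := fun x => x * c) (s := s) (b := 0)
    (f := f) (fun x y => by rw [mul_comm, O.mul_add, mul_comm c, mul_comm c])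
  simpa using this

theorem OperatorSet.fold_zero (O : OperatorSet ι K) (i : ι) {Y : Type*} (s : Finset Y) :
    s.fold (O.add i) 0 (fun _ => 0) = 0 := by
  simpa using O.fold_mul i s 0 (fun _ => 0)

theorem OperatorSet.fold_comm (O : OperatorSet ι K) (i : ι) {Y Z : Type*} (s : Finset Y)
    (t : Finset Z) (f : Y → Z → K) :
    s.fold (O.add i) 0 (fun y => t.fold (O.add i) 0 (f y)) =
      t.fold (O.add i) 0 (fun z => s.fold (O.add i) 0 (fun y => f y z)) := by
  classical
  induction s using Finset.induction_on with
  | empty => simpa using (O.fold_zero i t).symm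
  | insert y s hy ih =>
    simp only [Finset.fold_insert hy, ih]
    have := Finset.fold_op_distrib (op := O.add i) (s := t) (f := f y)
      (g := fun z => s.fold (O.add i) 0 (fun y => f y z)) (b₁ := 0) (b₂ := 0)
    rw [O.add_zero] at this
    exact this.symm

open Classical in
theorem Ignores.aggregate {f : (∀ a, D a) → K} {a : V} (h : Ignores f a) (p : V × AggOp ι) :
    Ignores (aggregate O p f) a := by
  have key : ∀ (x y : ∀ a, D a), (∀ b, b ≠ a → x b = y b) → ∀ d,
      f (Function.update x p.1 d) = f (Function.update y p.1 d) := by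
    intro x y hxy d
    refine h _ _ fun b hb => ?_
    by_cases hp : b = p.1
    · subst hp; simp
    · simp [Function.update_of_ne hp, hxy b hb]
  intro x y hxy
  obtain ⟨b, i | _⟩ := p
  · simp only [aggregate_sum, key x y hxy]
  · simp only [aggregate_prod, key x y hxy]

theorem DependsOn.aggregate {f : (∀ a, D a) → K} {s : Set V} (h : DependsOn f s)
    (p : V × AggOp ι) : DependsOn (aggregate O p f) s := by
  classical
  have key : ∀ (x y : ∀ a, D a), (∀ b ∈ s, x b = y b) → ∀ d,
      f (Function.update x p.1 d) = f (Function.update y p.1 d) := by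
    intro x y hxy d
    refine h fun b hb => ?_
    by_cases hp : b = p.1
    · subst hp; simp
    · simp [Function.update_of_ne hp, hxy b hb]
  intro x y hxy
  obtain ⟨b, i | _⟩ := p
  · rw [aggregate_sum, aggregate_sum]
    congr 1
    funext d
    convert key x y hxy d
  · rw [aggregate_prod, aggregate_prod]
    refine Finset.prod_congr rfl fun d _ => ?_
    convert key x y hxy d

theorem pow_eq_self_of_idem (hidem : ∀ x : K, x * x = x) (x : K) {n : ℕ} (hn : n ≠ 0) :
    x ^ n = x := by
  obtain ⟨n, rfl⟩ := Nat.exists_eq_succ_of_ne_zero hn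
  exact IsIdempotentElem.pow_succ_eq n (hidem x)

/-- A factor independent of `a` leaves a sum by distributivity. In a product it appears once for
every value of `a`, and since the domain is nonempty, idempotence reduces this power to the factor
itself. -/
theorem aggregate_mul_of_ignores (hidem : ∀ x : K, x * x = x) [∀ a, Nonempty (D a)]
    (g : (∀ a, D a) → K) {h : (∀ a, D a) → K} {a : V} (hh : Ignores h a) (o : AggOp ι) :
    aggregate O (a, o) (fun x => g x * h x) = fun x => aggregate O (a, o) g x * h x := by
  funext x
  cases o with
  | sum i => simp only [aggregate_sum, hh.update, O.fold_mul]
  | prod =>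
    simp only [aggregate_prod, hh.update, Finset.prod_mul_distrib, Finset.prod_const]
    rw [pow_eq_self_of_idem hidem _ (Finset.card_ne_zero.2 Finset.univ_nonempty)]

theorem aggregate_prod_mul (g h : (∀ a, D a) → K) (a : V) :
    aggregate O (a, AggOp.prod) (fun x => g x * h x) =
      fun x => aggregate O (a, AggOp.prod) g x * aggregate O (a, AggOp.prod) h x := by
  funext x
  simp only [aggregate_prod, Finset.prod_mul_distrib]

/-- Each of the two aggregations acts on its own factor only, whatever the operators are. -/
theorem aggregate_comm_of_factor (hidem : ∀ x : K, x * x = x) [∀ a, Nonempty (D a)]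
    {g h : (∀ a, D a) → K} {a b : V} (hg : Ignores g b) (hh : Ignores h a) (o o' : AggOp ι) :
    aggregate O (a, o) (aggregate O (b, o') (fun x => g x * h x)) =
      aggregate O (b, o') (aggregate O (a, o) (fun x => g x * h x)) := by
  rw [aggregate_mul_of_ignores hidem g hh]
  simp only [mul_comm (g _), mul_comm (aggregate O (a, o) g _)]
  rw [aggregate_mul_of_ignores hidem h hg, aggregate_mul_of_ignores hidem h (hg.aggregate _)]
  simp only [mul_comm _ (g _)]
  rw [aggregate_mul_of_ignores hidem g (hh.aggregate _)]
  simp only [mul_comm]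

open Classical in
theorem aggregate_comm_of_op (f : (∀ a, D a) → K) {a b : V} (hab : a ≠ b) (o : AggOp ι) :
    aggregate O (a, o) (aggregate O (b, o) f) = aggregate O (b, o) (aggregate O (a, o) f) := by
  funext x
  cases o with
  | sum i =>
    simp only [aggregate_sum]
    rw [O.fold_comm]
    simp only [Function.update_comm hab]
  | prod =>
    simp only [aggregate_prod]
    rw [Finset.prod_comm]
    simp only [Function.update_comm hab]

/-- A product aggregation distributes over both factors even if its attribute occurs in both,
whereas a sum needs one factor that is independent of its attribute. Hence only semiring attributes
have to be separated by the two sets of edges. -/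
theorem exists_factor (hidem : ∀ x : K, x * x = x) [∀ a, Nonempty (D a)] {H : Hypergraph V}
    (hfin : H.vertexSet.Finite) (R : ∀ F : Set V, (∀ a : F, D a) → K) {E₁ E₂ : Set (Set V)}
    (hE : E₁ ∪ E₂ = H.edgeSet) (hd : Disjoint E₁ E₂) (l : AggOrdering V ι)
    (hl : ∀ a ∈ l.semiringAttrs, a ∈ ⋃₀ E₁ → a ∉ ⋃₀ E₂) :
    ∃ g h : (∀ a, D a) → K, DependsOn g (⋃₀ E₁) ∧ DependsOn h (⋃₀ E₂) ∧
      ajarQuery O H l R = fun x => g x * h x := by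
  induction l with
  | nil =>
    refine ⟨_, _, dependsOn_finprod R E₁, dependsOn_finprod R E₂, ?_⟩
    have hf := H.finite_edgeSet hfin
    funext x
    simp only [ajarQuery, List.foldr_nil, joinAnnotation]
    rw [← hE, finprod_mem_union hd (hf.subset (by simp [← hE])) (hf.subset (by simp [← hE]))]
  | cons p l ih =>
    obtain ⟨g, h, hg, hh, hgh⟩ := ih fun a ⟨i, ha⟩ => hl a ⟨i, List.mem_cons_of_mem _ ha⟩
    have hq : ajarQuery O H (p :: l) R = aggregate O p (ajarQuery O H l R) := rfl
    rw [hq, hgh]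
    obtain ⟨a, i | _⟩ := p
    · by_cases ha : a ∈ ⋃₀ E₁
      · exact ⟨_, _, hg.aggregate _, hh,
          aggregate_mul_of_ignores hidem g (hh.ignores (hl a ⟨i, by simp⟩ ha)) _⟩
      · refine ⟨_, _, hg, hh.aggregate (O := O) (a, AggOp.sum i), ?_⟩
        simp only [mul_comm (g _)]
        exact aggregate_mul_of_ignores hidem h (hg.ignores ha) _
    · exact ⟨_, _, hg.aggregate _, hh.aggregate _, aggregate_prod_mul g h a⟩

theorem ajarQuery_swap (hidem : ∀ x : K, x * x = x) [∀ a, Nonempty (D a)] {H : Hypergraph V}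
    (hfin : H.vertexSet.Finite) (R : ∀ F : Set V, (∀ a : F, D a) → K) (l : AggOrdering V ι)
    {a b : V} (hab : a ≠ b) {o o' : AggOp ι}
    (h : o = o' ∨ ¬ ConnectedIn H.Adj (l.semiringAttrs ∪ {a, b}) a b) :
    ajarQuery O H ((a, o) :: (b, o') :: l) R = ajarQuery O H ((b, o') :: (a, o) :: l) R := by
  change aggregate O (a, o) (aggregate O (b, o') (ajarQuery O H l R)) =
    aggregate O (b, o') (aggregate O (a, o) (ajarQuery O H l R))
  rcases h with rfl | h
  · exact aggregate_comm_of_op _ hab o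
  set U := l.semiringAttrs ∪ {a, b}
  have haU : a ∈ U := Or.inr (Or.inl rfl)
  have hbU : b ∈ U := Or.inr (Or.inr rfl)
  -- The edges are divided according to whether they touch the connected component of `a`; by
  -- assumption `b` lies outside that component.
  set E₁ : Set (Set V) := {F | F ∈ H.edgeSet ∧ ∃ v ∈ F, ConnectedIn H.Adj U a v}
  set E₂ : Set (Set V) := {F | F ∈ H.edgeSet ∧ ¬ ∃ v ∈ F, ConnectedIn H.Adj U a v}
  have hE₁ : ∀ v ∈ U, v ∈ ⋃₀ E₁ → ConnectedIn H.Adj U a v := by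
    rintro v hv ⟨F, ⟨hF, w, hw, haw⟩, hvF⟩
    exact haw.trans (.of_rel haw.right_mem hv ⟨F, hF, hw, hvF⟩)
  have hE₂ : ∀ v, ConnectedIn H.Adj U a v → v ∉ ⋃₀ E₂ := by
    rintro v hv ⟨F, ⟨-, hn⟩, hvF⟩
    exact hn ⟨v, hvF, hv⟩
  obtain ⟨g, k, hg, hk, hgk⟩ := exists_factor (O := O) hidem hfin R (E₁ := E₁) (E₂ := E₂)
    (by ext F; exact ⟨fun h => h.elim (·.1) (·.1), fun h => (em _).imp (⟨h, ·⟩) (⟨h, ·⟩)⟩)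
    (Set.disjoint_left.2 fun F h1 h2 => h2.2 h1.2) l
    (fun v hv h1 => hE₂ v (hE₁ v (Or.inl hv) h1))
  rw [hgk]
  exact aggregate_comm_of_factor hidem (hg.ignores fun hb => h (hE₁ b hbU hb))
    (hk.ignores (hE₂ a (.refl haU))) o o'

theorem ajarQuery_move_front (hidem : ∀ x : K, x * x = x) [∀ a, Nonempty (D a)]
    {H : Hypergraph V} (hfin : H.vertexSet.Finite) (R : ∀ F : Set V, (∀ a : F, D a) → K)
    (l : AggOrdering V ι) {b : V} {o : AggOp ι} (m : AggOrdering V ι)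
    (h : ∀ m₁ m₂ a o', m = m₁ ++ (a, o') :: m₂ → a ≠ b ∧ (o' = o ∨
      ¬ ConnectedIn H.Adj (AggOrdering.semiringAttrs (m₂ ++ l) ∪ {a, b}) a b)) :
    ajarQuery O H (m ++ (b, o) :: l) R = ajarQuery O H ((b, o) :: (m ++ l)) R := by
  induction m with
  | nil => rfl
  | cons p m ih =>
    obtain ⟨a, o'⟩ := p
    have hq : ajarQuery O H ((a, o') :: m ++ (b, o) :: l) R =
      aggregate O (a, o') (ajarQuery O H (m ++ (b, o) :: l) R) := rfl
    rw [hq, ih fun m₁ m₂ c o'' hm => h ((a, o') :: m₁) m₂ c o'' (by rw [hm]; rfl)]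
    obtain ⟨hab, h'⟩ := h [] m a o' rfl
    exact ajarQuery_swap hidem hfin R (m ++ l) hab h'

/-- Two orderings of the same aggregations give the same query if all inverted pairs commute. -/
theorem ajarQuery_eq_of_perm (hidem : ∀ x : K, x * x = x) [∀ a, Nonempty (D a)]
    {H : Hypergraph V} (hfin : H.vertexSet.Finite) (R : ∀ F : Set V, (∀ a : F, D a) → K)
    {α β : AggOrdering V ι} (hα : (α.map Prod.fst).Nodup) (hp : α.Perm β)
    (h : ∀ a b, α.Precedes a b → β.Precedes b a → α.SameOp a b ∨
      ¬ ConnectedIn H.Adj (α.semiringAfter a ∪ {a, b}) a b) :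
    ajarQuery O H α R = ajarQuery O H β R := by
  induction β generalizing α with
  | nil => rw [hp.eq_nil]
  | cons p β ih =>
    obtain ⟨b, o⟩ := p
    -- The head `b` of `β` is moved to the front of `α`. It passes the attributes of `m`, each of
    -- which forms an inverted pair with it.
    obtain ⟨m, l, rfl⟩ := exists_split (hp.mem_iff.2 List.mem_cons_self)
    have hperm : (m ++ l).Perm β := (List.perm_middle.symm.trans hp).cons_inv
    have hsub : (m ++ l).Sublist (m ++ (b, o) :: l) := List.sublist_append_iff.2
      ⟨m, l, rfl, List.Sublist.refl _, List.sublist_cons_self _ _⟩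
    rw [ajarQuery_move_front hidem hfin R l m]
    · have := ih (nodup_sublist hsub hα) hperm fun a c hac hca => by
        refine (h a c (hac.of_sublist hsub) (precedes_cons.2 (Or.inr hca))).imp ?_ ?_
        · rintro ⟨o', h1, h2⟩
          obtain ⟨o1, h3⟩ := hac.left_mem
          obtain ⟨o2, h4⟩ := hac.right_mem
          cases op_eq hα (hsub.subset h3) h1
          cases op_eq hα (hsub.subset h4) h2
          exact ⟨_, h3, h4⟩
        -- Deleting `b` can only shrink the set of later semiring attributes, so disconnected pairs
        -- stay disconnected.
        · refine mt fun hc => hc.subset (Set.union_subset_union_left _ ?_)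
          rintro x ⟨⟨i, hx⟩, hax⟩
          exact ⟨⟨i, hsub.subset hx⟩, hax.of_sublist hsub⟩
      change aggregate O (b, o) (ajarQuery O H (m ++ l) R) = aggregate O (b, o) (ajarQuery O H β R)
      rw [this]
    · rintro m₁ m₂ a o' rfl
      have hs : (m₁ ++ (a, o') :: m₂) ++ (b, o) :: l = m₁ ++ (a, o') :: (m₂ ++ (b, o) :: l) := by simp
      have hab : Precedes ((m₁ ++ (a, o') :: m₂) ++ (b, o) :: l) a b :=
        (precedes_of_split hα hs).2 ⟨o, by simp⟩
      refine ⟨hab.ne hα, (h a b hab (precedes_cons.2 (Or.inl ⟨rfl, ?_⟩))).imp ?_ ?_⟩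
      · exact ⟨o', hperm.mem_iff.1 (by simp)⟩
      · rintro ⟨o'', h1, h2⟩
        rw [op_eq hα (o := o') (by simp) h1, op_eq hα (o := o) (by simp) h2]
      · refine mt fun hc => hc.subset (Set.union_subset_union_left _ ?_)
        rw [← semiringAttrs_of_split hα hs]
        rintro x ⟨i, hx⟩
        exact ⟨i, by simp only [List.mem_append, List.mem_cons] at hx ⊢; tauto⟩

end Semantics

/-! ### Decomposable AGHDs -/

section Decomposable

variable {V N ι : Type*} {G : CopyTree V N} {H : Hypergraph V} {α : AggOrdering V ι}
  {S T₀ : Set N} {r : N} {a b : V}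

theorem CopyTree.mem_base_bag {t : N} : a ∈ G.base.bag t ↔ ∃ i, (a, i) ∈ G.bag t := by
  simp [CopyTree.base]

theorem mem_partitionHypergraph {P : V → Set V → ℕ} {i : ℕ} :
    (a, i) ∈ (partitionHypergraph H P).vertexSet ↔ ∃ F ∈ H.edgeSet, a ∈ F ∧ P a F = i := by
  simp only [partitionHypergraph, copyEdge, Set.mem_iUnion, Set.mem_image, Prod.mk.injEq,
    exists_prop]
  grind

theorem mem_copyEdge {P : V → Set V → ℕ} {F : Set V} (ha : a ∈ F) :
    (a, P a F) ∈ copyEdge P F := ⟨a, ha, rfl⟩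

theorem CopyTree.IsAGHDOn.exists_edge (h : G.IsAGHDOn H α S) {t : N} (ht : t ∈ S) {i : ℕ}
    (ha : (a, i) ∈ G.bag t) : ∃ F ∈ H.edgeSet, a ∈ F ∧ G.label a F = i :=
  mem_partitionHypergraph.1 (h.2.bag_subset t ht ha)

theorem CopyTree.IsAGHDOn.mem_vertexSet (h : G.IsAGHDOn H α S) {t : N} (ht : t ∈ S)
    (ha : a ∈ G.base.bag t) : a ∈ H.vertexSet := by
  obtain ⟨i, hi⟩ := CopyTree.mem_base_bag.1 ha
  obtain ⟨F, hF, haF, -⟩ := h.exists_edge ht hi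
  exact H.subset_vertexSet_of_mem_edgeSet' hF haF

theorem CopyTree.IsAGHDOn.copy_eq (h : G.IsAGHDOn H α S) (ha : a ∉ α.productAttrs) {s t : N}
    (hs : s ∈ S) (ht : t ∈ S) {i j : ℕ} (hi : (a, i) ∈ G.bag s) (hj : (a, j) ∈ G.bag t) :
    i = j := by
  obtain ⟨F, hF, haF, rfl⟩ := h.exists_edge hs hi
  obtain ⟨F', hF', haF', rfl⟩ := h.exists_edge ht hj
  exact h.1 a ha F hF F' hF' haF haF'

theorem CopyTree.IsAGHDOn.exists_node (h : G.IsAGHDOn H α S) {F : Set V} (hF : F ∈ H.edgeSet) :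
    ∃ t ∈ S, ∀ a ∈ F, (a, G.label a F) ∈ G.bag t := by
  obtain ⟨t, ht, hFt⟩ := h.2.cover _ ⟨F, hF, rfl⟩
  exact ⟨t, ht, fun a ha => hFt (mem_copyEdge ha)⟩

theorem CopyTree.IsAGHDOn.connected (h : G.IsAGHDOn H α S) {F : Set V} (hF : F ∈ H.edgeSet)
    (ha : a ∈ F) : IsConnectedSet G.tree.Adj {t | t ∈ S ∧ (a, G.label a F) ∈ G.bag t} :=
  h.2.running _ (mem_partitionHypergraph.2 ⟨F, hF, ha, rfl⟩)

/-- One step of the decomposition of a decomposable AGHD. -/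
structure IsSplitting (G : CopyTree V N) (H : Hypergraph V) (α : AggOrdering V ι) (S : Set N)
    (r : N) (T₀ : Set N) (sub : ∀ C, IsQueryComponent H α C → Set N)
    (rt : ∀ C, IsQueryComponent H α C → N) : Prop where
  aghd : G.IsAGHDOn H α S
  T₀_subset : T₀ ⊆ S
  root_mem : r ∈ T₀
  T₀_connected : IsConnectedSet G.tree.Adj T₀
  T₀_bags : ⋃ t ∈ T₀, G.base.bag t = outputAttrs H α
  sub_component : ∀ C hC, IsComponentOf G.tree.Adj (S \ T₀) (sub C hC)
  sub_root : ∀ C hC, rt C hC ∈ sub C hC ∧ ∃ g ∈ T₀, G.tree.Adj g (rt C hC)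
  sub_aghd : ∀ C hC, G.IsAGHDOn (edgesMeeting H C) (componentOrdering H α C) (sub C hC)

theorem IsDecomposableOn.aghd (h : IsDecomposableOn G H α S r) : G.IsAGHDOn H α S := by
  cases h
  assumption

theorem IsDecomposableOn.exists_splitting (h : IsDecomposableOn G H α S r) :
    ∃ T₀ sub rt, IsSplitting G H α S r T₀ sub rt ∧ ∀ C hC, IsDecomposableOn G (edgesMeeting H C)
      (componentOrdering H α C) (sub C hC) (rt C hC) := by
  cases h with
  | intro _ _ _ _ T₀ aghd h1 h2 h3 h4 sub rt h5 h6 h7 h8 =>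
    exact ⟨T₀, sub, rt, ⟨aghd, h1, h2, h3, h4, h5, h6, fun C hC => (h8 C hC).aghd⟩, h8⟩

variable {sub : ∀ C, IsQueryComponent H α C → Set N} {rt : ∀ C, IsQueryComponent H α C → N}
  {C : Set V}

namespace IsSplitting

variable (h : IsSplitting G H α S r T₀ sub rt) (hH : IsAdmissible H α)

include h

theorem sub_subset (hC : IsQueryComponent H α C) : sub C hC ⊆ S \ T₀ :=
  ((isComponentOf_iff fun _ _ h => h.symm).1 (h.sub_component C hC)).2.1

theorem sub_connected (hC : IsQueryComponent H α C) : IsConnectedSet G.tree.Adj (sub C hC) :=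
  ((isComponentOf_iff fun _ _ h => h.symm).1 (h.sub_component C hC)).1

theorem mem_outputAttrs {t : N} (ht : t ∈ T₀) (ha : a ∈ G.base.bag t) : a ∈ outputAttrs H α := by
  rw [← h.T₀_bags]
  exact Set.mem_biUnion ht ha

theorem exists_mem_T₀ (ha : a ∈ outputAttrs H α) : ∃ t ∈ T₀, a ∈ G.base.bag t := by
  rw [← h.T₀_bags] at ha
  simpa using ha

include hH

/-- If the two subtrees share a node they are equal. A bag then contains some `c` of `C` as a vertex
of an edge meeting `C'`, and a semiring attribute on such an edge lies in `C'`. -/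
theorem component_eq {C' : Set V} (hC : IsQueryComponent H α C) (hC' : IsQueryComponent H α C')
    {t : N} (ht : t ∈ sub C hC) (ht' : t ∈ sub C' hC') : C = C' := by
  have heq : sub C hC = sub C' hC' := (h.sub_component C hC).eq_of_inter_nonempty
    (fun _ _ h => h.symm) (h.sub_component C' hC') ⟨t, ht, ht'⟩
  obtain ⟨c, hc⟩ := (hH.connected hC).1
  obtain ⟨F, hF, hcF⟩ := hH.cover c (hH.attrs_subset (hH.component_subset_attrs hC hc))
  obtain ⟨u, hu, hFu⟩ := (h.sub_aghd C hC).exists_node (F := F) ⟨hF, c, hcF, hc⟩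
  rw [heq] at hu
  have := (h.sub_aghd C' hC').mem_vertexSet hu (CopyTree.mem_base_bag.2 ⟨_, hFu c hcF⟩)
  exact hH.component_eq hC hC'
    ⟨c, hc, (hH.mem_component_iff hC').2 ⟨this, hH.subset_semiringAttrs hC hc⟩⟩

/-- All occurrences of a copy of an aggregated attribute lie in the subtree of one component. -/
theorem exists_component (ha : a ∈ α.attrs) {i : ℕ} {t : N} (ht : t ∈ S)
    (hat : (a, i) ∈ G.bag t) : ∃ C hC, a ∈ componentPlus H α C ∧
      ∀ s ∈ S, (a, i) ∈ G.bag s → s ∈ sub C hC := by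
  obtain ⟨F, hF, haF, rfl⟩ := h.aghd.exists_edge ht hat
  obtain ⟨C, hC, hFC⟩ := hH.exists_component_of_edge hF fun hsub => (hsub haF).2 ha
  refine ⟨C, hC, (hH.mem_componentPlus_iff hC).2
    ⟨mem_edgesMeeting_vertexSet.2 ⟨F, hF, hFC, haF⟩, ha⟩, fun s hs has => ?_⟩
  obtain ⟨u, hu, hFu⟩ := (h.sub_aghd C hC).exists_node (F := F) ⟨hF, hFC⟩
  -- The occurrences of the copy form a subtree. It avoids `T₀`, whose bags hold output attributes
  -- only, and it contains the node that covers `F`.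
  refine (h.sub_component C hC).subset_of_connected (fun _ _ h => h.symm)
    (h.aghd.connected hF haF) ?_ ⟨u, ⟨((h.sub_subset hC) hu).1, hFu a haF⟩, hu⟩ ⟨hs, has⟩
  rintro x ⟨hx, hax⟩
  exact ⟨hx, fun hx0 => (h.mem_outputAttrs hx0 (CopyTree.mem_base_bag.2 ⟨_, hax⟩)).2 ha⟩

omit hH

/-- The root of the subtree is the first node of the subtree on some walk from the root. -/
theorem exists_walk_root (hr : ∃ p : G.tree.Walk G.root r, ∀ x ∈ p.support, x ∈ S → x = r) {t : N}
    (ht : t ∈ T₀) : ∃ p : G.tree.Walk G.root t, ∀ x ∈ p.support, x ∈ S → x ∈ T₀ := by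
  obtain ⟨p, hp⟩ := hr
  obtain ⟨q, hq⟩ := connectedIn_iff_exists_walk.1 (h.T₀_connected.2 r h.root_mem t ht)
  refine ⟨p.append q, fun x hx hxS => ?_⟩
  rcases (SimpleGraph.Walk.mem_support_append_iff _ _).1 hx with hx | hx
  · rw [hp x hx hxS]
    exact h.root_mem
  · exact hq x hx

theorem exists_walk_rt (hr : ∃ p : G.tree.Walk G.root r, ∀ x ∈ p.support, x ∈ S → x = r)
    (hC : IsQueryComponent H α C) : ∃ p : G.tree.Walk G.root (rt C hC),
      ∀ x ∈ p.support, x ∈ S → x ∈ T₀ ∨ x = rt C hC := by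
  obtain ⟨g, hg, hadj⟩ := (h.sub_root C hC).2
  obtain ⟨p, hp⟩ := h.exists_walk_root hr hg
  refine ⟨p.concat hadj, fun x hx hxS => ?_⟩
  rcases (by simpa using hx : x ∈ p.support ∨ x = rt C hC) with hx | hx
  · exact Or.inl (hp x hx hxS)
  · exact Or.inr hx

theorem exists_walk_rt' (hr : ∃ p : G.tree.Walk G.root r, ∀ x ∈ p.support, x ∈ S → x = r)
    (hC : IsQueryComponent H α C) : ∃ p : G.tree.Walk G.root (rt C hC),
      ∀ x ∈ p.support, x ∈ sub C hC → x = rt C hC := by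
  obtain ⟨p, hp⟩ := h.exists_walk_rt hr hC
  refine ⟨p, fun x hx hxC => (hp x hx (h.sub_subset hC hxC).1).resolve_left (h.sub_subset hC hxC).2⟩

theorem exists_walk_sub (hr : ∃ p : G.tree.Walk G.root r, ∀ x ∈ p.support, x ∈ S → x = r)
    (hC : IsQueryComponent H α C) {t : N} (ht : t ∈ sub C hC) :
    ∃ p : G.tree.Walk G.root t, ∀ x ∈ p.support, x ∈ S → x ∈ T₀ ∨ x ∈ sub C hC := by
  obtain ⟨p, hp⟩ := h.exists_walk_rt hr hC
  obtain ⟨q, hq⟩ := connectedIn_iff_exists_walk.1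
    ((h.sub_connected hC).2 _ (h.sub_root C hC).1 t ht)
  refine ⟨p.append q, fun x hx hxS => ?_⟩
  rcases (SimpleGraph.Walk.mem_support_append_iff _ _).1 hx with hx | hx
  · refine (hp x hx hxS).imp_right ?_
    rintro rfl
    exact (h.sub_root C hC).1
  · exact Or.inr (hq x hx)

end IsSplitting

/-! ### The order of the topmost nodes -/

/-- `t` is the topmost node of the copy `w` in the subtree `S`. -/
def TopIn (G : CopyTree V N) (S : Set N) (w : V × ℕ) (t : N) : Prop :=
  t ∈ S ∧ w ∈ G.bag t ∧ ∀ s ∈ S, w ∈ G.bag s → G.AncestorOrEq t s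

/-- In the subtree `S`, the topmost node of some copy of `a` is a proper ancestor of the topmost
node of some copy of `b`. -/
def Above (G : CopyTree V N) (S : Set N) (a b : V) : Prop :=
  ∃ i j s t, TopIn G S (a, i) s ∧ TopIn G S (b, j) t ∧ s ≠ t ∧ G.AncestorOrEq s t

/-- The single copy of `b` occurs in `T₀`. The ancestors within `S` of a node of `T₀` lie in `T₀`,
where no aggregated attribute occurs. The hypothesis `hr` says that `r` is the first node of `S` met
from the root. -/
theorem IsSplitting.not_above (h : IsSplitting G H α S r T₀ sub rt) (hH : IsAdmissible H α)
    (hr : ∃ p : G.tree.Walk G.root r, ∀ x ∈ p.support, x ∈ S → x = r)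
    (ha : a ∈ α.attrs) (hb : b ∈ outputAttrs H α) : ¬ Above G S a b := by
  rintro ⟨i, j, s, t, hs, ht, -, hst⟩
  obtain ⟨u, hu, hbu⟩ := h.exists_mem_T₀ hb
  obtain ⟨k, hk⟩ := CopyTree.mem_base_bag.1 hbu
  obtain rfl := h.aghd.copy_eq ((hH.mem_outputAttrs_iff hb.1).1 hb).2 (h.T₀_subset hu) ht.1 hk ht.2.1
  obtain ⟨p, hp⟩ := h.exists_walk_root hr hu
  have hsT := hp s ((hst.trans (ht.2.2 u (h.T₀_subset hu) hk)) p) hs.1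
  exact (h.mem_outputAttrs hsT (CopyTree.mem_base_bag.2 ⟨_, hs.2.1⟩)).2 ha

/-- Within `S`, the ancestors of a node in the subtree of a component lie in that subtree or in
`T₀`, so both topmost nodes belong to the same component. -/
theorem IsSplitting.above_component (h : IsSplitting G H α S r T₀ sub rt) (hH : IsAdmissible H α)
    (hr : ∃ p : G.tree.Walk G.root r, ∀ x ∈ p.support, x ∈ S → x = r)
    (ha : a ∈ α.attrs) (hb : b ∈ α.attrs) (hab : Above G S a b) :
    ∃ C hC, a ∈ componentPlus H α C ∧ b ∈ componentPlus H α C ∧ Above G (sub C hC) a b := by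
  obtain ⟨i, j, s, t, hs, ht, hne, hst⟩ := hab
  obtain ⟨C, hC, haC, hC'⟩ := h.exists_component hH ha hs.1 hs.2.1
  obtain ⟨D, hD, hbD, hD'⟩ := h.exists_component hH hb ht.1 ht.2.1
  have hsC := hC' s hs.1 hs.2.1
  have htD := hD' t ht.1 ht.2.1
  obtain ⟨p, hp⟩ := h.exists_walk_sub hr hD htD
  obtain rfl : C = D := h.component_eq hH hC hD hsC
    ((hp s (hst p) hs.1).resolve_left (h.sub_subset hC hsC).2)
  exact ⟨C, hC, haC, hbD, i, j, s, t,
    ⟨hsC, hs.2.1, fun x hx => hs.2.2 x (h.sub_subset hC hx).1⟩,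
    ⟨htD, ht.2.1, fun x hx => ht.2.2 x (h.sub_subset hC hx).1⟩, hne, hst⟩

/-- The depth of the topmost node that contains a copy of `a`. -/
noncomputable def topDepth (G : CopyTree V N) (S : Set N) (a : V) : ℕ :=
  sInf (G.tree.dist G.root '' {t | t ∈ S ∧ a ∈ G.base.bag t})

theorem CopyTree.IsAGHDOn.topDepth_eq (h : G.IsAGHDOn H α S) (ha : a ∉ α.productAttrs) {i : ℕ}
    {s : N} (hs : TopIn G S (a, i) s) : topDepth G S a = G.tree.dist G.root s := by
  have hmem : G.tree.dist G.root s ∈ G.tree.dist G.root '' {t | t ∈ S ∧ a ∈ G.base.bag t} :=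
    ⟨s, ⟨hs.1, CopyTree.mem_base_bag.2 ⟨_, hs.2.1⟩⟩, rfl⟩
  refine le_antisymm (Nat.sInf_le hmem) (le_csInf ⟨_, hmem⟩ ?_)
  rintro _ ⟨t, ⟨ht, hat⟩, rfl⟩
  obtain ⟨k, hk⟩ := CopyTree.mem_base_bag.1 hat
  obtain rfl := h.copy_eq ha hs.1 ht hs.2.1 hk
  by_cases hst : s = t
  · rw [hst]
  · exact ((hs.2.2 t ht hk).dist_lt hst).le

theorem CopyTree.IsAGHDOn.topDepth_lt (h : G.IsAGHDOn H α S) (ha : a ∉ α.productAttrs)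
    (hb : b ∉ α.productAttrs) (hab : Above G S a b) : topDepth G S a < topDepth G S b := by
  obtain ⟨i, j, s, t, hs, ht, hne, hst⟩ := hab
  rw [h.topDepth_eq ha hs, h.topDepth_eq hb ht]
  exact hst.dist_lt hne

/-! ### Forced precedences -/

/-- `a` has to stay before `b` in every equivalent ordering. -/
def Forced (H : Hypergraph V) (α : AggOrdering V ι) (a b : V) : Prop :=
  α.Precedes a b ∧ ¬ α.SameOp a b ∧ ConnectedIn H.Adj (α.semiringAfter a ∪ {a, b}) a b

/-- Before it reaches `b`, a path from `a` through semiring attributes cannot leave the component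
`C`. -/
theorem IsAdmissible.connectedIn_component (hH : IsAdmissible H α) (hC : IsQueryComponent H α C)
    {W : Set V} (hW : W ⊆ α.semiringAttrs) (ha : a ∈ C) (hb : b ∈ α.attrs)
    (hab : ConnectedIn H.Adj (W ∪ {a, b}) a b) :
    b ∈ componentPlus H α C ∧ ConnectedIn H.Adj (W ∩ C ∪ {a, b}) a b := by
  have key : ConnectedIn H.Adj (W ∩ C ∪ {a, b}) a b := by
    by_contra hn
    refine hn (hab.mem_of_closed {x | ConnectedIn H.Adj (W ∩ C ∪ {a, b}) a x}
      (.refl (Or.inr (Or.inl rfl))) fun x hx _ y hy hxy => ?_)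
    have hxC : x ∈ C := by
      rcases ConnectedIn.right_mem hx with h | rfl | rfl
      exacts [h.2, ha, absurd hx hn]
    refine ConnectedIn.trans hx (.of_rel hx.right_mem ?_ hxy)
    rcases hy with hy | hy
    · exact Or.inl ⟨hy, (hH.isQueryComponent_iff'.1 hC).2.2 x hxC y (hW hy) hxy⟩
    · exact Or.inr hy
  refine ⟨?_, key⟩
  by_contra hn
  have hne : b ∉ C := fun h => hn (Or.inl h)
  refine hne (key.mem_of_closed C ha fun x hx _ y hy hxy => ?_)
  obtain ⟨F, hF, hxF, hyF⟩ := hxy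
  rcases hy with hy | rfl | rfl
  · exact hy.2
  · exact ha
  · exact absurd ((hH.mem_componentPlus_iff hC).2
      ⟨mem_edgesMeeting_vertexSet.2 ⟨F, hF, ⟨x, hxF, hx⟩, hyF⟩, hb⟩) hn

/-- Two product attributes share their operator. So a forced pair has a semiring attribute, and this
attribute singles out a component. -/
theorem semiring_or_of_not_sameOp (ha : a ∈ α.attrs) (hb : b ∈ α.attrs) (h : ¬ α.SameOp a b) :
    a ∈ α.semiringAttrs ∨ b ∈ α.semiringAttrs := by
  rcases mem_attrs_cases ha with ha | ha
  · exact Or.inl ha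
  · rcases mem_attrs_cases hb with hb | hb
    · exact Or.inr hb
    · exact absurd ⟨_, ha, hb⟩ h

theorem IsAdmissible.forced_component (hH : IsAdmissible H α) (h : Forced H α a b) :
    ∃ C, IsQueryComponent H α C ∧ a ∈ componentPlus H α C ∧ b ∈ componentPlus H α C := by
  obtain ⟨hab, hop, hc⟩ := h
  have hW : α.semiringAfter a ⊆ α.semiringAttrs := fun x hx => hx.1
  rcases semiring_or_of_not_sameOp hab.left_mem hab.right_mem hop with ha | hb
  · obtain ⟨C, hC, haC⟩ := hH.exists_component ha
    exact ⟨C, hC, Or.inl haC, (hH.connectedIn_component hC hW haC hab.right_mem hc).1⟩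
  · obtain ⟨C, hC, hbC⟩ := hH.exists_component hb
    refine ⟨C, hC, (hH.connectedIn_component hC hW hbC hab.left_mem ?_).1, Or.inl hbC⟩
    rw [Set.pair_comm]
    exact hc.symm H.adj_symm'

theorem IsAdmissible.forced_connectedIn (hH : IsAdmissible H α) (hC : IsQueryComponent H α C)
    (haC : a ∈ componentPlus H α C) (hbC : b ∈ componentPlus H α C) (h : Forced H α a b) :
    ConnectedIn H.Adj ({s | s ∈ C ∧ α.Precedes a s} ∪ {a, b}) a b := by
  obtain ⟨hab, hop, hc⟩ := h
  have hW : α.semiringAfter a ⊆ α.semiringAttrs := fun x hx => hx.1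
  have hsub : α.semiringAfter a ∩ C ⊆ {s | s ∈ C ∧ α.Precedes a s} := fun s hs => ⟨hs.2, hs.1.2⟩
  rcases semiring_or_of_not_sameOp hab.left_mem hab.right_mem hop with ha | hb
  · have haC' := (hH.mem_component_iff hC).2 ⟨((hH.mem_componentPlus_iff hC).1 haC).1, ha⟩
    exact (hH.connectedIn_component hC hW haC' hab.right_mem hc).2.subset
      (Set.union_subset_union_left _ hsub)
  · have hbC' := (hH.mem_component_iff hC).2 ⟨((hH.mem_componentPlus_iff hC).1 hbC).1, hb⟩
    have := (hH.connectedIn_component hC hW hbC' hab.left_mem (by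
      rw [Set.pair_comm]
      exact hc.symm H.adj_symm')).2
    rw [Set.pair_comm] at this
    exact (this.symm H.adj_symm').subset (Set.union_subset_union_left _ hsub)

/-- A product front is the first attribute of `C⁺`. In the other case the definition of the front
excludes an earlier connected attribute with a different operator. -/
theorem IsAdmissible.not_forced_front (hH : IsAdmissible H α) (hC : IsQueryComponent H α C)
    (haC : a ∈ componentPlus H α C) (hb : b ∈ componentFront H α C) : ¬ Forced H α a b := by
  intro h
  have hc := hH.forced_connectedIn hC haC (hH.componentFront_subset hb) h
  rcases hH.componentFront_cases hC with ⟨p, hp, hp', hfirst⟩ | ⟨f, i, -, -, -, hfront⟩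
  · rw [hp] at hb
    obtain rfl := hb
    exact (hfirst.2.2 a haC h.1.left_mem (h.1.ne hH.nodup)).asymm hH.nodup h.1
  · rcases (hfront b (hH.componentFront_subset hb)).1 hb a haC h.1 with h' | h'
    · exact h.2.1 h'
    · rw [Set.pair_comm] at h'
      exact h' (hc.symm H.adj_symm')

theorem SameOp.trans' (hα : (α.map Prod.fst).Nodup) {c : V} (h : α.SameOp a b)
    (h' : α.SameOp b c) : α.SameOp a c := by
  obtain ⟨o, h1, h2⟩ := h
  obtain ⟨o', h3, h4⟩ := h'
  cases op_eq hα h2 h3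
  exact ⟨o, h1, h4⟩

/-- Making the front attributes output attributes must not destroy the connection between `a` and
`b`. It does not, because no front attribute is reached from `a` through later attributes of `C`. -/
theorem IsAdmissible.forced_sub (hH : IsAdmissible H α) (hC : IsQueryComponent H α C)
    (haC : a ∈ componentPlus H α C) (hbC : b ∈ componentPlus H α C)
    (ha : a ∉ componentFront H α C) (hb : b ∉ componentFront H α C) (h : Forced H α a b) :
    Forced (edgesMeeting H C) (componentOrdering H α C) a b := by
  have hc := hH.forced_connectedIn hC haC hbC h
  obtain ⟨hab, hop, -⟩ := h
  -- front attributes after `a` are not connected to `a`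
  have hfront : ∀ s ∈ componentFront H α C, s ∈ C → α.Precedes a s →
      ¬ ConnectedIn H.Adj ({s | s ∈ C ∧ α.Precedes a s} ∪ {a}) a s := by
    intro s hs hsC has hcon
    rcases hH.componentFront_cases hC with ⟨p, hp, hp', -⟩ | ⟨f, i, -, -, hfi, hfr⟩
    · rw [hp] at hs
      obtain rfl := hs
      exact notMem_productAttrs hH.nodup (hH.subset_semiringAttrs hC hsC) hp'
    have hs' := (hfr s (Or.inl hsC)).1 hs
    have hso : α.SameOp a s := by
      refine (hs' a haC has).resolve_right fun hn => hn ((hcon.symm H.adj_symm').subset ?_)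
      rintro x (hx | rfl)
      · exact Or.inl hx
      · exact Or.inr (Or.inr rfl)
    have haC' : a ∈ C := by
      obtain ⟨o, h1, h2⟩ := hso
      cases op_eq hH.nodup h2 (hfi s hs).2
      exact (hH.mem_component_iff hC).2 ⟨((hH.mem_componentPlus_iff hC).1 haC).1, ⟨i, h1⟩⟩
    -- As `a` is not in the front, an earlier `B` with a different operator is connected to it. The
    -- path from `s` through `a` to `B` then keeps `s` out of the front, too.
    have ha' := mt (hfr a haC).2 ha
    push Not at ha'
    obtain ⟨B, hB, hBa, hBop, hBcon⟩ := ha'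
    rcases hs' B hB (hBa.trans hH.nodup has) with h' | h'
    · obtain ⟨o, h1, h2⟩ := hso
      exact hBop (SameOp.trans' hH.nodup h' ⟨o, h2, h1⟩)
    · refine h' (((hcon.symm H.adj_symm').subset ?_).trans (hBcon.subset ?_))
      · rintro x (⟨hx, hax⟩ | rfl)
        · exact Or.inl ⟨hx, hBa.trans hH.nodup hax⟩
        · exact Or.inl ⟨haC', hBa⟩
      · rintro x (hx | rfl | rfl)
        · exact Or.inl hx
        · exact Or.inl ⟨haC', hBa⟩
        · exact Or.inr (Or.inr rfl)
  have haS : a ∈ componentPlus H α C \ componentFront H α C := ⟨haC, ha⟩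
  have hbS : b ∈ componentPlus H α C \ componentFront H α C := ⟨hbC, hb⟩
  refine ⟨(precedes_restrict hH.nodup).2 ⟨hab, haS, hbS⟩, fun ⟨o, h1, h2⟩ => hop
    ⟨o, (restrict_sublist _ _).subset h1, (restrict_sublist _ _).subset h2⟩, ?_⟩
  have hinC : a ∈ C ∨ b ∈ C := by
    refine (semiring_or_of_not_sameOp hab.left_mem hab.right_mem hop).imp ?_ ?_
    · exact fun h => (hH.mem_component_iff hC).2 ⟨((hH.mem_componentPlus_iff hC).1 haC).1, h⟩
    · exact fun h => (hH.mem_component_iff hC).2 ⟨((hH.mem_componentPlus_iff hC).1 hbC).1, h⟩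
  set U := {s | s ∈ C ∧ s ∉ componentFront H α C ∧ α.Precedes a s} with hU
  have hUsub : U ⊆ (componentOrdering H α C).semiringAfter a := by
    rintro s ⟨h1, h2, h3⟩
    exact ⟨mem_semiringAttrs_restrict.2 ⟨hH.subset_semiringAttrs hC h1, Or.inl h1, h2⟩,
      (precedes_restrict hH.nodup).2 ⟨h3, haS, Or.inl h1, h2⟩⟩
  by_contra hn
  have hstep : ∀ x ∈ U ∪ {a}, ∀ y, H.Adj x y → (x ∈ C ∨ y ∈ C) → (edgesMeeting H C).Adj x y := by
    rintro x - y ⟨F, hF, hxF, hyF⟩ (hx | hy)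
    · exact ⟨F, ⟨hF, x, hxF, hx⟩, hxF, hyF⟩
    · exact ⟨F, ⟨hF, y, hyF, hy⟩, hxF, hyF⟩
  -- Two connections are carried along the path: one that avoids the front in the smaller
  -- hypergraph, and one in `H` to which `hfront` applies at the next point.
  have hZ := hc.mem_of_closed {x | ConnectedIn (edgesMeeting H C).Adj (U ∪ {a}) a x ∧
      ConnectedIn H.Adj ({s | s ∈ C ∧ α.Precedes a s} ∪ {a}) a x}
    ⟨.refl (Or.inr rfl), .refl (Or.inr rfl)⟩ ?_
  · exact hn (hZ.1.subset (Set.union_subset_union hUsub (by simp)))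
  · rintro x ⟨hx, hx'⟩ - y hy hxy
    rcases hy with hy | rfl | rfl
    · have hcon := hx'.trans (.of_rel hx'.right_mem (Or.inl hy) hxy)
      have hyf : y ∉ componentFront H α C := fun hyf => hfront y hyf hy.1 hy.2 hcon
      exact ⟨hx.trans (.of_rel hx.right_mem (Or.inl ⟨hy.1, hyf, hy.2⟩)
        (hstep x hx.right_mem y hxy (Or.inr hy.1))), hcon⟩
    · exact ⟨.refl (Or.inr rfl), .refl (Or.inr rfl)⟩
    · have hxC : x ∈ C ∨ y ∈ C := by
        rcases hx.right_mem with h | rfl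
        exacts [Or.inl h.1, hinC]
      exact absurd ((hx.subset (Set.union_subset_union hUsub (by simp))).trans
        (.of_rel (Set.union_subset_union hUsub (by simp) hx.right_mem) (Or.inr (Or.inr rfl))
          (hstep x hx.right_mem y hxy hxC))) hn

end Decomposable

/-! ### Decomposable AGHDs are compatible with an equivalent ordering -/

section Rank

variable {V N ι : Type*} {G : CopyTree V N}

theorem exists_between_of_finite {s : Set V} (hs : s.Finite) {v : V → ℚ} {L : ℚ}
    (h : ∀ a ∈ s, L < v a) : ∃ L', L < L' ∧ ∀ a ∈ s, L' < v a := by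
  induction s, hs using Set.Finite.induction_on with
  | empty => exact ⟨L + 1, by linarith, by simp⟩
  | @insert a s _ _ ih =>
    obtain ⟨L', h1, h2⟩ := ih fun b hb => h b (Or.inr hb)
    obtain ⟨M, hM1, hM2⟩ := exists_between (lt_min h1 (h a (Or.inl rfl)))
    refine ⟨M, hM1, ?_⟩
    rintro b (rfl | hb)
    · exact hM2.trans_le (min_le_right _ _)
    · exact (hM2.trans_le (min_le_left _ _)).trans (h2 b hb)

/-- The rank of an attribute at depth `d` in the interval `(L, L')`. -/
def depthRank (L L' : ℚ) (d : ℕ) : ℚ := L' - (L' - L) / (d + 2)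

/-- The summand `2` in the denominator makes the inequality strict at depth `0`. -/
theorem lt_depthRank {L L' : ℚ} (h : L < L') (d : ℕ) : L < depthRank L L' d := by
  have hd : (0 : ℚ) ≤ d := Nat.cast_nonneg d
  have : (L' - L) / (d + 2) < L' - L := by
    rw [div_lt_iff₀ (by positivity)]
    nlinarith
  rw [depthRank]
  linarith

theorem depthRank_lt {L L' : ℚ} (h : L < L') (d : ℕ) : depthRank L L' d < L' := by
  have : 0 < (L' - L) / ((d : ℚ) + 2) := div_pos (by linarith) (by positivity)
  rw [depthRank]
  linarith

theorem depthRank_strictMono {L L' : ℚ} (h : L < L') {d e : ℕ} (hde : d < e) :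
    depthRank L L' d < depthRank L L' e := by
  have hde' : (d : ℚ) < e := Nat.cast_lt.2 hde
  have : (L' - L) / ((e : ℚ) + 2) < (L' - L) / ((d : ℚ) + 2) :=
    div_lt_div_of_pos_left (by linarith) (by positivity) (by linarith)
  rw [depthRank, depthRank]
  linarith

/-- `ρ` is a rank function on `s` above `L` for the constraints, with given values of the product
attributes. -/
structure IsRank (G : CopyTree V N) (H : Hypergraph V) (α : AggOrdering V ι) (S : Set N)
    (v : V → ℚ) (L : ℚ) (s : Set V) (ρ : V → ℚ) : Prop where
  eq_of_product : ∀ a ∈ s, a ∈ α.productAttrs → ρ a = v a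
  lt : ∀ a ∈ s, L < ρ a
  mono : ∀ a ∈ s, ∀ b ∈ s, a ≠ b → Above G S a b ∨ Forced H α a b → ρ a < ρ b

variable {H : Hypergraph V} {α : AggOrdering V ι} {S : Set N} {r : N}

/-- The front has to come before the rest. If it is a product attribute `p`, the rest is ranked
above the prescribed value `v p`. Otherwise some `L'` lies between `L` and all prescribed values;
the front attributes are ranked in `(L, L')` by the depth of their topmost nodes, and the rest above
`L'`. Front attributes have the same operator, so no pair of them is forced. -/
theorem exists_rank_component (hH : IsAdmissible H α) {C : Set V} (hC : IsQueryComponent H α C)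
    {v : V → ℚ} (hv : ∀ a ∈ α.productAttrs, ∀ b ∈ α.productAttrs, α.Precedes a b → v a < v b)
    {L : ℚ} (hL : ∀ a ∈ α.productAttrs, L < v a)
    (haghd : G.IsAGHDOn (edgesMeeting H C) (componentOrdering H α C) S)
    (habove : ∀ a b, a ∈ (componentOrdering H α C).attrs →
      b ∈ outputAttrs (edgesMeeting H C) (componentOrdering H α C) → ¬ Above G S a b)
    (ih : ∀ L', (∀ a ∈ (componentOrdering H α C).productAttrs, L' < v a) →
      ∃ ρ, IsRank G (edgesMeeting H C) (componentOrdering H α C) S v L'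
        (componentOrdering H α C).attrs ρ) :
    ∃ ρ : V → ℚ, (∀ a ∈ componentPlus H α C, a ∈ α.productAttrs → ρ a = v a) ∧
      (∀ a ∈ componentPlus H α C, L < ρ a) ∧
      ∀ a ∈ componentPlus H α C, ∀ b ∈ componentPlus H α C, a ≠ b →
        Above G S a b ∨ Forced H α a b → ρ a < ρ b := by
  classical
  have hattr : ∀ a ∈ componentPlus H α C, a ∉ componentFront H α C →
      a ∈ (componentOrdering H α C).attrs := fun a h1 h2 =>
    (hH.mem_attrs_componentOrdering hC).2 ⟨h1, h2⟩
  have hpa : ∀ a, a ∈ (componentOrdering H α C).productAttrs ↔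
      a ∈ α.productAttrs ∧ a ∈ componentPlus H α C ∧ a ∉ componentFront H α C := fun a =>
    mem_productAttrs_restrict
  have hnot : ∀ a ∈ componentPlus H α C, a ∉ componentFront H α C →
      ∀ b ∈ componentFront H α C, ¬ (Above G S a b ∨ Forced H α a b) := by
    rintro a ha ha' b hb (h | h)
    · exact habove a b (hattr a ha ha') ((hH.mem_outputAttrs_component hC).2 (Or.inr hb)) h
    · exact hH.not_forced_front hC ha hb h
  have hsub : ∀ a ∈ componentPlus H α C, a ∉ componentFront H α C →
      ∀ b ∈ componentPlus H α C, b ∉ componentFront H α C → Above G S a b ∨ Forced H α a b →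
      Above G S a b ∨ Forced (edgesMeeting H C) (componentOrdering H α C) a b :=
    fun a ha ha' b hb hb' h => h.imp_right (hH.forced_sub hC ha hb ha' hb')
  rcases hH.componentFront_cases hC with ⟨p, hp, hp', hfirst⟩ | ⟨f, i, -, -, hfi, -⟩
  · obtain ⟨ρ, hρ⟩ := ih (v p) fun a ha => by
      obtain ⟨h1, h2, h3⟩ := (hpa a).1 ha
      refine hv p hp' a h1 (hfirst.2.2 a h2 (productAttrs_subset h1) ?_)
      rintro rfl
      exact h3 (by simp [hp])
    have hpf : ∀ a, a ∈ componentFront H α C ↔ a = p := fun a => by rw [hp]; rfl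
    have hLp := hL p hp'
    refine ⟨fun x => if x = p then v p else ρ x, fun a ha ha' => ?_, fun a ha => ?_,
      fun a ha b hb hab h => ?_⟩
    · by_cases hap : a = p
      · simp [hap]
      · simp only [if_neg hap]
        have := mt (hpf a).1 hap
        exact hρ.eq_of_product a (hattr a ha this) ((hpa a).2 ⟨ha', ha, this⟩)
    · by_cases hap : a = p
      · simpa [hap] using hLp
      · simp only [if_neg hap]
        exact hLp.trans (hρ.lt a (hattr a ha (mt (hpf a).1 hap)))
    · by_cases hbp : b = p
      · exact absurd h (hnot a ha (mt (hpf a).1 fun hap => hab (hap.trans hbp.symm)) b ((hpf b).2 hbp))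
      · have hb' := mt (hpf b).1 hbp
        by_cases hap : a = p
        · simp only [if_neg hbp, if_pos hap]
          exact hρ.lt b (hattr b hb hb')
        · have ha' := mt (hpf a).1 hap
          simp only [if_neg hbp, if_neg hap]
          exact hρ.mono a (hattr a ha ha') b (hattr b hb hb') hab (hsub a ha ha' b hb hb' h)
  · obtain ⟨L', hL', hLv⟩ := exists_between_of_finite (hH.finite.subset
      (productAttrs_subset.trans hH.attrs_subset)) hL
    obtain ⟨ρ, hρ⟩ := ih L' fun a ha => hLv a ((hpa a).1 ha).1
    have hnp : ∀ a ∈ componentFront H α C, a ∉ α.productAttrs := fun a ha =>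
      notMem_productAttrs hH.nodup ⟨i, (hfi a ha).2⟩
    refine ⟨fun x => if x ∈ componentFront H α C then depthRank L L' (topDepth G S x) else ρ x,
      fun a ha ha' => ?_, fun a ha => ?_, fun a ha b hb hab h => ?_⟩
    · have haf : a ∉ componentFront H α C := fun h => hnp a h ha'
      simp only [if_neg haf]
      exact hρ.eq_of_product a (hattr a ha haf) ((hpa a).2 ⟨ha', ha, haf⟩)
    · by_cases haf : a ∈ componentFront H α C
      · simp only [if_pos haf]
        exact lt_depthRank hL' _
      · simp only [if_neg haf]
        exact hL'.trans (hρ.lt a (hattr a ha haf))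
    · by_cases hbf : b ∈ componentFront H α C
      · have haf : a ∈ componentFront H α C := not_not.1 fun haf => hnot a ha haf b hbf h
        simp only [if_pos haf, if_pos hbf]
        refine depthRank_strictMono hL' (haghd.topDepth_lt (fun h => hnp a haf ((hpa a).1 h).1)
          (fun h => hnp b hbf ((hpa b).1 h).1) (h.resolve_right fun h => ?_))
        exact h.2.1 ⟨_, (hfi a haf).2, (hfi b hbf).2⟩
      · by_cases haf : a ∈ componentFront H α C
        · simp only [if_pos haf, if_neg hbf]
          exact (depthRank_lt hL' _).trans (hρ.lt b (hattr b hb hbf))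
        · simp only [if_neg haf, if_neg hbf]
          exact hρ.mono a (hattr a ha haf) b (hattr b hb hbf) hab (hsub a ha haf b hb hbf h)

/-- The lower bound `L` has to vary in the induction, because the rest of a component is ranked
above its front. The prescribed values `v` make the ranks of different components agree on common
product attributes. -/
theorem IsDecomposableOn.exists_rank (h : IsDecomposableOn G H α S r) (hH : IsAdmissible H α)
    (hr : ∃ p : G.tree.Walk G.root r, ∀ x ∈ p.support, x ∈ S → x = r)
    {v : V → ℚ} (hv : ∀ a ∈ α.productAttrs, ∀ b ∈ α.productAttrs, α.Precedes a b → v a < v b)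
    {L : ℚ} (hL : ∀ a ∈ α.productAttrs, L < v a) : ∃ ρ, IsRank G H α S v L α.attrs ρ := by
  classical
  induction h generalizing L with
  | intro H α S r T₀ h0 h1 h2 h3 h4 sub rt h5 h6 h7 h8 ih =>
    have hs : IsSplitting G H α S r T₀ sub rt :=
      ⟨h0, h1, h2, h3, h4, h5, h6, fun C hC => (h8 C hC).aghd⟩
    have key : ∀ C (hC : IsQueryComponent H α C), ∃ ρ : V → ℚ,
        (∀ a ∈ componentPlus H α C, a ∈ α.productAttrs → ρ a = v a) ∧
        (∀ a ∈ componentPlus H α C, L < ρ a) ∧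
        ∀ a ∈ componentPlus H α C, ∀ b ∈ componentPlus H α C, a ≠ b →
          Above G (sub C hC) a b ∨ Forced H α a b → ρ a < ρ b := by
      intro C hC
      obtain ⟨T, sub', rt', hs', -⟩ := (h8 C hC).exists_splitting
      refine exists_rank_component hH hC hv hL (h8 C hC).aghd (fun a b ha hb => ?_) fun L' hL' => ?_
      · exact hs'.not_above (hH.meeting hC) (hs.exists_walk_rt' hr hC) ha hb
      · refine ih C hC (hH.meeting hC) (hs.exists_walk_rt' hr hC) (fun a ha b hb hab => ?_) hL'
        exact hv a (mem_productAttrs_restrict.1 ha).1 b (mem_productAttrs_restrict.1 hb).1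
          (hab.of_sublist (restrict_sublist _ _))
    choose ρ hρ1 hρ2 hρ3 using key
    -- A semiring attribute takes its rank from its unique component; the default `0` is given only
    -- to attributes that are not aggregated.
    let ρ' : V → ℚ := fun x => if x ∈ α.productAttrs then v x else
      if hx : ∃ C, IsQueryComponent H α C ∧ x ∈ C then ρ hx.choose hx.choose_spec.1 x else 0
    have hρ' : ∀ C hC, ∀ a ∈ componentPlus H α C, ρ' a = ρ C hC a := by
      intro C hC a ha
      by_cases hap : a ∈ α.productAttrs
      · simp only [ρ', if_pos hap]
        exact (hρ1 C hC a ha hap).symm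
      · have haC : a ∈ C := ha.resolve_right fun h => hap h.1
        have hx : ∃ C, IsQueryComponent H α C ∧ a ∈ C := ⟨C, hC, haC⟩
        have hCe : hx.choose = C := hH.component_eq hx.choose_spec.1 hC ⟨a, hx.choose_spec.2, haC⟩
        simp only [ρ', if_neg hap, dif_pos hx]
        congr
    refine ⟨ρ', fun a _ ha => if_pos ha, fun a ha => ?_, fun a ha b hb hab h => ?_⟩
    · rcases mem_attrs_cases ha with ha | ha
      · obtain ⟨C, hC, haC⟩ := hH.exists_component ha
        rw [hρ' C hC a (Or.inl haC)]
        exact hρ2 C hC a (Or.inl haC)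
      · simp only [ρ', if_pos ha]
        exact hL a ha
    · obtain ⟨C, hC, haC, hbC, h⟩ : ∃ C hC, a ∈ componentPlus H α C ∧ b ∈ componentPlus H α C ∧
          (Above G (sub C hC) a b ∨ Forced H α a b) := by
        rcases h with h | h
        · obtain ⟨C, hC, h1, h2, h3⟩ := hs.above_component hH hr ha hb h
          exact ⟨C, hC, h1, h2, Or.inl h3⟩
        · obtain ⟨C, hC, h1, h2⟩ := hH.forced_component h
          exact ⟨C, hC, h1, h2, Or.inr h⟩
      rw [hρ' C hC a haC, hρ' C hC b hbC]
      exact hρ3 C hC a haC b hbC hab h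

open Classical in
theorem AggOrdering.Precedes.idxOf_lt {a b : V} (hα : (α.map Prod.fst).Nodup)
    (h : α.Precedes a b) : (α.map Prod.fst).idxOf a < (α.map Prod.fst).idxOf b := by
  induction α with
  | nil => cases h
  | cons p α ih =>
    obtain ⟨c, o⟩ := p
    obtain ⟨hc, hα'⟩ := nodup_cons hα
    have hne := h.ne hα
    rw [List.map_cons]
    rcases precedes_cons.1 h with ⟨rfl, hb⟩ | h
    · rw [List.idxOf_cons_self, List.idxOf_cons_ne _ hne]
      exact Nat.succ_pos _
    · have ha : c ≠ a := fun h' => hc (h' ▸ h.left_mem)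
      have hb : c ≠ b := fun h' => hc (h' ▸ h.right_mem)
      rw [List.idxOf_cons_ne _ ha, List.idxOf_cons_ne _ hb]
      exact Nat.succ_lt_succ (ih hα' h)

theorem exists_perm_of_rank (α : AggOrdering V ι) (ρ : V → ℚ) :
    ∃ β : AggOrdering V ι, α.Perm β ∧ ∀ a ∈ α.attrs, ∀ b ∈ α.attrs, ρ a < ρ b → β.Precedes a b := by
  classical
  let R : V × AggOp ι → V × AggOp ι → Prop := fun p q => ρ p.1 ≤ ρ q.1
  have : Std.Total R := ⟨fun p q => le_total _ _⟩
  have : IsTrans _ R := ⟨fun p q s h h' => le_trans h h'⟩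
  have hperm := List.perm_insertionSort R α
  refine ⟨α.insertionSort R, hperm.symm, fun a ha b hb hab => ?_⟩
  have hmem : ∀ x ∈ α.attrs, x ∈ attrs (α.insertionSort R) := by
    rintro x ⟨o, hx⟩
    exact ⟨o, hperm.mem_iff.2 hx⟩
  rcases precedes_total (hmem a ha) (hmem b hb) (by rintro rfl; exact lt_irrefl _ hab) with h | h
  · exact h
  · have hp : ((α.insertionSort R).map Prod.fst).Pairwise fun x y => ρ x ≤ ρ y :=
      List.pairwise_map.2 (List.pairwise_insertionSort R α)
    have := hp.sublist h
    simp only [List.pairwise_cons, List.mem_singleton, forall_eq] at this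
    exact absurd this.1 (not_le.2 hab)

theorem CopyTree.IsDecomposable.exists_compatible {K : Type*} [CommMonoidWithZero K]
    (O : OperatorSet ι K) (hidem : ∀ x : K, x * x = x) (hH : IsAdmissible H α)
    (h : G.IsDecomposable H α) :
    ∃ β : AggOrdering V ι, β.IsOrderingOn H ∧ OrderEquiv O H α β ∧ G.Compatible β := by
  classical
  have hr : ∃ p : G.tree.Walk G.root G.root, ∀ x ∈ p.support, x ∈ Set.univ → x = G.root :=
    ⟨.nil, by simp⟩
  -- Product attributes are ranked by their positions in `α`, which start at `0`, so `-1` is a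
  -- strict lower bound.
  obtain ⟨ρ, hρ⟩ := IsDecomposableOn.exists_rank h hH hr
    (v := fun a => ((α.map Prod.fst).idxOf a : ℚ)) (L := -1)
    (fun a _ b _ hab => by exact_mod_cast hab.idxOf_lt hH.nodup)
    (fun a _ => lt_of_lt_of_le (by norm_num) (Nat.cast_nonneg _))
  obtain ⟨β, hperm, hβ⟩ := exists_perm_of_rank α ρ
  have hattrs : α.attrs = β.attrs := by
    ext x
    simp only [attrs, Set.mem_ofPred_eq, hperm.mem_iff]
  have hnd : (β.map Prod.fst).Nodup := (hperm.map _).nodup_iff.1 hH.nodup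
  refine ⟨β, ⟨hnd, hattrs ▸ hH.attrs_subset⟩, ⟨hattrs, fun D _ _ R => ?_⟩, ?_⟩
  -- A pair that is inverted but does not commute would be forced, and then the ranks would have
  -- kept its order.
  · refine ajarQuery_eq_of_perm hidem hH.finite R hH.nodup hperm fun a b hab hba => ?_
    by_contra hn
    rw [not_or, not_not] at hn
    have := hρ.mono a hab.left_mem b hab.right_mem (hab.ne hH.nodup) (Or.inr ⟨hab, hn.1, hn.2⟩)
    exact (hβ a hab.left_mem b hab.right_mem this).asymm hnd hba
  · intro a b hab i j s t hs ht hst hanc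
    rw [or_iff_not_imp_left, not_not, ← hattrs]
    intro ha
    have hA : Above G Set.univ a b := ⟨i, j, s, t, ⟨trivial, hs.1, fun x _ => hs.2 x⟩,
      ⟨trivial, ht.1, fun x _ => ht.2 x⟩, hst, hanc⟩
    -- The ranks only concern aggregated attributes. An output attribute `b` is excluded, since no
    -- aggregated attribute is above it.
    have hb : b ∈ α.attrs := by
      by_contra hb
      obtain ⟨T, sub, rt, hs', -⟩ := IsDecomposableOn.exists_splitting h
      refine hs'.not_above hH hr ha ⟨?_, hb⟩ hA
      exact hs'.aghd.mem_vertexSet trivial (CopyTree.mem_base_bag.2 ⟨j, ht.1⟩)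
    exact hβ a ha b hb (hρ.mono a ha b hb hab (Or.inl hA))

end Rank

/-! ### Equivalent orderings agree on the first attribute of a connected set -/

section Diagonal

variable {V ι K : Type*} [CommMonoidWithZero K] {O : OperatorSet ι K} {U W : Set V}

/-- Two values for the attributes in `U`, a single one for the others. -/
@[ext]
structure TwoValued (U : Set V) (a : V) : Type where
  val : Bool
  mem : val = true → a ∈ U

instance (a : V) : Finite (TwoValued U a) :=
  Finite.of_injective TwoValued.val fun _ _ h => TwoValued.ext h

noncomputable instance (a : V) : Fintype (TwoValued U a) := Fintype.ofFinite _

instance (a : V) : Nonempty (TwoValued U a) := ⟨⟨false, by simp⟩⟩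

theorem TwoValued.eq_of_notMem {a : V} (ha : a ∉ U) (d e : TwoValued U a) : d = e := by
  obtain ⟨d, hd⟩ := d
  obtain ⟨e, he⟩ := e
  refine TwoValued.ext ?_
  cases d <;> cases e <;> simp_all

open Classical in
theorem TwoValued.univ_eq {a : V} (ha : a ∈ U) : (Finset.univ : Finset (TwoValued U a)) =
    {⟨false, fun _ => ha⟩, ⟨true, fun _ => ha⟩} := by
  ext ⟨b, hb⟩
  cases b <;> simp

open Classical in
/-- `p` if all values on `W` are `false`, `q` if all of them are `true`, otherwise `0`. -/
noncomputable def diag (W : Set V) (p q : K) (x : ∀ a, TwoValued U a) : K :=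
  if ∀ a ∈ W, (x a).1 = false then p else if ∀ a ∈ W, (x a).1 = true then q else 0

open Classical in
/-- The relations whose join is the diagonal. -/
noncomputable def diagRel (U F₀ : Set V) (p q : K) (F : Set V) (y : ∀ a : F, TwoValued U a) : K :=
  -- Only the edge `F₀` carries the annotations `p` and `q`. An edge disjoint from `U` passes this
  -- test vacuously.
  if ∀ a : F, a.1 ∈ U → (y a).1 = false then (if F = F₀ then p else 1)
  else if ∀ a : F, a.1 ∈ U → (y a).1 = true then (if F = F₀ then q else 1) else 0

/-- If a tuple is not constant on `U`, connectivity gives an edge that contains attributes of `U`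
with both values, and the relation of that edge vanishes. On the constant tuples `F₀`, which meets
`U`, contributes `p` or `q`. -/
theorem joinAnnotation_diagRel {H : Hypergraph V} (hfin : H.vertexSet.Finite)
    (hU : IsConnectedSet H.Adj U) {F₀ : Set V} (hF₀ : F₀ ∈ H.edgeSet) (hF₀U : (F₀ ∩ U).Nonempty)
    (p q : K) (x : ∀ a, TwoValued U a) :
    joinAnnotation H (diagRel U F₀ p q) x = diag U p q x := by
  classical
  have hf := H.finite_edgeSet hfin
  have hone : ∀ c : K, ∏ᶠ F ∈ H.edgeSet, (if F = F₀ then c else 1) = c := by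
    intro c
    rw [finprod_mem_eq_finite_toFinset_prod _ hf, Finset.prod_ite_eq' _ F₀ (fun _ => c)]
    simp [hF₀]
  rw [joinAnnotation, diag]
  by_cases h1 : ∀ a ∈ U, (x a).1 = false
  · rw [if_pos h1]
    refine (finprod_mem_congr rfl fun F _ => ?_).trans (hone p)
    have hF : ∀ a : F, a.1 ∈ U → (x a).val = false := fun a ha => h1 a.1 ha
    rw [diagRel, if_pos hF]
  rw [if_neg h1]
  by_cases h2 : ∀ a ∈ U, (x a).1 = true
  · rw [if_pos h2]
    refine (finprod_mem_congr rfl fun F _ => ?_).trans (hone q)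
    rw [diagRel]
    by_cases hF : ∀ a : F, a.1 ∈ U → (x a).1 = false
    · have hne : F ≠ F₀ := by
        rintro rfl
        obtain ⟨a, haF, haU⟩ := hF₀U
        have := hF ⟨a, haF⟩ haU
        rw [h2 a haU] at this
        cases this
      rw [if_pos hF, if_neg hne, if_neg hne]
    · have hF' : ∀ a : F, a.1 ∈ U → (x a).val = true := fun a ha => h2 a.1 ha
      rw [if_neg hF, if_pos hF']
  rw [if_neg h2]
  push Not at h1 h2
  obtain ⟨a, haU, ha⟩ := h1
  obtain ⟨b, hbU, hb⟩ := h2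
  have ha' : (x a).1 = true := by simpa using ha
  have hb' : (x b).1 = false := by simpa using hb
  obtain ⟨F, hF, c, hcF, hcU, hc, d, hdF, hdU, hd⟩ : ∃ F ∈ H.edgeSet, ∃ c ∈ F, c ∈ U ∧
      (x c).1 = true ∧ ∃ d ∈ F, d ∈ U ∧ (x d).1 = false := by
    by_contra hn
    push Not at hn
    have := (hU.2 a haU b hbU).mem_of_closed {v | (x v).1 = true} ha' fun u hu huU v hv huv => by
      obtain ⟨F, hF, huF, hvF⟩ := huv
      simpa using hn F hF u huF huU hu v hvF hv
    rw [Set.mem_ofPred_eq, hb'] at this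
    cases this
  rw [finprod_mem_eq_finite_toFinset_prod _ hf]
  refine Finset.prod_eq_zero (hf.mem_toFinset.2 hF) ?_
  rw [diagRel, if_neg, if_neg]
  · intro h
    have := h ⟨d, hdF⟩ hdU
    rw [hd] at this
    cases this
  · intro h
    have := h ⟨c, hcF⟩ hcU
    rw [hc] at this
    cases this

open Classical in
theorem aggregate_of_notMem {a : V} (ha : a ∉ U) (o : AggOp ι) (f : (∀ a, TwoValued U a) → K)
    (x : ∀ a, TwoValued U a) : aggregate O (a, o) f x = f x := by
  have hu : (Finset.univ : Finset (TwoValued U a)) = {x a} := by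
    ext d
    simp [TwoValued.eq_of_notMem ha d (x a)]
  cases o with
  | sum i => rw [aggregate_sum, hu, Finset.fold_singleton, O.add_zero, Function.update_eq_self]
  | prod => rw [aggregate_prod, hu, Finset.prod_singleton, Function.update_eq_self]

/-- The operator of an aggregation, applied to two elements. -/
def AggOp.apply (O : OperatorSet ι K) : AggOp ι → K → K → K
  | AggOp.sum i => O.add i
  | AggOp.prod => fun p q => p * q

open Classical in
theorem aggregate_of_mem {a : V} (ha : a ∈ U) (o : AggOp ι) (f : (∀ a, TwoValued U a) → K)
    (x : ∀ a, TwoValued U a) : aggregate O (a, o) f x =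
      o.apply O (f (Function.update x a ⟨false, fun _ => ha⟩))
        (f (Function.update x a ⟨true, fun _ => ha⟩)) := by
  have hne : (⟨false, fun _ => ha⟩ : TwoValued U a) ∉
      ({⟨true, fun _ => ha⟩} : Finset (TwoValued U a)) := by
    rw [Finset.mem_singleton]
    intro h
    cases congrArg TwoValued.val h
  cases o with
  | sum i =>
    rw [aggregate_sum, TwoValued.univ_eq ha, Finset.fold_insert hne, Finset.fold_singleton,
      O.add_zero]
    rfl
  | prod =>
    rw [aggregate_prod, TwoValued.univ_eq ha, Finset.prod_insert hne, Finset.prod_singleton]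
    rfl

/-- The product differs from every addition at the arguments `1` and `0`. -/
theorem AggOp.apply_injective [Nontrivial K] {o o' : AggOp ι}
    (h : ∀ p q : K, o.apply O p q = o'.apply O p q) : o = o' := by
  cases o with
  | sum i =>
    cases o' with
    | sum j => rw [O.add_injective (funext fun p => funext fun q => h p q)]
    | prod =>
      have := h 1 0
      simp [apply, O.add_zero] at this
  | prod =>
    cases o' with
    | sum j =>
      have := h 1 0
      simp [apply, O.add_zero] at this
    | prod => rfl

open Classical in
theorem diag_update_false {a : V} (ha : a ∈ U) (haW : a ∉ W) (p q : K)
    (x : ∀ a, TwoValued U a) :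
    diag (insert a W) p q (Function.update x a ⟨false, fun _ => ha⟩) =
      if ∀ b ∈ W, (x b).1 = false then p else 0 := by
  have h : ∀ b ∈ W, Function.update x a ⟨false, fun _ => ha⟩ b = x b := fun b hb =>
    Function.update_of_ne (by rintro rfl; exact haW hb) _ _
  have h1 : (∀ b ∈ insert a W, (Function.update x a ⟨false, fun _ => ha⟩ b).1 = false) ↔
      ∀ b ∈ W, (x b).1 = false := by
    simp only [Set.forall_mem_insert, Function.update_self, true_and]
    exact forall₂_congr fun b hb => by rw [h b hb]
  have h2 : ¬ ∀ b ∈ insert a W, (Function.update x a ⟨false, fun _ => ha⟩ b).1 = true := by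
    simp
  rw [diag, if_neg h2, if_congr h1 rfl rfl]

open Classical in
theorem diag_update_true {a : V} (ha : a ∈ U) (haW : a ∉ W) (p q : K)
    (x : ∀ a, TwoValued U a) :
    diag (insert a W) p q (Function.update x a ⟨true, fun _ => ha⟩) =
      if ∀ b ∈ W, (x b).1 = true then q else 0 := by
  have h : ∀ b ∈ W, Function.update x a ⟨true, fun _ => ha⟩ b = x b := fun b hb =>
    Function.update_of_ne (by rintro rfl; exact haW hb) _ _
  have h1 : (∀ b ∈ insert a W, (Function.update x a ⟨true, fun _ => ha⟩ b).1 = true) ↔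
      ∀ b ∈ W, (x b).1 = true := by
    simp only [Set.forall_mem_insert, Function.update_self, true_and]
    exact forall₂_congr fun b hb => by rw [h b hb]
  have h2 : ¬ ∀ b ∈ insert a W, (Function.update x a ⟨true, fun _ => ha⟩ b).1 = false := by
    simp
  rw [diag, if_neg h2, if_congr h1 rfl rfl]

variable {H : Hypergraph V} {F₀ : Set V} {p q : K}

theorem diff_attrs_cons_of_mem {a : V} {o : AggOp ι} {l : AggOrdering V ι} (ha : a ∈ U)
    (hal : a ∉ l.attrs) : U \ l.attrs = insert a (U \ attrs ((a, o) :: l)) := by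
  ext b
  simp only [Set.mem_sdiff, Set.mem_insert_iff, mem_attrs_cons]
  by_cases hb : b = a
  · subst hb; simp [ha, hal]
  · simp [hb]

theorem diff_attrs_cons_of_notMem {a : V} {o : AggOp ι} {l : AggOrdering V ι} (ha : a ∉ U) :
    U \ attrs ((a, o) :: l) = U \ l.attrs := by
  ext b
  simp only [Set.mem_sdiff, mem_attrs_cons]
  by_cases hb : b = a
  · subst hb; simp [ha]
  · simp [hb]

/-- A sum over an attribute of `U` turns the diagonal into the diagonal on the attributes that are
left: as long as one is left, at most one of the two summands is nonzero. -/
theorem ajarQuery_diag (hjoin : ∀ x, joinAnnotation H (diagRel U F₀ p q) x = diag U p q x)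
    (l : AggOrdering V ι) (hl : (l.map Prod.fst).Nodup)
    (hsemi : ∀ a ∈ U, a ∈ l.attrs → a ∈ l.semiringAttrs) (hne : (U \ l.attrs).Nonempty)
    (x : ∀ a, TwoValued U a) :
    ajarQuery O H l (diagRel U F₀ p q) x = diag (U \ l.attrs) p q x := by
  induction l generalizing x with
  | nil =>
    have : U \ attrs ([] : AggOrdering V ι) = U := by
      ext b
      simp [attrs]
    rw [this]
    exact hjoin x
  | cons s l ih =>
    obtain ⟨a, o⟩ := s
    obtain ⟨hal, hl'⟩ := nodup_cons hl
    have hsemi' : ∀ b ∈ U, b ∈ attrs l → b ∈ semiringAttrs l := by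
      intro b hb hbl
      obtain ⟨i, hi⟩ := hsemi b hb (mem_attrs_cons.2 (Or.inr hbl))
      refine ⟨i, (List.mem_cons.1 hi).resolve_left fun h => hal ?_⟩
      cases h
      exact hbl
    change aggregate O (a, o) (ajarQuery O H l (diagRel U F₀ p q)) x = _
    by_cases ha : a ∈ U
    · have hW := diff_attrs_cons_of_mem (o := o) ha hal
      have hq : ajarQuery O H l (diagRel U F₀ p q) = diag (U \ attrs l) p q :=
        funext fun x => ih hl' hsemi' (hW ▸ Set.insert_nonempty _ _) x
      have haW : a ∉ U \ attrs ((a, o) :: l) := fun h => h.2 (mem_attrs_cons.2 (Or.inl rfl))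
      rw [hq, hW, aggregate_of_mem ha, diag_update_false ha haW, diag_update_true ha haW]
      obtain ⟨i, hi⟩ := hsemi a ha (mem_attrs_cons.2 (Or.inl rfl))
      cases op_eq hl hi List.mem_cons_self
      rw [diag, AggOp.apply]
      obtain ⟨c, hc⟩ := hne
      by_cases h1 : ∀ b ∈ U \ attrs ((a, AggOp.sum i) :: l), (x b).1 = false
      · have h2 : ¬ ∀ b ∈ U \ attrs ((a, AggOp.sum i) :: l), (x b).1 = true := fun h => by
          have := h c hc
          rw [h1 c hc] at this
          cases this
        rw [if_pos h1, if_pos h1, if_neg h2, O.add_zero]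
      · rw [if_neg h1, if_neg h1, O.add_comm, O.add_zero]
    · have hW := diff_attrs_cons_of_notMem (o := o) (l := l) ha
      rw [aggregate_of_notMem ha, hW]
      exact ih hl' hsemi' (hW ▸ hne) x

/-- At the innermost product of `U`, two factors with disjoint supports are multiplied, because an
attribute of `U` is still free. The resulting zero survives all outer aggregations. -/
theorem ajarQuery_diag_zero
    (hjoin : ∀ x, joinAnnotation H (diagRel U F₀ p q) x = diag U p q x)
    (l : AggOrdering V ι) (hl : (l.map Prod.fst).Nodup)
    (hprod : ∃ a ∈ U, a ∈ l.productAttrs) (hne : (U \ l.attrs).Nonempty)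
    (x : ∀ a, TwoValued U a) : ajarQuery O H l (diagRel U F₀ p q) x = 0 := by
  induction l generalizing x with
  | nil => obtain ⟨a, -, ha⟩ := hprod; cases ha
  | cons s l ih =>
    obtain ⟨a, o⟩ := s
    obtain ⟨hal, hl'⟩ := nodup_cons hl
    obtain ⟨c, hcU, hcl⟩ := hne
    have hcl' : c ∉ attrs l := fun h => hcl (mem_attrs_cons.2 (Or.inr h))
    change aggregate O (a, o) (ajarQuery O H l (diagRel U F₀ p q)) x = 0
    by_cases hp : ∃ b ∈ U, b ∈ productAttrs l
    · have hq := ih hl' hp ⟨c, hcU, hcl'⟩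
      by_cases ha : a ∈ U
      · rw [aggregate_of_mem ha, hq, hq]
        cases o with
        | sum i => exact O.add_zero i 0
        | prod => exact mul_zero 0
      · rw [aggregate_of_notMem ha, hq]
    · obtain ⟨b, hbU, hb⟩ := hprod
      obtain ⟨rfl, rfl⟩ : b = a ∧ AggOp.prod = o := by
        rcases List.mem_cons.1 hb with h | h
        · exact ⟨congrArg Prod.fst h, congrArg Prod.snd h⟩
        · exact absurd ⟨b, hbU, h⟩ hp
      have hW := diff_attrs_cons_of_mem (o := AggOp.prod) hbU hal
      have hbW : b ∉ U \ attrs ((b, AggOp.prod) :: l) := fun h =>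
        h.2 (mem_attrs_cons.2 (Or.inl rfl))
      have hq : ajarQuery O H l (diagRel U F₀ p q) = diag (U \ attrs l) p q :=
        funext fun x => ajarQuery_diag hjoin l hl' (fun a ha hal => (mem_attrs_cases hal).resolve_right
          fun h => hp ⟨a, ha, h⟩) ⟨c, hcU, hcl'⟩ x
      rw [hq, hW, aggregate_of_mem hbU, diag_update_false hbU hbW, diag_update_true hbU hbW]
      have hcW : c ∈ U \ attrs ((b, AggOp.prod) :: l) := ⟨hcU, hcl⟩
      rw [AggOp.apply]
      by_cases h1 : ∀ b' ∈ U \ attrs ((b, AggOp.prod) :: l), (x b').1 = false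
      · rw [if_neg (c := ∀ b' ∈ _, (x b').1 = true)]
        · exact mul_zero _
        intro h
        have := h c hcW
        rw [h1 c hcW] at this
        cases this
      · rw [if_neg h1]
        exact zero_mul _

theorem ajarQuery_append_of_disjoint (l m : AggOrdering V ι) (hl : ∀ a ∈ l.attrs, a ∉ U)
    (R : ∀ F : Set V, (∀ a : F, TwoValued U a) → K) (x : ∀ a, TwoValued U a) :
    ajarQuery O H (l ++ m) R x = ajarQuery O H m R x := by
  induction l with
  | nil => rfl
  | cons s l ih =>
    obtain ⟨a, o⟩ := s
    change aggregate O (a, o) (ajarQuery O H (l ++ m) R) x = _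
    rw [aggregate_of_notMem (hl a (mem_attrs_cons.2 (Or.inl rfl)))]
    exact ih fun b hb => hl b (mem_attrs_cons.2 (Or.inr hb))

variable {α β : AggOrdering V ι}

theorem exists_split_first (hα : (α.map Prod.fst).Nodup) {a : V} (ha : α.IsFirst U a)
    (hU : U ⊆ α.attrs) : ∃ l m o, α = l ++ (a, o) :: m ∧ (∀ b ∈ attrs l, b ∉ U) ∧
      U \ attrs m = {a} := by
  obtain ⟨o, hao⟩ := ha.2.1
  obtain ⟨l, m, rfl⟩ := exists_split hao
  have hlt : ∀ b ∈ U, b ≠ a → b ∈ attrs m := fun b hb hne =>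
    (precedes_of_split hα rfl).1 (ha.2.2 b hb (hU hb) hne)
  have ham : a ∉ attrs m := fun h => ((precedes_of_split hα rfl).2 h).ne hα rfl
  refine ⟨l, m, o, rfl, fun b hb hbU => ?_, ?_⟩
  · have hd : ∀ b ∈ attrs l, b ∉ attrs ((a, o) :: m) := by
      intro b hb hb'
      rw [mem_attrs_iff] at hb hb'
      rw [List.map_append] at hα
      exact (List.disjoint_of_nodup_append hα) hb hb'
    by_cases hba : b = a
    · exact hd b hb (mem_attrs_cons.2 (Or.inl hba))
    · exact hd b hb (mem_attrs_cons.2 (Or.inr (hlt b hbU hba)))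
  · ext b
    constructor
    · rintro ⟨hb, hbm⟩
      by_contra hne
      exact hbm (hlt b hb hne)
    · rintro rfl
      exact ⟨ha.1, ham⟩

/-- When the first attribute `a` of `U` is reached, the inner sums have left the diagonal on `{a}`.
The aggregations further out concern one-element domains and change nothing. -/
theorem ajarQuery_first (hjoin : ∀ x, joinAnnotation H (diagRel U F₀ p q) x = diag U p q x)
    (hα : (α.map Prod.fst).Nodup) {a : V} (ha : α.IsFirst U a) (hU : U ⊆ α.attrs)
    (hsemi : ∀ b ∈ U, b ≠ a → b ∈ α.semiringAttrs) {o : AggOp ι} (hao : (a, o) ∈ α)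
    (x : ∀ a, TwoValued U a) : ajarQuery O H α (diagRel U F₀ p q) x = o.apply O p q := by
  obtain ⟨l, m, o', hs, hl, hm⟩ := exists_split_first hα ha hU
  obtain rfl : o = o' := op_eq hα hao (by simp [hs])
  have hmnd : (m.map Prod.fst).Nodup := nodup_sublist (by
    rw [hs]; exact (List.sublist_cons_self _ _).trans (List.sublist_append_right _ _)) hα
  have ham : a ∉ attrs m := (hm ▸ rfl : a ∈ U \ attrs m).2
  have hq : ajarQuery O H m (diagRel U F₀ p q) = diag {a} p q := by
    funext x
    rw [← hm]
    refine ajarQuery_diag hjoin m hmnd (fun b hb hbm => ?_) (hm ▸ Set.singleton_nonempty a) x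
    obtain ⟨i, hi⟩ := hsemi b hb (by rintro rfl; exact ham hbm)
    obtain ⟨o', ho'⟩ := hbm
    obtain rfl := op_eq hα hi (o' := o') (by simp [hs, ho'])
    exact ⟨i, ho'⟩
  rw [hs, ajarQuery_append_of_disjoint _ _ hl]
  change aggregate O (a, o) (ajarQuery O H m (diagRel U F₀ p q)) x = _
  rw [hq, aggregate_of_mem ha.1]
  congr 1 <;> simp [diag]

theorem ajarQuery_first_zero (hjoin : ∀ x, joinAnnotation H (diagRel U F₀ p q) x = diag U p q x)
    (hα : (α.map Prod.fst).Nodup) {a b : V} (ha : α.IsFirst U a) (hU : U ⊆ α.attrs)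
    (hb : b ∈ U) (hb' : b ∈ α.productAttrs) (hab : b ≠ a)
    (x : ∀ a, TwoValued U a) : ajarQuery O H α (diagRel U F₀ p q) x = 0 := by
  obtain ⟨l, m, o, hs, hl, hm⟩ := exists_split_first hα ha hU
  have hmnd : (m.map Prod.fst).Nodup := nodup_sublist (by
    rw [hs]; exact (List.sublist_cons_self _ _).trans (List.sublist_append_right _ _)) hα
  have hbm : b ∈ productAttrs m := by
    have hbm : b ∈ attrs m := by
      by_contra h
      have : b ∈ U \ attrs m := ⟨hb, h⟩
      rw [hm] at this
      exact hab this
    obtain ⟨o', ho'⟩ := hbm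
    obtain rfl := op_eq hα hb' (o' := o') (by simp [hs, ho'])
    exact ho'
  have hq := ajarQuery_diag_zero (O := O) hjoin m hmnd ⟨b, hb, hbm⟩ (hm ▸ Set.singleton_nonempty a)
  rw [hs, ajarQuery_append_of_disjoint _ _ hl]
  change aggregate O (a, o) (ajarQuery O H m (diagRel U F₀ p q)) x = _
  rw [aggregate_of_mem ha.1, hq, hq]
  cases o with
  | sum i => exact O.add_zero i 0
  | prod => exact mul_zero 0

theorem exists_edge_join (hH : IsAdmissible H α) (hU : IsConnectedSet H.Adj U) (hUα : U ⊆ α.attrs) :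
    ∃ F₀, ∀ (p q : K) (x : ∀ a, TwoValued U a),
      joinAnnotation H (diagRel U F₀ p q) x = diag U p q x := by
  obtain ⟨a, ha⟩ := hU.1
  obtain ⟨F₀, hF₀, haF₀⟩ := hH.cover a (hH.attrs_subset (hUα ha))
  exact ⟨F₀, fun p q x => joinAnnotation_diagRel hH.finite hU hF₀ ⟨a, haF₀, ha⟩ p q x⟩

variable [Nontrivial K]

theorem OrderEquiv.op_eq_of_first (h : OrderEquiv O H α β) (hH : IsAdmissible H α)
    (hβ : (β.map Prod.fst).Nodup) (hU : IsConnectedSet H.Adj U) (hUα : U ⊆ α.attrs) {a b : V}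
    (ha : α.IsFirst U a) (hb : β.IsFirst U b) (hsα : ∀ c ∈ U, c ≠ a → c ∈ α.semiringAttrs)
    (hsβ : ∀ c ∈ U, c ≠ b → c ∈ β.semiringAttrs) {o o' : AggOp ι} (hao : (a, o) ∈ α)
    (hbo : (b, o') ∈ β) : o = o' := by
  obtain ⟨F₀, hF₀⟩ := exists_edge_join (K := K) hH hU hUα
  refine AggOp.apply_injective (O := O) fun p q => ?_
  have x : ∀ a, TwoValued U a := fun a => Classical.arbitrary _
  rw [← ajarQuery_first (hF₀ p q) hH.nodup ha hUα hsα hao x,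
    ← ajarQuery_first (hF₀ p q) hβ hb (h.1 ▸ hUα) hsβ hbo x]
  exact congrFun (h.2 (TwoValued U) _) x

/-- The case of the one-element connected set `{a}`: equivalent orderings use the same operator for
each attribute. -/
theorem OrderEquiv.mem (h : OrderEquiv O H α β) (hH : IsAdmissible H α)
    (hβ : (β.map Prod.fst).Nodup) {a : V} {o : AggOp ι} (ha : (a, o) ∈ α) : (a, o) ∈ β := by
  have haα : a ∈ α.attrs := ⟨o, ha⟩
  obtain ⟨o', ho'⟩ : a ∈ β.attrs := h.1 ▸ haα
  have hne : ∀ c ∈ ({a} : Set V), c ≠ a → False := fun c hc hn => hn hc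
  have := h.op_eq_of_first hH hβ (isConnectedSet_singleton a) (Set.singleton_subset_iff.2 haα)
    (a := a) (b := a) ⟨rfl, haα, fun c hc _ hn => (hne c hc hn).elim⟩
    ⟨rfl, ⟨o', ho'⟩, fun c hc _ hn => (hne c hc hn).elim⟩ (fun c hc hn => (hne c hc hn).elim)
    (fun c hc hn => (hne c hc hn).elim) ha ho'
  rwa [this]

theorem OrderEquiv.semiring_mem (h : OrderEquiv O H α β) (hH : IsAdmissible H α)
    (hβ : (β.map Prod.fst).Nodup) {a : V} (ha : a ∈ α.semiringAttrs) : a ∈ β.semiringAttrs := by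
  obtain ⟨i, hi⟩ := ha
  exact ⟨i, h.mem hH hβ hi⟩

theorem OrderEquiv.sameOp_of_first (h : OrderEquiv O H α β) (hH : IsAdmissible H α)
    (hβ : (β.map Prod.fst).Nodup) (hU : IsConnectedSet H.Adj U) (hUα : U ⊆ α.semiringAttrs)
    {a b : V} (ha : α.IsFirst U a) (hb : β.IsFirst U b) : α.SameOp a b := by
  obtain ⟨o, hao⟩ := ha.2.1
  obtain ⟨o', hbo⟩ := semiringAttrs_subset (hUα hb.1)
  have := h.op_eq_of_first hH hβ hU (hUα.trans semiringAttrs_subset) ha hb (fun c hc _ => hUα hc)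
    (fun c hc _ => h.semiring_mem hH hβ (hUα hc)) hao (h.mem hH hβ hbo)
  exact ⟨o, hao, this ▸ hbo⟩

/-- With `p = q = 1` the diagonal instance gives `1` if `b` is the first attribute of `U`, and `0`
if the product lies further inside. -/
theorem OrderEquiv.isFirst_product_iff (h : OrderEquiv O H α β) (hH : IsAdmissible H α)
    (hβ : (β.map Prod.fst).Nodup) (hU : IsConnectedSet H.Adj U) {b : V} (hb : b ∈ U)
    (hbp : b ∈ α.productAttrs) (hs : ∀ c ∈ U, c ≠ b → c ∈ α.semiringAttrs) :
    α.IsFirst U b ↔ β.IsFirst U b := by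
  have hUα : U ⊆ α.attrs := fun c hc => by
    by_cases hcb : c = b
    · exact hcb ▸ productAttrs_subset hbp
    · exact semiringAttrs_subset (hs c hc hcb)
  have hUβ : U ⊆ β.attrs := h.1 ▸ hUα
  have hbp' : (b, AggOp.prod) ∈ β := h.mem hH hβ hbp
  obtain ⟨F₀, hF₀⟩ := exists_edge_join (K := K) hH hU hUα
  have x : ∀ a, TwoValued U a := fun a => Classical.arbitrary _
  have heq : ajarQuery O H α (diagRel U F₀ 1 1) x = ajarQuery O H β (diagRel U F₀ 1 1) x :=
    congrFun (h.2 (TwoValued U) _) x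
  obtain ⟨a, ha⟩ := exists_isFirst (α := α) ⟨b, hb, hUα hb⟩
  obtain ⟨c, hc⟩ := exists_isFirst (α := β) ⟨b, hb, hUβ hb⟩
  have h1 : ∀ {γ : AggOrdering V ι}, (γ.map Prod.fst).Nodup → U ⊆ γ.attrs → γ.IsFirst U b →
      (b, AggOp.prod) ∈ γ → (∀ c ∈ U, c ≠ b → c ∈ γ.semiringAttrs) →
      ajarQuery O H γ (diagRel U F₀ 1 1) x = 1 := by
    intro γ hγ hUγ hf hbγ hsγ
    rw [ajarQuery_first (hF₀ 1 1) hγ hf hUγ hsγ hbγ x]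
    exact mul_one 1
  constructor
  · intro hf
    by_cases hbc : b = c
    · rwa [hbc]
    · rw [h1 hH.nodup hUα hf hbp hs, ajarQuery_first_zero (hF₀ 1 1) hβ hc hUβ hb hbp' hbc] at heq
      exact absurd heq one_ne_zero
  · intro hf
    by_cases hba : b = a
    · rwa [hba]
    · rw [h1 hβ hUβ hf hbp' fun c hc hn => h.semiring_mem hH hβ (hs c hc hn),
        ajarQuery_first_zero (hF₀ 1 1) hH.nodup ha hUα hb hbp hba] at heq
      exact absurd heq zero_ne_one

end Diagonal

/-! ### Partitioning decomposable AGHDs -/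

section Partition

variable {V N ι : Type*} {G : CopyTree V N} {H H' : Hypergraph V} {α : AggOrdering V ι}
  {S T₀ : Set N} {r : N} {a b : V} {C : Set V}

theorem CopyTree.ancestorOrEq_of_walk (hS : IsConnectedSet G.tree.Adj S)
    (hr : ∃ p : G.tree.Walk G.root r, ∀ x ∈ p.support, x ∈ S → x = r) (hrS : r ∈ S) {t : N}
    (ht : t ∈ S) : G.AncestorOrEq r t := by
  obtain ⟨w, hw, hwt⟩ := CopyTree.exists_top hS
  obtain ⟨p, hp⟩ := hr
  rw [← hp w (hwt r hrS p) hw]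
  exact hwt t ht

theorem SameInner.isQueryComponent_iff (hs : SameInner α H H') (hH : IsAdmissible H α) :
    IsQueryComponent H' α C ↔ IsQueryComponent H α C := by
  refine ⟨fun hC => ?_, hs.isQueryComponent hH⟩
  rw [hH.isQueryComponent_iff']
  rw [IsQueryComponent, ← hs.outputAttrs_eq, ← hs.1, hH.queryBase_eq,
    isComponentOf_iff H'.adj_symm'] at hC
  exact ⟨hC.1.mono_rel fun x hx y _ hxy => hs.symm.adj (semiringAttrs_subset (hC.2.1 hx)) hxy,
    hC.2.1, fun x hx y hy hxy => hC.2.2 x hx y hy (hs.adj (semiringAttrs_subset (hC.2.1 hx)) hxy)⟩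

theorem SameInner.isCharPosition_cons (hs : SameInner α H H') (hH : IsAdmissible H α)
    (hC : IsQueryComponent H α C) {l : List (Set V)} : IsCharPosition H' α (C :: l) ↔
      IsCharPosition (componentHypergraph H α C) (componentOrdering H α C) l := by
  have hCa := hH.component_subset_attrs hC
  rw [IsCharPosition, hs.isQueryComponent_iff hH, ← hs.componentHypergraph_eq hCa,
    ← hs.componentOrdering_eq hH.nodup hCa, and_iff_right hC]

variable {sub : ∀ C, IsQueryComponent H α C → Set N} {rt : ∀ C, IsQueryComponent H α C → N}

namespace IsSplitting

variable (h : IsSplitting G H α S r T₀ sub rt)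
  (hr : ∃ p : G.tree.Walk G.root r, ∀ x ∈ p.support, x ∈ S → x = r)

include h hr

theorem root_ancestorOrEq {t : N} (ht : t ∈ S) : G.AncestorOrEq r t :=
  CopyTree.ancestorOrEq_of_walk h.aghd.2.subtree hr (h.T₀_subset h.root_mem) ht

theorem not_rt_ancestorOrEq (hC : IsQueryComponent H α C) {t : N} (ht : t ∈ T₀) :
    ¬ G.AncestorOrEq (rt C hC) t := by
  intro hanc
  obtain ⟨p, hp⟩ := h.exists_walk_root hr ht
  have hrt := h.sub_subset hC (h.sub_root C hC).1
  exact hrt.2 (hp _ (hanc p) hrt.1)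

/-- The nodes of `S` below `rt C hC` are connected and avoid `T₀`, so they all lie in the component
of `rt C hC`. -/
theorem mem_sub_iff (hC : IsQueryComponent H α C) {t : N} :
    t ∈ sub C hC ↔ t ∈ S ∧ G.AncestorOrEq (rt C hC) t := by
  constructor
  · intro ht
    exact ⟨(h.sub_subset hC ht).1, CopyTree.ancestorOrEq_of_walk (h.sub_connected hC)
      (h.exists_walk_rt' hr hC) (h.sub_root C hC).1 ht⟩
  · intro ht
    have hrt := (h.sub_root C hC).1
    have hrtS := (h.sub_subset hC hrt).1
    have hcon := h.aghd.2.subtree.inter G.isTree (G.isConnectedSet_descendants (rt C hC))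
      ⟨rt C hC, hrtS, G.ancestorOrEq_refl _⟩
    exact (h.sub_component C hC).subset_of_connected (fun _ _ h => h.symm) hcon
      (fun x hx => ⟨hx.1, fun hx0 => h.not_rt_ancestorOrEq hr hC hx0 hx.2⟩)
      ⟨rt C hC, ⟨hrtS, G.ancestorOrEq_refl _⟩, hrt⟩ ht

/-- The nodes outside the subtrees of the components form a subtree. -/
theorem rest_connected :
    IsConnectedSet G.tree.Adj {t | t ∈ S ∧ ∀ C hC, t ∉ sub C hC} := by
  classical
  have hT : ∀ t ∈ T₀, t ∈ {t | t ∈ S ∧ ∀ C hC, t ∉ sub C hC} := fun t ht =>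
    ⟨h.T₀_subset ht, fun C hC h' => (h.sub_subset hC h').2 ht⟩
  refine .of_center (a := r) (fun _ _ h => h.symm) (fun t ht => ?_) (hT r h.root_mem)
  obtain ⟨p, hp⟩ := G.isTree.exists_isPath G.root t
  have hrt := h.root_ancestorOrEq hr ht.1
  refine connectedIn_iff_exists_walk.2 ⟨p.dropUntil r (hrt p), fun x hx => ?_⟩
  have hrx := CopyTree.ancestorOrEq_of_mem_dropUntil hp (hrt p) hx
  have hxt := CopyTree.ancestorOrEq_of_isPath hp (p.support_dropUntil_subset_support _ hx)
  refine ⟨hrx.mem_of_between hxt h.aghd.2.subtree (h.T₀_subset h.root_mem) ht.1,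
    fun C hC hxC => ht.2 C hC ?_⟩
  exact (h.mem_sub_iff hr hC).2 ⟨ht.1, ((h.mem_sub_iff hr hC).1 hxC).2.trans hxt⟩

/-- An interface attribute is an output attribute, so its single copy occurs in `T₀` and in the
subtree of `C`. By running intersection it occurs at both ends of the tree edge between them. -/
theorem interface_subset (hH : IsAdmissible H α) (hC : IsQueryComponent H α C) :
    interfaceEdge H α C ⊆ G.base.bag (rt C hC) ∧
      ∃ g ∈ T₀, interfaceEdge H α C ⊆ G.base.bag g := by
  obtain ⟨hrt, g, hg, hadj⟩ := h.sub_root C hC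
  have key : ∀ a ∈ interfaceEdge H α C, a ∈ G.base.bag (rt C hC) ∧ a ∈ G.base.bag g := by
    rintro a ⟨hao, ha⟩
    obtain ⟨F, hF, hFC, haF⟩ := mem_edgesMeeting_vertexSet.1 ha
    have hZ := h.aghd.connected hF haF
    obtain ⟨u, hu, hFu⟩ := (h.sub_aghd C hC).exists_node (F := F) ⟨hF, hFC⟩
    have huS := (h.sub_subset hC hu).1
    obtain ⟨t, ht, hat⟩ := h.exists_mem_T₀ hao
    obtain ⟨k, hk⟩ := CopyTree.mem_base_bag.1 hat
    obtain rfl := h.aghd.copy_eq ((hH.mem_outputAttrs_iff hao.1).1 hao).2 (h.T₀_subset ht) huS hk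
      (hFu a haF)
    obtain ⟨z, hz, hztop⟩ := CopyTree.exists_top hZ
    have hzt := hztop t ⟨h.T₀_subset ht, hk⟩
    have hzu := hztop u ⟨huS, hFu a haF⟩
    have hrtu := ((h.mem_sub_iff hr hC).1 hu).2
    have hnt : ¬ G.AncestorOrEq (rt C hC) z := fun h' =>
      h.not_rt_ancestorOrEq hr hC ht (h'.trans hzt)
    have hzrt := (hzu.total hrtu).resolve_right hnt
    have hrtZ := hzrt.mem_of_between hrtu hZ hz ⟨huS, hFu a haF⟩
    have hgrt := (CopyTree.ancestorOrEq_or_of_adj hadj).resolve_right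
      (h.not_rt_ancestorOrEq hr hC hg)
    refine ⟨CopyTree.mem_base_bag.2 ⟨_, hrtZ.2⟩, CopyTree.mem_base_bag.2
      ⟨G.label a F, And.right (?_ : g ∈ {t | t ∈ S ∧ (a, G.label a F) ∈ G.bag t})⟩⟩
    rcases hzrt.total hgrt with hzg | hgz
    · exact hzg.mem_of_between hgrt hZ hz hrtZ
    · have hpair : IsConnectedSet G.tree.Adj {g, rt C hC} :=
        (isConnectedSet_singleton (rt C hC)).insert (fun _ _ h => h.symm) rfl hadj.symm
      rcases hgz.mem_of_between hzrt hpair (Or.inl rfl) (Or.inr rfl) with rfl | hzr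
      · exact hz
      · rw [Set.mem_singleton_iff] at hzr
        exact absurd (hzr ▸ G.ancestorOrEq_refl _) hnt
  exact ⟨fun a ha => (key a ha).1, g, hg, fun a ha => (key a ha).2⟩

/-- Subtrees outside `T₀` that belong to no component contain output attributes only and are counted
here. The hypothesis `hcov` concerns the extra edges of `H'`, about which the AGHD of the query of
`H` says nothing. -/
theorem isGHDOn_rest (hH : IsAdmissible H α) (hs : SameInner α H H')
    (hcov : ∀ F ∈ H'.edgeSet, F ⊆ outputAttrs H α → ∃ t ∈ S, F ⊆ G.base.bag t) :
    IsGHDOn (outputHypergraph H' α) G.base {t | t ∈ S ∧ ∀ C hC, t ∉ sub C hC} where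
  subtree := h.rest_connected hr
  bag_subset t ht a ha := by
    change a ∈ outputAttrs H' α
    rw [← hs.outputAttrs_eq]
    refine ⟨h.aghd.mem_vertexSet ht.1 ha, fun haα => ?_⟩
    obtain ⟨i, hi⟩ := CopyTree.mem_base_bag.1 ha
    obtain ⟨C, hC, -, hsub⟩ := h.exists_component hH haα ht.1 hi
    exact ht.2 C hC (hsub t ht.1 hi)
  cover F hF := by
    have hT : ∀ t ∈ T₀, t ∈ {t | t ∈ S ∧ ∀ C hC, t ∉ sub C hC} := fun t ht =>
      ⟨h.T₀_subset ht, fun C hC h' => (h.sub_subset hC h').2 ht⟩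
    rcases hF with ⟨hF, hFo⟩ | ⟨C, hC, rfl⟩
    · rw [← hs.outputAttrs_eq] at hFo
      obtain ⟨t, ht, hFt⟩ := hcov F hF hFo
      by_cases hn : ∀ C hC, t ∉ sub C hC
      · exact ⟨t, ⟨ht, hn⟩, hFt⟩
      -- If the covering node lies in the subtree of `C`, then `F` is contained in the interface
      -- edge of `C`, which is also covered in `T₀`.
      · push Not at hn
        obtain ⟨C, hC, htC⟩ := hn
        obtain ⟨-, g, hg, hsub⟩ := h.interface_subset hr hH hC
        exact ⟨g, hT g hg, fun a ha => hsub ⟨hFo ha, (h.sub_aghd C hC).mem_vertexSet htC (hFt ha)⟩⟩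
    · have hC' := (hs.isQueryComponent_iff hH).1 hC
      obtain ⟨-, g, hg, hsub⟩ := h.interface_subset hr hH hC'
      exact ⟨g, hT g hg, by rwa [← hs.interfaceEdge_eq (hH.component_subset_attrs hC')]⟩
  running a ha := by
    change a ∈ outputAttrs H' α at ha
    rw [← hs.outputAttrs_eq] at ha
    obtain ⟨t, ht, hat⟩ := h.exists_mem_T₀ ha
    obtain ⟨k, hk⟩ := CopyTree.mem_base_bag.1 hat
    have hap := ((hH.mem_outputAttrs_iff ha.1).1 ha).2
    have heq : {t | t ∈ {t | t ∈ S ∧ ∀ C hC, t ∉ sub C hC} ∧ a ∈ G.base.bag t} =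
        {t | t ∈ S ∧ ∀ C hC, t ∉ sub C hC} ∩ {t | t ∈ S ∧ (a, k) ∈ G.bag t} := by
      ext x
      refine and_congr_right fun hx => ?_
      rw [CopyTree.mem_base_bag]
      constructor
      · rintro ⟨j, hj⟩
        obtain rfl := h.aghd.copy_eq hap hx.1 (h.T₀_subset ht) hj hk
        exact ⟨hx.1, hj⟩
      · exact fun hx' => ⟨k, hx'.2⟩
    rw [heq]
    refine (h.rest_connected hr).inter G.isTree
      (h.aghd.2.running _ (h.aghd.2.bag_subset t (h.T₀_subset ht) hk)) ⟨t, ?_, h.T₀_subset ht, hk⟩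
    exact ⟨h.T₀_subset ht, fun C hC h' => (h.sub_subset hC h').2 ht⟩

end IsSplitting

/-- `H` is the hypergraph of the subquery, while `H'` also has the interface edges added at earlier
steps. At the next step the new interface edge is covered by the bag at the root of the subtree. -/
theorem IsDecomposableOn.exists_partition (h : IsDecomposableOn G H α S r)
    (hH : IsAdmissible H α) (hr : ∃ p : G.tree.Walk G.root r, ∀ x ∈ p.support, x ∈ S → x = r)
    (hs : SameInner α H H')
    (hcov : ∀ F ∈ H'.edgeSet, F ⊆ outputAttrs H α → ∃ t ∈ S, F ⊆ G.base.bag t) :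
    ∃ part : N → List (Set V), (∀ t ∈ S, IsCharPosition H' α (part t)) ∧
      ∀ l, IsCharPosition H' α l →
        IsGHDOn (charHypergraph H' α l) G.base {t | t ∈ S ∧ part t = l} := by
  classical
  induction h generalizing H' with
  | intro H α S r T₀ h0 h1 h2 h3 h4 sub rt h5 h6 h7 h8 ih =>
    have hsp : IsSplitting G H α S r T₀ sub rt :=
      ⟨h0, h1, h2, h3, h4, h5, h6, fun C hC => (h8 C hC).aghd⟩
    have key : ∀ C hC, ∃ part : N → List (Set V),
        (∀ t ∈ sub C hC, IsCharPosition (componentHypergraph H α C) (componentOrdering H α C)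
          (part t)) ∧
        ∀ l, IsCharPosition (componentHypergraph H α C) (componentOrdering H α C) l →
          IsGHDOn (charHypergraph (componentHypergraph H α C) (componentOrdering H α C) l) G.base
            {t | t ∈ sub C hC ∧ part t = l} := by
      intro C hC
      refine ih C hC (hH.meeting hC) (hsp.exists_walk_rt' hr hC) (hH.sameInner_component hC) ?_
      rintro F (hF | rfl) -
      · obtain ⟨u, hu, hFu⟩ := (h8 C hC).aghd.exists_node hF
        exact ⟨u, hu, fun a ha => CopyTree.mem_base_bag.2 ⟨_, hFu a ha⟩⟩
      · exact ⟨_, (h6 C hC).1, (hsp.interface_subset hr hH hC).1⟩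
    choose part hpart1 hpart2 using key
    let part' : N → List (Set V) := fun t =>
      if ht : ∃ C, ∃ hC : IsQueryComponent H α C, t ∈ sub C hC then
        ht.choose :: part ht.choose ht.choose_spec.choose t else []
    have hp1 : ∀ C hC t, t ∈ sub C hC → part' t = C :: part C hC t := by
      intro C hC t ht
      have ht' : ∃ C, ∃ hC : IsQueryComponent H α C, t ∈ sub C hC := ⟨C, hC, ht⟩
      have hCe : ht'.choose = C :=
        hsp.component_eq hH ht'.choose_spec.choose hC ht'.choose_spec.choose_spec ht
      simp only [part', dif_pos ht']
      congr
    have hp2 : ∀ t, (∀ C hC, t ∉ sub C hC) → part' t = [] := by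
      intro t ht
      exact dif_neg fun ⟨C, hC, h'⟩ => ht C hC h'
    refine ⟨part', fun t ht => ?_, fun l hl => ?_⟩
    · by_cases hn : ∀ C hC, t ∉ sub C hC
      · rw [hp2 t hn]
        trivial
      · push Not at hn
        obtain ⟨C, hC, htC⟩ := hn
        rw [hp1 C hC t htC, hs.isCharPosition_cons hH hC]
        exact hpart1 C hC t htC
    · rcases l with _ | ⟨C, l⟩
      · have : {t | t ∈ S ∧ part' t = []} = {t | t ∈ S ∧ ∀ C hC, t ∉ sub C hC} := by
          ext t
          refine and_congr_right fun _ => ⟨fun h' C hC htC => ?_, hp2 t⟩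
          rw [hp1 C hC t htC] at h'
          cases h'
        rw [this]
        exact hsp.isGHDOn_rest hr hH hs hcov
      · have hC : IsQueryComponent H α C := (hs.isQueryComponent_iff hH).1 hl.1
        have hCa := hH.component_subset_attrs hC
        have : {t | t ∈ S ∧ part' t = C :: l} = {t | t ∈ sub C hC ∧ part C hC t = l} := by
          ext t
          constructor
          · rintro ⟨_, ht⟩
            by_cases hn : ∀ C hC, t ∉ sub C hC
            · rw [hp2 t hn] at ht
              cases ht
            · push Not at hn
              obtain ⟨C', hC', htC'⟩ := hn
              rw [hp1 C' hC' t htC'] at ht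
              obtain ⟨rfl, rfl⟩ := List.cons.inj ht
              exact ⟨htC', rfl⟩
          · rintro ⟨ht, rfl⟩
            exact ⟨(hsp.sub_subset hC ht).1, hp1 C hC t ht⟩
        rw [this, charHypergraph, ← hs.componentHypergraph_eq hCa,
          ← hs.componentOrdering_eq hH.nodup hCa]
        exact hpart2 C hC l ((hs.isCharPosition_cons hH hC).1 hl)

theorem CopyTree.IsDecomposable.exists_partition [Finite N] (hH : IsAdmissible H α)
    (h : G.IsDecomposable H α) : ∃ part : N → CharIndex H α,
      (∀ i, IsGHDOn (charHypergraph H α i.1) G.base (part ⁻¹' {i})) ∧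
      ∀ γ : Set V → ℝ, G.base.width γ = ⨆ i, G.base.widthOn γ (part ⁻¹' {i}) := by
  obtain ⟨part, h1, h2⟩ := IsDecomposableOn.exists_partition (H' := H) h hH
    ⟨.nil, by simp⟩ (.refl α H) fun F hF _ => by
      obtain ⟨u, hu, hFu⟩ := (IsDecomposableOn.aghd h).exists_node hF
      exact ⟨u, hu, fun a ha => CopyTree.mem_base_bag.2 ⟨_, hFu a ha⟩⟩
  let part' : N → CharIndex H α := fun t => ⟨part t, h1 t trivial⟩
  have hset : ∀ i : CharIndex H α, part' ⁻¹' {i} = {t | t ∈ Set.univ ∧ part t = i.1} := by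
    intro i
    ext t
    simp [part', Subtype.ext_iff]
  have hghd : ∀ i, IsGHDOn (charHypergraph H α i.1) G.base (part' ⁻¹' {i}) := fun i => by
    rw [hset i]
    exact h2 i.1 i.2
  refine ⟨part', hghd, fun γ => ?_⟩
  have hne : ∀ i, Nonempty (part' ⁻¹' {i} : Set N) := fun i => (hghd i).subtree.1.to_subtype
  have : Finite (CharIndex H α) := hH.finite_charPositions
  have : Nonempty (CharIndex H α) := ⟨part' G.root⟩
  have : Nonempty (Set.univ : Set N) := ⟨⟨G.root, trivial⟩⟩
  have hbdd : ∀ S : Set N, BddAbove (Set.range fun t : S => γ (G.base.bag t)) := fun S =>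
    (Set.finite_range _).bddAbove
  refine le_antisymm (ciSup_le fun t => ?_) (ciSup_le fun i => ciSup_le fun t => ?_)
  · exact (le_ciSup (hbdd (part' ⁻¹' {part' t})) ⟨t.1, rfl⟩).trans
      (le_ciSup (f := fun i => G.base.widthOn γ (part' ⁻¹' {i})) (Set.finite_range _).bddAbove
        (part' t))
  · exact le_ciSup (hbdd Set.univ) ⟨t.1, trivial⟩

end Partition

/-! ### Gluing trees -/

section Glue

/-- Trees `tree i` on `M i`, where every index `i` other than the root is attached to its parent:
the node `down i` of the tree of `i` is joined to the node `up i` of the tree of `par i`. -/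
structure TreeSystem (I : Type*) (M : I → Type*) where
  tree : ∀ i, SimpleGraph (M i)
  isTree : ∀ i, (tree i).IsTree
  rank : I → ℕ
  par : I → I
  rank_lt : ∀ i, par i ≠ i → rank (par i) < rank i
  root : I
  eq_root : ∀ i, par i = i → i = root
  up : ∀ i, M (par i)
  down : ∀ i, M i

namespace TreeSystem

variable {I : Type*} {M : I → Type*} (A : TreeSystem I M)

/-- Adjacency in the glued tree. -/
inductive Adj : (Σ i, M i) → (Σ i, M i) → Prop
  | inner {i : I} {s t : M i} (h : (A.tree i).Adj s t) : Adj ⟨i, s⟩ ⟨i, t⟩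
  | toDown (i : I) (h : A.par i ≠ i) : Adj ⟨A.par i, A.up i⟩ ⟨i, A.down i⟩
  | toUp (i : I) (h : A.par i ≠ i) : Adj ⟨i, A.down i⟩ ⟨A.par i, A.up i⟩

variable {A}

theorem Adj.inner' {x y : Σ i, M i} (h : A.Adj x y) (hxy : x.1 = y.1) :
    (A.tree y.1).Adj (hxy ▸ x.2) y.2 := by
  cases h with
  | inner h => exact h
  | toDown i h => exact absurd hxy h
  | toUp i h => exact absurd hxy.symm h

theorem adj_inner_iff {i : I} {s t : M i} : A.Adj ⟨i, s⟩ ⟨i, t⟩ ↔ (A.tree i).Adj s t :=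
  ⟨fun h => h.inner' rfl, .inner⟩

theorem Adj.symm {x y : Σ i, M i} (h : A.Adj x y) : A.Adj y x := by
  cases h with
  | inner h => exact .inner h.symm
  | toDown i h => exact .toUp i h
  | toUp i h => exact .toDown i h

variable (A)

/-- The glued graph. -/
def glue : SimpleGraph (Σ i, M i) where
  Adj := A.Adj
  symm := ⟨fun _ _ h => h.symm⟩
  loopless := ⟨fun ⟨_, _⟩ h => (A.tree _).loopless.irrefl _ (h.inner' rfl)⟩

theorem glue_connected : A.glue.Connected := by
  have hin : ∀ i (s t : M i), A.glue.Reachable ⟨i, s⟩ ⟨i, t⟩ := fun i s t =>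
    ((A.isTree i).connected s t).map
      (⟨fun s => ⟨i, s⟩, fun h => Adj.inner h⟩ : A.tree i →g A.glue)
  have key : ∀ n i, A.rank i = n → ∀ s : M i, A.glue.Reachable ⟨i, s⟩ ⟨A.root, A.down A.root⟩ := by
    intro n
    induction n using Nat.strong_induction_on with
    | _ n ih =>
      intro i hi s
      by_cases hp : A.par i = i
      · obtain rfl := A.eq_root i hp
        exact hin _ _ _
      · exact (hin i s (A.down i)).trans ((SimpleGraph.Adj.reachable (G := A.glue)
          (Adj.toUp i hp)).trans (ih _ (hi ▸ A.rank_lt i hp) _ rfl _))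
  exact SimpleGraph.connected_iff_exists_forall_reachable _ |>.2
    ⟨⟨A.root, A.down A.root⟩, fun x => (key _ x.1 rfl x.2).symm⟩

open Classical in
/-- The retraction of the glued tree onto the tree of `i`. -/
noncomputable def retract (i k : I) (x : M k) : M i :=
  if h : k = i then h ▸ x
  -- An index below `i` is pushed up until the tree of `i` is reached. Any other index ends here, at
  -- the node by which the tree of `i` hangs on its parent.
  else if _h' : A.par k = k ∨ A.rank k ≤ A.rank i then A.down i
  else retract i (A.par k) (A.up k)
termination_by A.rank k
decreasing_by exact A.rank_lt k fun h'' => _h' (Or.inl h'')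

theorem retract_self (i : I) (x : M i) : A.retract i i x = x := by
  rw [retract]
  simp

theorem retract_of_le {i k : I} (h : k ≠ i) (h' : A.rank k ≤ A.rank i) (x : M k) :
    A.retract i k x = A.down i := by
  rw [retract, dif_neg h, dif_pos (Or.inr h')]

theorem retract_const {i k : I} (h : k ≠ i) (x y : M k) : A.retract i k x = A.retract i k y := by
  rw [retract, dif_neg h]
  conv_rhs => rw [retract, dif_neg h]

/-- Linking edges are contracted, and by `retract_const` so is every tree other than that of `i`. -/
theorem retract_link {i k : I} (h : A.par k ≠ k) :
    A.retract i (A.par k) (A.up k) = A.retract i k (A.down k) := by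
  have hlt := A.rank_lt k h
  by_cases hk : k = i
  · obtain rfl := hk
    rw [A.retract_of_le h hlt.le, retract_self]
  by_cases hle : A.rank k ≤ A.rank i
  · rw [A.retract_of_le hk hle, A.retract_of_le _ (by omega)]
    rintro rfl
    omega
  · conv_rhs => rw [retract, dif_neg hk, dif_neg (by tauto)]

/-- The retraction sends a walk that avoids the edge `st` to connected points of the tree of `i`
without that edge. So an edge that is a bridge in its own tree remains one after gluing. -/
theorem reachable_retract {i : I} {s t : M i} {x y : Σ i, M i}
    (h : (A.glue.deleteEdges {s(⟨i, s⟩, ⟨i, t⟩)}).Reachable x y) :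
    ((A.tree i).deleteEdges {s(s, t)}).Reachable (A.retract i x.1 x.2) (A.retract i y.1 y.2) := by
  obtain ⟨p⟩ := h
  induction p with
  | nil => rfl
  | cons hadj _ ih =>
    refine SimpleGraph.Reachable.trans ?_ ih
    rw [SimpleGraph.deleteEdges_adj] at hadj
    obtain ⟨hadj, hne⟩ := hadj
    cases (hadj : A.Adj _ _) with
    | @inner k a b h =>
      by_cases hk : k = i
      · obtain rfl := hk
        rw [retract_self, retract_self]
        refine SimpleGraph.Adj.reachable (SimpleGraph.deleteEdges_adj.2 ⟨h, fun h' => hne ?_⟩)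
        rw [Set.mem_singleton_iff] at h' ⊢
        simpa using h'
      · rw [A.retract_const hk a b]
    | toDown k h => rw [A.retract_link h]
    | toUp k h => rw [A.retract_link h]

theorem isBridge_inner {i : I} {s t : M i} (h : (A.tree i).Adj s t) :
    A.glue.IsBridge s(⟨i, s⟩, ⟨i, t⟩) := by
  rw [SimpleGraph.isBridge_iff]
  intro h'
  have := A.reachable_retract h'
  rw [retract_self, retract_self] at this
  exact SimpleGraph.isBridge_iff.1
    (SimpleGraph.isAcyclic_iff_forall_adj_isBridge.1 (A.isTree i).isAcyclic h) this

/-- `i` is below `j`. -/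
def Below (j i : I) : Prop := Relation.ReflTransGen (fun a b => A.par a = b ∧ A.par a ≠ a) i j

theorem rank_le_of_below {i j : I} (h : A.Below j i) : A.rank j ≤ A.rank i := by
  induction h with
  | refl => exact le_rfl
  | tail _ h ih =>
    obtain ⟨rfl, h⟩ := h
    exact (A.rank_lt _ h).le.trans ih

theorem below_par {i j : I} (hi : A.par i ≠ i) (hne : i ≠ j) :
    A.Below j (A.par i) ↔ A.Below j i := by
  refine ⟨fun h => Relation.ReflTransGen.head ⟨rfl, hi⟩ h, fun h => ?_⟩
  rcases Relation.ReflTransGen.cases_head h with h | ⟨c, ⟨rfl, -⟩, h⟩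
  · exact absurd h hne
  · exact h

/-- Only the link of `j` leads from the indices below `j` to the others, so being below `j` is
constant along walks that avoid it. -/
theorem isBridge_link {j : I} (h : A.par j ≠ j) :
    A.glue.IsBridge s(⟨A.par j, A.up j⟩, ⟨j, A.down j⟩) := by
  rw [SimpleGraph.isBridge_iff]
  have key : ∀ x y, (A.glue.deleteEdges {s(⟨A.par j, A.up j⟩, ⟨j, A.down j⟩)}).Reachable x y →
      (A.Below j x.1 ↔ A.Below j y.1) := by
    rintro x y ⟨p⟩
    induction p with
    | nil => rfl
    | cons hadj _ ih =>
      refine Iff.trans ?_ ih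
      rw [SimpleGraph.deleteEdges_adj] at hadj
      obtain ⟨hadj, hne⟩ := hadj
      cases (hadj : A.Adj _ _) with
      | inner h => rfl
      | toDown k h => exact A.below_par h fun hk => hne (by rw [hk]; rfl)
      | toUp k h => exact (A.below_par h fun hk => hne (by rw [hk]; exact Sym2.eq_swap)).symm
  intro h'
  have := A.rank_le_of_below ((key _ _ h').2 .refl)
  exact absurd (A.rank_lt j h) (not_lt.2 this)

theorem isTree_glue : A.glue.IsTree := by
  refine ⟨A.glue_connected, SimpleGraph.isAcyclic_iff_forall_adj_isBridge.2 fun x y hxy => ?_⟩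
  cases (hxy : A.Adj _ _) with
  | inner h => exact A.isBridge_inner h
  | toDown k h => exact A.isBridge_link h
  | toUp k h =>
    rw [Sym2.eq_swap]
    exact A.isBridge_link h

end TreeSystem

end Glue

/-! ### Connecting decompositions of the characteristic hypergraphs -/

section Connect

variable {V N ι : Type*} {G : CopyTree V N} {H H' : Hypergraph V} {α : AggOrdering V ι}
  {S : Set N} {r : N} {a b : V} {C F : Set V} {l : List (Set V)}

open Classical in
/-- The position on the way to `l` at which the attribute `a` becomes an output attribute. -/
noncomputable def introPosition (H : Hypergraph V) (α : AggOrdering V ι) (a : V) :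
    List (Set V) → List (Set V)
  | [] => []
  | C :: l => if a ∈ outputAttrs H α then [] else
      C :: introPosition (edgesMeeting H C) (componentOrdering H α C) a l

theorem introPosition_of_mem (ha : a ∈ outputAttrs H α) : introPosition H α a l = [] := by
  cases l with
  | nil => rfl
  | cons C l => exact if_pos ha

theorem introPosition_cons (ha : a ∉ outputAttrs H α) : introPosition H α a (C :: l) =
    C :: introPosition (edgesMeeting H C) (componentOrdering H α C) a l := if_neg ha

/-- All attributes of the edge `F` are output attributes at the position, and not before. -/
def IsEdgePosition (H : Hypergraph V) (α : AggOrdering V ι) (F : Set V) : List (Set V) → Prop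
  | [] => F ⊆ outputAttrs H α
  | C :: l => (F ∩ C).Nonempty ∧ IsEdgePosition (edgesMeeting H C) (componentOrdering H α C) F l

/-- An edge with an aggregated attribute meets a component and passes to its query. The ordering
gets shorter, so the edge finally consists of output attributes. -/
theorem IsAdmissible.exists_edgePosition (hH : IsAdmissible H α) (hs : SameInner α H H')
    (hF : F ∈ H.edgeSet) : ∃ l, IsCharPosition H' α l ∧ IsEdgePosition H α F l := by
  induction hn : α.length using Nat.strong_induction_on generalizing H H' α with
  | _ n ih =>
    by_cases hFo : F ⊆ outputAttrs H α
    · exact ⟨[], trivial, hFo⟩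
    · obtain ⟨C, hC, hFC⟩ := hH.exists_component_of_edge hF hFo
      obtain ⟨l, h1, h2⟩ := ih _ (hn ▸ hH.length_componentOrdering_lt hC) (hH.meeting hC)
        (hH.sameInner_component hC) ⟨hF, hFC⟩ rfl
      exact ⟨C :: l, (hs.isCharPosition_cons hH hC).2 h1, hFC, h2⟩

/-- The interface edge between the position `l` and the position `l ++ [C]`. -/
def linkEdge (H : Hypergraph V) (α : AggOrdering V ι) : List (Set V) → Set V → Set V
  | [], C => interfaceEdge H α C
  | D :: l, C => linkEdge (componentHypergraph H α D) (componentOrdering H α D) l C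

/-- As an edge of both hypergraphs it is covered by a bag in each of their decompositions; these two
bags can be joined. -/
theorem linkEdge_mem (h : IsCharPosition H α (l ++ [C])) :
    linkEdge H α l C ∈ (charHypergraph H α l).edgeSet ∧
      linkEdge H α l C ∈ (charHypergraph H α (l ++ [C])).edgeSet := by
  induction l generalizing H α with
  | nil =>
    refine ⟨Or.inr ⟨C, h.1, rfl⟩, Or.inl ⟨Or.inr rfl, fun a ha => ⟨ha.2, fun ha' => ha.1.2 ?_⟩⟩⟩
    exact (mem_attrs_restrict.1 ha').1
  | cons D l ih => exact ih h.2

/-- The part of the tree with node set `S` is composed of decompositions of the characteristic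
hypergraphs, `part t` being the position to which the node `t` belongs, and `lab a l` being the
number of the copy of `a` that is used at the position `l`. -/
structure IsComposed (G : CopyTree V N) (H H' : Hypergraph V) (α : AggOrdering V ι) (S : Set N)
    (r : N) (part : N → List (Set V)) (lab : V → List (Set V) → ℕ) : Prop where
  admissible : IsAdmissible H α
  same : SameInner α H H'
  edges : H.edgeSet ⊆ H'.edgeSet
  position : ∀ t ∈ S, IsCharPosition H' α (part t)
  ghd : ∀ l, IsCharPosition H' α l →
    IsGHDOn (charHypergraph H' α l) G.base {t | t ∈ S ∧ part t = l}
  root_mem : r ∈ S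
  root_part : part r = []
  link : ∀ l C, IsCharPosition H' α (l ++ [C]) → ∃ u ∈ S, ∃ v ∈ S, part u = l ∧
    part v = l ++ [C] ∧ G.tree.Adj u v ∧ linkEdge H' α l C ⊆ G.base.bag u ∧
      linkEdge H' α l C ⊆ G.base.bag v
  sep : ∀ s ∈ S, ∀ t ∈ S, G.tree.Adj s t → part s <+: part t ∨ part t <+: part s
  bag : ∀ t ∈ S, ∀ a i, (a, i) ∈ G.bag t → i = lab a (part t)
  lab_eq : ∀ a ∈ H.vertexSet, ∀ l l', IsCharPosition H' α l → IsCharPosition H' α l' →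
    (lab a l = lab a l' ↔ introPosition H α a l = introPosition H α a l')
  label : ∀ F ∈ H.edgeSet, ∃ l, IsCharPosition H' α l ∧ IsEdgePosition H α F l ∧
    ∀ a ∈ F, G.label a F = lab a l

variable {part : N → List (Set V)} {lab : V → List (Set V) → ℕ}

namespace IsComposed

variable (h : IsComposed G H H' α S r part lab)

include h

/-- The nodes that belong to the component `C`. -/
theorem sub (hC : IsQueryComponent H α C) : ∃ u ∈ S, ∃ v, part u = [] ∧ G.tree.Adj u v ∧
    interfaceEdge H α C ⊆ G.base.bag u ∧ interfaceEdge H α C ⊆ G.base.bag v ∧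
    IsComposed G (edgesMeeting H C) (componentHypergraph H α C) (componentOrdering H α C)
      {t | t ∈ S ∧ ∃ l, part t = C :: l} v (fun t => (part t).tail)
      (fun a l => lab a (C :: l)) := by
  have hH := h.admissible
  have hCa := hH.component_subset_attrs hC
  have hpos : ∀ {l}, IsCharPosition H' α (C :: l) ↔
      IsCharPosition (componentHypergraph H α C) (componentOrdering H α C) l :=
    h.same.isCharPosition_cons hH hC
  obtain ⟨u, hu, v, hv, hup, hvp, hadj, hub, hvb⟩ := h.link [] C (hpos.2 trivial)
  rw [linkEdge, ← h.same.interfaceEdge_eq hCa] at hub hvb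
  refine ⟨u, hu, v, hup, hadj, hub, hvb, hH.meeting hC, hH.sameInner_component hC,
    fun F hF => Or.inl hF, ?_, fun l hl => ?_, ⟨hv, [], hvp⟩, by rw [hvp]; rfl, ?_, ?_, ?_, ?_, ?_⟩
  · rintro t ⟨ht, l, hl⟩
    have := h.position t ht
    rw [hl] at this ⊢
    exact hpos.1 this
  · have := h.ghd (C :: l) (hpos.2 hl)
    rw [charHypergraph, ← h.same.componentHypergraph_eq hCa,
      ← h.same.componentOrdering_eq hH.nodup hCa] at this
    convert this using 1
    ext t
    constructor
    · rintro ⟨⟨ht, l', hl'⟩, htl⟩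
      refine ⟨ht, ?_⟩
      rw [hl'] at htl ⊢
      rw [← htl]
      rfl
    · rintro ⟨ht, htl⟩
      exact ⟨⟨ht, l, htl⟩, by rw [htl]; rfl⟩
  · intro l D hl
    obtain ⟨u, hu, v, hv, hup, hvp, hadj, hub, hvb⟩ := h.link (C :: l) D (hpos.2 hl)
    rw [linkEdge, ← h.same.componentHypergraph_eq hCa,
      ← h.same.componentOrdering_eq hH.nodup hCa] at hub hvb
    exact ⟨u, ⟨hu, l, hup⟩, v, ⟨hv, _, hvp⟩, by rw [hup]; rfl, by rw [hvp]; rfl, hadj, hub, hvb⟩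
  · rintro s ⟨hs, l, hl⟩ t ⟨ht, l', hl'⟩ hst
    have := h.sep s hs t ht hst
    rw [hl, hl', List.cons_prefix_cons, List.cons_prefix_cons] at this
    rw [hl, hl']
    exact this.imp And.right And.right
  · rintro t ⟨ht, l, hl⟩ a i hai
    have := h.bag t ht a i hai
    rw [hl] at this ⊢
    exact this
  · intro a ha l l' hl hl'
    have := h.lab_eq a (edgesMeeting_vertexSet_subset ha) (C :: l) (C :: l') (hpos.2 hl)
      (hpos.2 hl')
    rw [this]
    by_cases hao : a ∈ outputAttrs H α
    · have : a ∈ outputAttrs (edgesMeeting H C) (componentOrdering H α C) :=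
        (hH.mem_outputAttrs_component hC).2 (Or.inl ⟨hao, ha⟩)
      simp only [introPosition_of_mem hao, introPosition_of_mem this]
    · rw [introPosition_cons hao, introPosition_cons hao, List.cons_inj_right]
  · rintro F ⟨hF, hFC⟩
    obtain ⟨l, hl, hFl, hlab⟩ := h.label F hF
    rcases l with _ | ⟨D, l⟩
    · obtain ⟨c, hcF, hc⟩ := hFC
      exact absurd (hCa hc) (hFl hcF).2
    · have hD : IsQueryComponent H α D := (h.same.isQueryComponent_iff hH).1 hl.1
      obtain rfl := hH.component_eq_of_edge hC hD hF hFC hFl.1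
      exact ⟨l, hpos.1 hl, hFl.2, hlab⟩

theorem mem_bag_of_part_nil {t : N} (ht : t ∈ S) (htp : part t = []) (ha : a ∈ G.base.bag t) :
    a ∈ outputAttrs H α := by
  rw [h.same.outputAttrs_eq]
  exact (h.ghd [] trivial).bag_subset t ⟨ht, htp⟩ ha

theorem lab_eq_of_mem_outputAttrs (ha : a ∈ outputAttrs H α) {l l' : List (Set V)}
    (hl : IsCharPosition H' α l) (hl' : IsCharPosition H' α l') : lab a l = lab a l' :=
  (h.lab_eq a ha.1 l l' hl hl').2 (by rw [introPosition_of_mem ha, introPosition_of_mem ha])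

theorem label_eq_of_mem_outputAttrs (ha : a ∈ outputAttrs H α) (hF : F ∈ H.edgeSet) (haF : a ∈ F)
    (hl : IsCharPosition H' α l) : G.label a F = lab a l := by
  obtain ⟨l', hl', -, hlab⟩ := h.label F hF
  rw [hlab a haF]
  exact h.lab_eq_of_mem_outputAttrs ha hl' hl

theorem mem_bag_of_label {t : N} (ht : t ∈ S) (ha : a ∈ outputAttrs H α) (hF : F ∈ H.edgeSet)
    (haF : a ∈ F) : (a, G.label a F) ∈ G.bag t ↔ a ∈ G.base.bag t := by
  refine ⟨fun h' => CopyTree.mem_base_bag.2 ⟨_, h'⟩, fun h' => ?_⟩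
  obtain ⟨i, hi⟩ := CopyTree.mem_base_bag.1 h'
  rw [h.label_eq_of_mem_outputAttrs ha hF haF (h.position t ht), ← h.bag t ht a i hi]
  exact hi

/-- The number of a copy determines the component to which it belongs. -/
theorem exists_part_cons (hC : IsQueryComponent H α C) (ha : a ∉ outputAttrs H α)
    (hF : F ∈ H.edgeSet) (hFC : (F ∩ C).Nonempty) (haF : a ∈ F) {t : N} (ht : t ∈ S)
    (hat : (a, G.label a F) ∈ G.bag t) : ∃ l, part t = C :: l := by
  have haV := H.subset_vertexSet_of_mem_edgeSet' hF haF
  obtain ⟨l, hl, hFl, hlab⟩ := h.label F hF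
  rcases l with _ | ⟨D, l⟩
  · exact absurd (hFl haF) ha
  · have hD : IsQueryComponent H α D := (h.same.isQueryComponent_iff h.admissible).1 hl.1
    obtain rfl := h.admissible.component_eq_of_edge hC hD hF hFC hFl.1
    have hb := h.bag t ht a _ hat
    rw [hlab a haF] at hb
    have hi := (h.lab_eq a haV _ _ hl (h.position t ht)).1 hb
    rcases hp : part t with _ | ⟨E, l'⟩
    · exact absurd (h.mem_bag_of_part_nil ht hp (CopyTree.mem_base_bag.2 ⟨_, hat⟩)) ha
    · rw [hp, introPosition_cons ha, introPosition_cons ha] at hi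
      exact ⟨l', by rw [(List.cons.inj hi).1]⟩

theorem part_cases {t : N} (ht : t ∈ S) :
    part t = [] ∨ ∃ C, IsQueryComponent H α C ∧ ∃ l, part t = C :: l := by
  rcases hp : part t with _ | ⟨C, l⟩
  · exact Or.inl rfl
  · have := h.position t ht
    rw [hp] at this
    exact Or.inr ⟨C, (h.same.isQueryComponent_iff h.admissible).1 this.1, l, rfl⟩

theorem nil_connected : IsConnectedSet G.tree.Adj {t | t ∈ S ∧ part t = []} :=
  (h.ghd [] trivial).subtree

theorem connected (hsub : ∀ C, IsQueryComponent H α C →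
      IsConnectedSet G.tree.Adj {t | t ∈ S ∧ ∃ l, part t = C :: l}) :
    IsConnectedSet G.tree.Adj S := by
  refine .of_center (a := r) (fun _ _ h => h.symm) (fun t ht => ?_) h.root_mem
  have h0 : ∀ u ∈ S, part u = [] → ConnectedIn G.tree.Adj S r u := fun u hu hup =>
    (h.nil_connected.2 r ⟨h.root_mem, h.root_part⟩ u ⟨hu, hup⟩).subset fun _ h => h.1
  rcases h.part_cases ht with hp | ⟨C, hC, hp⟩
  · exact h0 t ht hp
  · obtain ⟨u, hu, v, hup, hadj, -, -, hC'⟩ := h.sub hC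
    exact ((h0 u hu hup).trans (.of_rel hu hC'.root_mem.1 hadj)).trans
      (((hsub C hC).2 v hC'.root_mem t ⟨ht, hp⟩).subset fun _ h => h.1)

/-- The copies of an attribute that is not an output attribute stay within one component, where the
claim is given. An output attribute has a single copy, whose occurrences in different parts meet
along the links. -/
theorem aghd (hsub : ∀ C, IsQueryComponent H α C → G.IsAGHDOn (edgesMeeting H C)
      (componentOrdering H α C) {t | t ∈ S ∧ ∃ l, part t = C :: l}) : G.IsAGHDOn H α S := by
  have hH := h.admissible
  have hcomp : ∀ {F a}, F ∈ H.edgeSet → a ∈ F → a ∉ outputAttrs H α →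
      ∃ C, IsQueryComponent H α C ∧ (F ∩ C).Nonempty := fun hF haF ha =>
    hH.exists_component_of_edge hF fun h' => ha (h' haF)
  refine ⟨fun a ha F hF F' hF' haF haF' => ?_, h.connected fun C hC => (hsub C hC).2.subtree,
    fun t ht => ?_, ?_, ?_⟩
  · by_cases hao : a ∈ outputAttrs H α
    · rw [h.label_eq_of_mem_outputAttrs hao hF haF (h.position r h.root_mem),
        h.label_eq_of_mem_outputAttrs hao hF' haF' (h.position r h.root_mem)]
    · have haα : a ∈ α.attrs := by
        by_contra h'
        exact hao ⟨H.subset_vertexSet_of_mem_edgeSet' hF haF, h'⟩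
      obtain ⟨C, hC, haC⟩ := hH.exists_component ((mem_attrs_cases haα).resolve_right ha)
      exact (hsub C hC).1 a (fun h' => ha (mem_productAttrs_restrict.1 h').1) F
        ⟨hF, a, haF, haC⟩ F' ⟨hF', a, haF', haC⟩ haF haF'
  · rintro ⟨a, i⟩ hat
    rw [mem_partitionHypergraph]
    rcases h.part_cases ht with hp | ⟨C, hC, hp⟩
    · have hao := h.mem_bag_of_part_nil ht hp (CopyTree.mem_base_bag.2 ⟨_, hat⟩)
      obtain ⟨F, hF, haF⟩ := hH.cover a hao.1
      refine ⟨F, hF, haF, ?_⟩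
      rw [h.bag t ht a i hat]
      exact h.label_eq_of_mem_outputAttrs hao hF haF (h.position t ht)
    · obtain ⟨F, hF, haF, hi⟩ := (hsub C hC).exists_edge ⟨ht, hp⟩ hat
      exact ⟨F, hF.1, haF, hi⟩
  · rintro _ ⟨F, hF, rfl⟩
    by_cases hFo : F ⊆ outputAttrs H α
    · obtain ⟨t, ⟨ht, -⟩, hFt⟩ := (h.ghd [] trivial).cover F
        (Or.inl ⟨h.edges hF, h.same.outputAttrs_eq ▸ hFo⟩)
      refine ⟨t, ht, ?_⟩
      rintro _ ⟨a, haF, rfl⟩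
      exact (h.mem_bag_of_label ht (hFo haF) hF haF).2 (hFt haF)
    · obtain ⟨C, hC, hFC⟩ := hH.exists_component_of_edge hF hFo
      obtain ⟨t, ht, hFt⟩ := (hsub C hC).2.cover _ ⟨F, ⟨hF, hFC⟩, rfl⟩
      exact ⟨t, ht.1, hFt⟩
  · rintro ⟨a, i⟩ hai
    obtain ⟨F, hF, haF, rfl⟩ := mem_partitionHypergraph.1 hai
    by_cases hao : a ∈ outputAttrs H α
    · have heq : {t | t ∈ S ∧ (a, G.label a F) ∈ G.bag t} = {t | t ∈ S ∧ a ∈ G.base.bag t} := by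
        ext t
        exact and_congr_right fun ht => h.mem_bag_of_label ht hao hF haF
      rw [heq]
      have h0 := (h.ghd [] trivial).running a (by
        change a ∈ outputAttrs H' α
        rwa [← h.same.outputAttrs_eq])
      obtain ⟨z, ⟨hz, hzp⟩, haz⟩ := h0.1
      refine .of_center (a := z) (fun _ _ h => h.symm) (fun t ht => ?_) ⟨hz, haz⟩
      have h1 : ∀ u ∈ S, part u = [] → a ∈ G.base.bag u →
          ConnectedIn G.tree.Adj {t | t ∈ S ∧ a ∈ G.base.bag t} z u := fun u hu hup hau =>
        (h0.2 z ⟨⟨hz, hzp⟩, haz⟩ u ⟨⟨hu, hup⟩, hau⟩).subset fun _ h => ⟨h.1.1, h.2⟩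
      rcases h.part_cases ht.1 with hp | ⟨C, hC, hp⟩
      · exact h1 t ht.1 hp ht.2
      -- From the part at position `[]`, the component is entered along the edge `uv`, both of whose
      -- bags contain the interface edge and hence `a`.
      · obtain ⟨u, hu, v, hup, hadj, hub, hvb, hC'⟩ := h.sub hC
        obtain ⟨i, hi⟩ := CopyTree.mem_base_bag.1 ht.2
        obtain ⟨F', hF', haF', rfl⟩ := (hsub C hC).exists_edge ⟨ht.1, hp⟩ hi
        have hai : a ∈ interfaceEdge H α C :=
          ⟨hao, (edgesMeeting H C).subset_vertexSet_of_mem_edgeSet' hF' haF'⟩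
        have hv := hC'.root_mem
        refine ((h1 u hu hup (hub hai)).trans (.of_rel ⟨hu, hub hai⟩ ⟨hv.1, hvb hai⟩ hadj)).trans ?_
        refine (((hsub C hC).connected hF' haF').2 v ⟨hv, ?_⟩ t ⟨⟨ht.1, hp⟩, hi⟩).subset
          fun x hx => ⟨hx.1.1, CopyTree.mem_base_bag.2 ⟨_, hx.2⟩⟩
        exact (h.mem_bag_of_label hv.1 hao hF'.1 haF').2 (hvb hai)
    · obtain ⟨C, hC, hFC⟩ := hcomp hF haF hao
      have heq : {t | t ∈ S ∧ (a, G.label a F) ∈ G.bag t} =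
          {t | t ∈ {t | t ∈ S ∧ ∃ l, part t = C :: l} ∧ (a, G.label a F) ∈ G.bag t} := by
        ext t
        exact ⟨fun ht => ⟨⟨ht.1, h.exists_part_cons hC hao hF hFC haF ht.1 ht.2⟩, ht.2⟩,
          fun ht => ⟨ht.1.1, ht.2⟩⟩
      rw [heq]
      exact (hsub C hC).connected ⟨hF, hFC⟩ haF

end IsComposed

/-- `T₀` consists of the nodes at position `[]`, and the subtree of `C` of those whose position
begins with `C`. Tree edges only join positions of which one is a prefix of the other, so these
subtrees are components outside `T₀`. -/
theorem IsComposed.isDecomposableOn (h : IsComposed G H H' α S r part lab) :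
    IsDecomposableOn G H α S r := by
  induction hn : α.length using Nat.strong_induction_on
    generalizing H H' α S r part lab with
  | _ n ih =>
    have hH := h.admissible
    have hsymm : ∀ s t, G.tree.Adj s t → G.tree.Adj t s := fun _ _ h => h.symm
    choose u hu v hup hadj hub hvb hsub using fun C (hC : IsQueryComponent H α C) => h.sub hC
    have hdec : ∀ C (hC : IsQueryComponent H α C), IsDecomposableOn G (edgesMeeting H C)
        (componentOrdering H α C) {t | t ∈ S ∧ ∃ l, part t = C :: l} (v C hC) := fun C hC =>
      ih _ (hn ▸ hH.length_componentOrdering_lt hC) (hsub C hC) rfl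
    have hcomp : ∀ C, IsQueryComponent H α C → IsComponentOf G.tree.Adj
        (S \ {t | t ∈ S ∧ part t = []}) {t | t ∈ S ∧ ∃ l, part t = C :: l} := by
      refine fun C hC => (isComponentOf_iff hsymm).2 ⟨(hdec C hC).aghd.2.subtree, ?_, ?_⟩
      · rintro t ⟨ht, l, hl⟩
        refine ⟨ht, fun h' => ?_⟩
        rw [h'.2] at hl
        cases hl
      · rintro s ⟨hs, l, hl⟩ t ht hst
        rcases h.part_cases ht.1 with hp | ⟨D, hD, l', hp⟩
        · exact absurd ⟨ht.1, hp⟩ ht.2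
        · have := h.sep s hs t ht.1 hst
          rw [hl, hp, List.cons_prefix_cons, List.cons_prefix_cons] at this
          exact ⟨ht.1, l', by rw [hp, this.elim And.left fun h => h.1.symm]⟩
    refine .intro H α S r {t | t ∈ S ∧ part t = []} (h.aghd fun C hC => (hdec C hC).aghd)
      (fun _ h => h.1) ⟨h.root_mem, h.root_part⟩ h.nil_connected ?_
      (fun C _ => {t | t ∈ S ∧ ∃ l, part t = C :: l}) v hcomp
      (fun C hC => ⟨(hsub C hC).root_mem, u C hC, ⟨hu C hC, hup C hC⟩, hadj C hC⟩) ?_ hdec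
    · ext a
      simp only [Set.mem_iUnion, exists_prop]
      constructor
      · rintro ⟨t, ht, hat⟩
        exact h.mem_bag_of_part_nil ht.1 ht.2 hat
      · intro ha
        rw [h.same.outputAttrs_eq] at ha
        obtain ⟨t, ht, hat⟩ := ((h.ghd [] trivial).running a ha).1
        exact ⟨t, ht, hat⟩
    · rintro C hC B hB ⟨t, htB, a, haC, hat⟩
      have htS := ((isComponentOf_iff hsymm).1 hB).2.1 htB
      rcases h.part_cases htS.1 with hp | ⟨D, hD, hp⟩
      · exact absurd ⟨htS.1, hp⟩ htS.2
      · have haD := (hdec D hD).aghd.mem_vertexSet ⟨htS.1, hp⟩ hat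
        obtain rfl := hH.component_eq hC hD ⟨a, haC,
          (hH.mem_component_iff hD).2 ⟨haD, hH.subset_semiringAttrs hC haC⟩⟩
        exact hB.eq_of_inter_nonempty hsymm (hcomp C hC) ⟨t, htB, htS.1, hp⟩

end Connect

/-! ### Construction of the glued AGHD -/

section Gluing

variable {V N ι : Type*} {H : Hypergraph V} {α : AggOrdering V ι} {a : V} {C : Set V}
  {l : List (Set V)}

theorem ConnectedIn.map {X Y : Type*} {r : X → X → Prop} {r' : Y → Y → Prop} {U : Set X} {W : Set Y}
    {x y : X} (f : X → Y) (hf : ∀ x y, r x y → r' (f x) (f y)) (hU : ∀ x ∈ U, f x ∈ W)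
    (h : ConnectedIn r U x y) : ConnectedIn r' W (f x) (f y) :=
  ⟨hU _ h.1, h.2.lift f fun _ _ h => ⟨hU _ h.1, hU _ h.2.1, hf _ _ h.2.2⟩⟩

theorem introPosition_prefix : introPosition H α a l <+: l := by
  induction l generalizing H α with
  | nil => exact List.prefix_rfl
  | cons C l ih =>
    rw [introPosition]
    split
    · exact List.nil_prefix
    · exact (List.prefix_cons_inj C).2 ih

theorem IsCharPosition.of_append {l' : List (Set V)} (h : IsCharPosition H α (l ++ l')) :
    IsCharPosition H α l := by
  induction l generalizing H α with
  | nil => trivial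
  | cons C l ih => exact ⟨h.1, ih h.2⟩

theorem IsCharPosition.of_prefix {l' : List (Set V)} (h : IsCharPosition H α l') (hl : l <+: l') :
    IsCharPosition H α l := by
  obtain ⟨l'', rfl⟩ := hl
  exact h.of_append

variable {M : CharIndex H α → Type*} (g : ∀ i, BagTree V (M i))

/-- The position before the last step. -/
def CharIndex.pred (i : CharIndex H α) : CharIndex H α :=
  ⟨i.1.dropLast, i.2.of_prefix i.1.dropLast_prefix⟩

theorem CharIndex.pred_eq {i : CharIndex H α} (hl : i.1 = l ++ [C]) : i.pred.1 = l := by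
  simp [CharIndex.pred, hl]

/-- At the position `[]` there is nothing to link, and arbitrary nodes are chosen. -/
theorem exists_link (hg : ∀ i, IsGHD (charHypergraph H α i.1) (g i)) (i : CharIndex H α) :
    ∃ (u : M i.pred) (v : M i), ∀ l C, i.1 = l ++ [C] →
      linkEdge H α l C ⊆ (g i.pred).bag u ∧ linkEdge H α l C ⊆ (g i).bag v := by
  rcases List.eq_nil_or_concat' i.1 with h | ⟨l, C, h⟩
  · obtain ⟨u, -⟩ := (hg i.pred).subtree.1
    obtain ⟨v, -⟩ := (hg i).subtree.1
    refine ⟨u, v, fun l C h' => ?_⟩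
    rw [h] at h'
    simp at h'
  · obtain ⟨h1, h2⟩ := linkEdge_mem (h ▸ i.2)
    obtain ⟨u, -, hu⟩ := (hg i.pred).cover _ (by rwa [CharIndex.pred_eq h])
    obtain ⟨v, -, hv⟩ := (hg i).cover _ (by rwa [h])
    refine ⟨u, v, fun l' C' h' => ?_⟩
    rw [h] at h'
    obtain ⟨rfl, h''⟩ := List.append_inj' h' rfl
    obtain rfl := List.singleton_injective h''
    exact ⟨hu, hv⟩

theorem CharIndex.length_pred_lt {i : CharIndex H α} (h : i.pred ≠ i) :
    i.pred.1.length < i.1.length := by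
  rcases List.eq_nil_or_concat' i.1 with h' | ⟨l, C, h'⟩
  · exact absurd (Subtype.ext (by simp [CharIndex.pred, h'])) h
  · rw [CharIndex.pred_eq h', h']
    simp

theorem CharIndex.eq_nil_of_pred_eq {i : CharIndex H α} (h : i.pred = i) : i = ⟨[], trivial⟩ := by
  rcases List.eq_nil_or_concat' i.1 with h' | ⟨l, C, h'⟩
  · exact Subtype.ext h'
  · have := CharIndex.pred_eq h'
    rw [h, h'] at this
    simp at this

/-- The decompositions are joined along the tree of positions, each to that of its predecessor at
bags containing the link edge. The bijection `e` leaves the type of nodes free. -/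
theorem exists_gluing (hH : IsAdmissible H α) (hg : ∀ i, IsGHD (charHypergraph H α i.1) (g i))
    (e : N ≃ Σ i, M i) : ∃ G : CopyTree V N, G.IsDecomposable H α ∧
      (∀ i (s t : M i), G.tree.Adj (e.symm ⟨i, s⟩) (e.symm ⟨i, t⟩) ↔ (g i).tree.Adj s t) ∧
      ∀ i (t : M i), G.base.bag (e.symm ⟨i, t⟩) = (g i).bag t := by
  classical
  choose up down hlink using exists_link g hg
  let A : TreeSystem (CharIndex H α) M :=
    { tree := fun i => (g i).tree
      isTree := fun i => (g i).isTree
      rank := fun i => i.1.length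
      par := CharIndex.pred
      rank_lt := fun i h => CharIndex.length_pred_lt h
      root := ⟨[], trivial⟩
      eq_root := fun i h => CharIndex.eq_nil_of_pred_eq h
      up := up
      down := down }
  have : Finite (CharIndex H α) := hH.finite_charPositions
  obtain ⟨code, hcode⟩ := Countable.exists_injective_nat (CharIndex H α)
  -- Two positions use the same copy of `a` exactly if `a` became an output attribute at the same
  -- place on the way to them; `code` numbers these places.
  let lab : V → List (Set V) → ℕ := fun a l =>
    if h : IsCharPosition H α (introPosition H α a l) then code ⟨_, h⟩ else 0
  have hlab : ∀ a l l', IsCharPosition H α l → IsCharPosition H α l' →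
      (lab a l = lab a l' ↔ introPosition H α a l = introPosition H α a l') := by
    intro a l l' hl hl'
    simp only [lab, dif_pos (hl.of_prefix introPosition_prefix),
      dif_pos (hl'.of_prefix introPosition_prefix), hcode.eq_iff, Subtype.mk.injEq]
  let G : CopyTree V N :=
    { tree := A.glue.comap e
      isTree := (SimpleGraph.Iso.comap e A.glue).isTree_iff.2 A.isTree_glue
      bag := fun x => {w | w.1 ∈ (g (e x).1).bag (e x).2 ∧ w.2 = lab w.1 (e x).1.1}
      root := e.symm ⟨⟨[], trivial⟩, down ⟨[], trivial⟩⟩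
      -- An edge uses the copies that belong to a position at which all its attributes are output
      -- attributes.
      label := fun a F => if h : ∃ l, IsCharPosition H α l ∧ IsEdgePosition H α F l then
        lab a h.choose else 0 }
  have hadj : ∀ x y, G.tree.Adj x y ↔ A.Adj (e x) (e y) := fun x y => Iff.rfl
  have hbag : ∀ x, G.base.bag x = (g (e x).1).bag (e x).2 := by
    intro x
    ext a
    rw [CopyTree.mem_base_bag]
    exact ⟨fun ⟨i, hi⟩ => hi.1, fun ha => ⟨lab a (e x).1.1, ha, rfl⟩⟩
  have hbag' : ∀ i (t : M i), G.base.bag (e.symm ⟨i, t⟩) = (g i).bag t := by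
    intro i t
    rw [hbag, e.apply_symm_apply]
  have hadj' : ∀ i (s t : M i), G.tree.Adj (e.symm ⟨i, s⟩) (e.symm ⟨i, t⟩) ↔
      (g i).tree.Adj s t := by
    intro i s t
    rw [hadj, e.apply_symm_apply, e.apply_symm_apply]
    exact TreeSystem.adj_inner_iff
  refine ⟨G, ?_, hadj', hbag'⟩
  refine IsComposed.isDecomposableOn (H' := H) (part := fun x => (e x).1.1) (lab := lab)
    ⟨hH, .refl α H, subset_rfl, fun x _ => (e x).1.2, fun l hl => ?_, trivial, ?_, ?_, ?_, ?_,
      fun a _ => hlab a, ?_⟩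
  · have hcon : ∀ (P : N → Prop), IsConnectedSet (g ⟨l, hl⟩).tree.Adj
        {t | t ∈ Set.univ ∧ P (e.symm ⟨⟨l, hl⟩, t⟩)} →
        IsConnectedSet G.tree.Adj {x | x ∈ {x | x ∈ Set.univ ∧ (e x).1.1 = l} ∧ P x} := by
      intro P hP
      have hmem : ∀ t ∈ {t | t ∈ Set.univ ∧ P (e.symm ⟨⟨l, hl⟩, t⟩)}, e.symm ⟨⟨l, hl⟩, t⟩ ∈
          {x | x ∈ {x | x ∈ Set.univ ∧ (e x).1.1 = l} ∧ P x} := fun t ht =>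
        ⟨⟨trivial, by rw [e.apply_symm_apply]⟩, ht.2⟩
      obtain ⟨z, hz⟩ := hP.1
      refine .of_center (a := e.symm ⟨⟨l, hl⟩, z⟩) (fun _ _ h => h.symm) (fun x hx => ?_)
        (hmem z hz)
      obtain ⟨⟨⟨i, hi⟩, t⟩, rfl⟩ := e.symm.surjective x
      obtain ⟨⟨-, hx⟩, hxP⟩ := hx
      rw [e.apply_symm_apply] at hx
      obtain rfl : i = l := hx
      exact (hP.2 z hz t ⟨trivial, hxP⟩).map (fun t => e.symm ⟨⟨i, hl⟩, t⟩)
        (fun s t hst => (hadj' _ s t).2 hst) hmem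
    have hgl := hg ⟨l, hl⟩
    refine ⟨?_, fun x hx => ?_, fun F hF => ?_, fun a ha => ?_⟩
    · change IsConnectedSet G.tree.Adj _
      simpa using hcon (fun _ => True) (by simpa using hgl.subtree)
    · obtain ⟨⟨⟨i, hi⟩, t⟩, rfl⟩ := e.symm.surjective x
      obtain ⟨-, hx⟩ := hx
      rw [e.apply_symm_apply] at hx
      obtain rfl : i = l := hx
      rw [hbag']
      exact hgl.bag_subset t trivial
    · obtain ⟨t, -, ht⟩ := hgl.cover F hF
      exact ⟨e.symm ⟨⟨l, hl⟩, t⟩, ⟨trivial, by rw [e.apply_symm_apply]⟩, by rwa [hbag']⟩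
    · refine hcon (fun x => a ∈ G.base.bag x) ?_
      simp only [hbag']
      exact hgl.running a ha
  · change (e (e.symm _)).1.1 = []
    rw [e.apply_symm_apply]
  · intro l C hl
    let i : CharIndex H α := ⟨l ++ [C], hl⟩
    have hi : i.pred.1 = l := CharIndex.pred_eq rfl
    obtain ⟨h1, h2⟩ := hlink i l C rfl
    refine ⟨e.symm ⟨i.pred, up i⟩, trivial, e.symm ⟨i, down i⟩, trivial, ?_, ?_, ?_, ?_, ?_⟩
    · rw [e.apply_symm_apply, hi]
    · rw [e.apply_symm_apply]
    · rw [hadj, e.apply_symm_apply, e.apply_symm_apply]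
      refine TreeSystem.Adj.toDown (A := A) i fun h => ?_
      have := congrArg (fun i => i.1.length) h
      simp [A, hi, i] at this
    · rwa [hbag']
    · rwa [hbag']
  · intro x _ y _ hxy
    rw [hadj] at hxy
    have hpre : ∀ i : CharIndex H α, i.pred.1 <+: i.1 := fun i => i.1.dropLast_prefix
    generalize e x = x' at hxy
    generalize e y = y' at hxy
    cases hxy with
    | inner h => exact Or.inl List.prefix_rfl
    | toDown i h => exact Or.inl (hpre i)
    | toUp i h => exact Or.inr (hpre i)
  · rintro x - a i hx
    exact hx.2
  · intro F hF
    have h := hH.exists_edgePosition (.refl α H) hF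
    exact ⟨h.choose, h.choose_spec.1, h.choose_spec.2, fun a _ => dif_pos h⟩

theorem exists_gluing_sigma [∀ i, Finite (M i)] (hH : IsAdmissible H α)
    (hg : ∀ i, IsGHD (charHypergraph H α i.1) (g i)) :
    ∃ (_ : Finite (Σ i, M i)) (G : CopyTree V (Σ i, M i)), G.IsDecomposable H α ∧
      (∀ i (s t : M i), G.tree.Adj ⟨i, s⟩ ⟨i, t⟩ ↔ (g i).tree.Adj s t) ∧
      (∀ i (t : M i), G.base.bag ⟨i, t⟩ = (g i).bag t) ∧
      ∀ γ : Set V → ℝ, G.base.width γ = ⨆ i, (g i).width γ := by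
  have : Finite (CharIndex H α) := hH.finite_charPositions
  have hfin : Finite (Σ i, M i) := inferInstance
  obtain ⟨G, h1, h2, h3⟩ := exists_gluing g hH hg (Equiv.refl _)
  refine ⟨hfin, G, h1, h2, h3, fun γ => ?_⟩
  have : Nonempty (CharIndex H α) := ⟨⟨[], trivial⟩⟩
  have hne : ∀ i, Nonempty (Set.univ : Set (M i)) := fun i => (hg i).subtree.1.to_subtype
  have : Nonempty (Set.univ : Set (Σ i, M i)) := ⟨⟨G.root, trivial⟩⟩
  refine le_antisymm (ciSup_le fun t => ?_) (ciSup_le fun i => ciSup_le fun t => ?_)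
  · refine le_trans ?_ (le_ciSup (f := fun i => (g i).width γ) (Set.finite_range _).bddAbove
      t.1.1)
    refine le_trans ?_ (le_ciSup (f := fun s : (Set.univ : Set (M t.1.1)) =>
      γ ((g t.1.1).bag s)) (Set.finite_range _).bddAbove ⟨t.1.2, trivial⟩)
    exact le_of_eq (congrArg γ (h3 t.1.1 t.1.2))
  · refine le_trans (le_of_eq (congrArg γ (h3 i t.1).symm)) (le_ciSup (f := fun s :
      (Set.univ : Set (Σ i, M i)) => γ (G.base.bag s)) (Set.finite_range _).bddAbove
        ⟨⟨i, t.1⟩, trivial⟩)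

end Gluing

/-! ### From valid to decomposable AGHDs -/

namespace AggOrdering

variable {V ι : Type*} {α : AggOrdering V ι} {s U : Set V} {a b : V}

theorem isFirst_restrict (hα : (α.map Prod.fst).Nodup) (hU : U ⊆ (α.restrict s).attrs) :
    (α.restrict s).IsFirst U a ↔ α.IsFirst U a := by
  constructor
  · rintro ⟨h1, h2, h3⟩
    exact ⟨h1, (mem_attrs_restrict.1 h2).1, fun b hb _ hne =>
      ((precedes_restrict hα).1 (h3 b hb (hU hb) hne)).1⟩
  · rintro ⟨h1, h2, h3⟩
    exact ⟨h1, hU h1, fun b hb hb' hne => (precedes_restrict hα).2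
      ⟨h3 b hb (mem_attrs_restrict.1 hb').1 hne, (mem_attrs_restrict.1 (hU h1)).2,
        (mem_attrs_restrict.1 hb').2⟩⟩

end AggOrdering

section Valid

variable {V N ι : Type*} {G : CopyTree V N} {H H' H₀ : Hypergraph V} {α α₀ β : AggOrdering V ι}
  {r : N} {y : V} {C F : Set V}

/-- The consequences of the equivalence of `α` and `β` for the first attributes of connected sets
with at most one product attribute. -/
structure SameFirst (H : Hypergraph V) (α β : AggOrdering V ι) : Prop where
  attrs_subset : α.attrs ⊆ β.attrs
  sameOp : ∀ U, IsConnectedSet H.Adj U → U ⊆ α.semiringAttrs → ∀ a b, α.IsFirst U a →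
    β.IsFirst U b → α.SameOp a b
  product_iff : ∀ U, IsConnectedSet H.Adj U → ∀ b ∈ U, b ∈ α.productAttrs →
    (∀ c ∈ U, c ≠ b → c ∈ α.semiringAttrs) → (α.IsFirst U b ↔ β.IsFirst U b)

theorem OrderEquiv.sameFirst {K : Type*} [CommMonoidWithZero K] [Nontrivial K]
    {O : OperatorSet ι K} (h : OrderEquiv O H α β) (hH : IsAdmissible H α)
    (hβ : (β.map Prod.fst).Nodup) : SameFirst H α β :=
  ⟨h.1.subset, fun _ hU hUα _ _ ha hb => h.sameOp_of_first hH hβ hU hUα ha hb,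
    fun _ hU _ hb hbp hs => h.isFirst_product_iff hH hβ hU hb hbp hs⟩

theorem edgesMeeting_adj {x y : V} (h : (edgesMeeting H C).Adj x y) : H.Adj x y := by
  obtain ⟨F, hF, hx, hy⟩ := h
  exact ⟨F, hF.1, hx, hy⟩

/-- Restricting `α` does not change which attribute of `U` comes first, so the property is inherited
with the same `β`. -/
theorem SameFirst.component (h : SameFirst H α β) (hα : (α.map Prod.fst).Nodup) :
    SameFirst (edgesMeeting H C) (componentOrdering H α C) β where
  attrs_subset a ha := h.attrs_subset (mem_attrs_restrict.1 ha).1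
  sameOp U hU hUα a b ha hb := by
    have hUα' := fun c hc => mem_semiringAttrs_restrict.1 (hUα (a := c) hc)
    obtain ⟨o, h1, h2⟩ := h.sameOp U (hU.mono_rel fun _ _ _ _ => edgesMeeting_adj)
      (fun c hc => (hUα' c hc).1) a b
      ((isFirst_restrict hα (hUα.trans semiringAttrs_subset)).1 ha) hb
    exact ⟨o, mem_restrict.2 ⟨h1, (hUα' a ha.1).2⟩, mem_restrict.2 ⟨h2, (hUα' b hb.1).2⟩⟩
  product_iff U hU b hb hbp hs := by
    have hUα : U ⊆ (componentOrdering H α C).attrs := fun c hc => by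
      by_cases hcb : c = b
      · exact hcb ▸ productAttrs_subset hbp
      · exact semiringAttrs_subset (hs c hc hcb)
    rw [← h.product_iff U (hU.mono_rel fun _ _ _ _ => edgesMeeting_adj) b hb
      (mem_productAttrs_restrict.1 hbp).1 fun c hc hcb =>
        (mem_semiringAttrs_restrict.1 (hs c hc hcb)).1]
    exact isFirst_restrict hα hUα

/-- In an equivalent ordering, no attribute of the rest of the component precedes an attribute of
the front to which it is connected within the rest. -/
theorem SameFirst.not_precedes_front (h : SameFirst H α β) (hβ : (β.map Prod.fst).Nodup)
    (hH : IsAdmissible H α) (hC : IsQueryComponent H α C) (hy : y ∈ componentFront H α C)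
    {D : Set V} (hD : IsConnectedSet H.Adj D) (hDC : D ⊆ C)
    (hDf : ∀ d ∈ D, d ∉ componentFront H α C)
    {x : V} (hx : x ∈ D) (hxy : H.Adj x y) {d : V} (hd : d ∈ D) : ¬ β.Precedes d y := by
  have hCs := hH.subset_semiringAttrs hC
  have hdβ : d ∈ β.attrs := h.attrs_subset (semiringAttrs_subset (hCs (hDC hd)))
  rcases hH.componentFront_cases hC with ⟨a, ha, hap, hfirst⟩ | ⟨f, i, -, -, hfi, hfr⟩
  · rw [ha] at hy
    obtain rfl := hy
    have hyC : ∀ c ∈ C, c ≠ y := by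
      rintro c hc rfl
      exact notMem_productAttrs hH.nodup (hCs hc) hap
    have hsub : insert y C ⊆ componentPlus H α C := by
      rintro c (rfl | hc)
      · exact hfirst.1
      · exact Or.inl hc
    -- The only product attribute of this set is `y`, which comes first in `α` and therefore also in
    -- `β`.
    have hU : IsConnectedSet H.Adj (insert y C) :=
      (hH.connected hC).insert H.adj_symm' (hDC hx) hxy
    have := (h.product_iff _ hU y (Or.inl rfl) hap fun c hc hcy => hCs (hc.resolve_left hcy)).1
      (hfirst.mono hsub (Or.inl rfl))
    exact (this.2.2 d (Or.inr (hDC hd)) hdβ (hyC d (hDC hd))).asymm hβ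
  · intro hdy
    obtain ⟨hyC, hyi⟩ := hfi y hy
    have hyfr := (hfr y (Or.inl hyC)).1 hy
    -- the first attribute of a connected set has the operator of `y`
    have hop : ∀ S, IsConnectedSet H.Adj S → y ∈ S → ∀ a ∈ componentPlus H α C,
        S ⊆ insert a C → α.IsFirst S a → α.SameOp a y := by
      intro S hS hyS a haC hSC hfirst
      by_cases hay : y = a
      · exact ⟨_, hay ▸ hyi, hyi⟩
      · refine (hyfr a haC (hfirst.2.2 y hyS ⟨_, hyi⟩ hay)).resolve_right (not_not.2 ?_)
        refine (hS.2 y hyS a hfirst.1).subset fun s hs => ?_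
        by_cases hsa : s = a
        · exact Or.inr (Or.inr hsa)
        · have hsC := (hSC hs).resolve_left hsa
          exact Or.inl ⟨hsC, hfirst.2.2 s hs (semiringAttrs_subset (hCs hsC)) hsa⟩
    have hU : IsConnectedSet H.Adj (insert y D) := hD.insert H.adj_symm' hx hxy
    have hUC : insert y D ⊆ C := Set.insert_subset hyC hDC
    have hne : ∀ {S : Set V} {γ : AggOrdering V ι}, y ∈ S → α.attrs ⊆ γ.attrs →
        ∃ a, γ.IsFirst S a := fun hS hγ => exists_isFirst ⟨y, hS, hγ ⟨_, hyi⟩⟩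
    obtain ⟨a₁, ha₁⟩ := hne (γ := α) (Set.mem_insert y D) subset_rfl
    obtain ⟨d₁, hd₁⟩ := hne (γ := β) (Set.mem_insert y D) h.attrs_subset
    -- As `d` precedes `y` in `β`, the first attribute of `insert y D` in `β` is not `y`.
    have hd₁D : d₁ ∈ D := by
      rcases hd₁.1 with rfl | h'
      · exact absurd hdy ((hd₁.2.2 d (Or.inr hd) hdβ (hdy.ne hβ)).asymm hβ)
      · exact h'
    have h₁y : α.SameOp d₁ y := by
      obtain ⟨o, h1, h2⟩ := h.sameOp _ hU (hUC.trans hCs) a₁ d₁ ha₁ hd₁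
      exact SameOp.trans' hH.nodup ⟨o, h2, h1⟩ (hop _ hU (Or.inl rfl) a₁ (Or.inl (hUC ha₁.1))
        (hUC.trans (Set.subset_insert _ _)) ha₁)
    have hnot := hDf d₁ hd₁D
    rw [hfr d₁ (Or.inl (hDC hd₁D))] at hnot
    push Not at hnot
    -- `d₁` has the operator of `y` but is not in the front, so some earlier `B` with a different
    -- operator is connected to it. The set `U'` defined below collects what is reachable from `B`
    -- in this connection.
    obtain ⟨B, hBC, hBd, hBop, hcon⟩ := hnot
    have hBα : B ∈ α.attrs := hBd.left_mem
    set W : Set V := {s | s ∈ C ∧ α.Precedes B s} ∪ {d₁, B} with hW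
    have hBW : B ∈ W := Or.inr (Or.inr rfl)
    set U' : Set V := {s | ConnectedIn H.Adj W B s} with hU'
    have hU'c : IsConnectedSet H.Adj U' :=
      ((isComponentOf_iff H.adj_symm').1 ⟨B, hBW, rfl⟩).1
    have hBU' : B ∈ U' := .refl hBW
    have hd₁U' : d₁ ∈ U' := hcon.symm H.adj_symm'
    have hU'C : ∀ s ∈ U', s ≠ B → s ∈ C ∧ α.Precedes B s := by
      intro s hs hsB
      rcases (ConnectedIn.right_mem hs : s ∈ W) with h' | rfl | rfl
      exacts [h', ⟨hDC hd₁D, hBd⟩, absurd rfl hsB]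
    have hBfirst : α.IsFirst U' B := ⟨hBU', hBα, fun s hs _ hsB => (hU'C s hs hsB).2⟩
    have hUU' : IsConnectedSet H.Adj (insert y D ∪ U') :=
      hU.union H.adj_symm' hU'c ⟨d₁, Or.inr hd₁D, hd₁U'⟩
    have hyUU' : y ∈ insert y D ∪ U' := Or.inl (Or.inl rfl)
    have hBy : ¬ α.SameOp B y := fun ⟨o, h1, h2⟩ => by
      obtain ⟨o', h3, h4⟩ := h₁y
      cases op_eq hH.nodup h2 h4
      exact hBop ⟨_, h1, h3⟩
    have hUU'C : insert y D ∪ U' ⊆ insert B C := by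
      rintro s (hs | hs)
      · exact Or.inr (hUC hs)
      · by_cases hsB : s = B
        · exact Or.inl hsB
        · exact Or.inr (hU'C s hs hsB).1
    -- In both cases the union of `insert y D` and `U'` shows that `B` has the operator of `y`, a
    -- contradiction.
    rcases mem_attrs_cases hBα with hBs | hBp
    · have hBC' : B ∈ C := (hH.mem_component_iff hC).2 ⟨((hH.mem_componentPlus_iff hC).1 hBC).1, hBs⟩
      have hUU'C' : insert y D ∪ U' ⊆ C := fun s hs =>
        (hUU'C hs).elim (fun h' => h' ▸ hBC') id
      obtain ⟨a, ha⟩ := hne (γ := α) hyUU' subset_rfl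
      obtain ⟨b, hb⟩ := hne (γ := β) hyUU' h.attrs_subset
      obtain ⟨b', hb'⟩ : ∃ b', β.IsFirst U' b' := exists_isFirst ⟨B, hBU', h.attrs_subset hBα⟩
      have hay := hop _ hUU' hyUU' a (Or.inl (hUU'C' ha.1))
        (hUU'C'.trans (Set.subset_insert _ _)) ha
      have hab := h.sameOp _ hUU' (hUU'C'.trans hCs) a b ha hb
      have hBb' := h.sameOp _ hU'c (fun s hs => hCs (hUU'C' (Or.inr hs))) B b' hBfirst hb'
      -- in both cases the first attribute of the union is the first attribute of `U'`
      have hbb' : b ∈ U' := by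
        rcases hb.1 with h' | h'
        · rw [(hb.mono Set.subset_union_left h').unique hβ hd₁]
          exact hd₁U'
        · exact h'
      rw [(hb.mono Set.subset_union_right hbb').unique hβ hb'] at hab
      obtain ⟨o, h1, h2⟩ := hab
      obtain ⟨o', h3, h4⟩ := hay
      obtain ⟨o'', h5, h6⟩ := hBb'
      cases op_eq hH.nodup h1 h3
      cases op_eq hH.nodup h2 h6
      exact hBy ⟨_, h5, h4⟩
    · have hs : ∀ c ∈ insert y D ∪ U', c ≠ B → c ∈ α.semiringAttrs := fun c hc hcB =>
        hCs ((hUU'C hc).resolve_left hcB)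
      have hB' := (h.product_iff U' hU'c B hBU' hBp fun c hc => hs c (Or.inr hc)).1 hBfirst
      have hdB : d₁ ≠ B := by
        rintro rfl
        exact hBd.ne hH.nodup rfl
      have hBd' := hB'.2.2 d₁ hd₁U' hd₁.2.1 hdB
      -- In `β`, `B` comes before `d₁`, and `d₁` comes first in `insert y D`. So `B` comes first in
      -- the union in `β`, and therefore in `α`.
      have hBfirst' := (h.product_iff _ hUU' B (Or.inr hBU') hBp hs).2
        ⟨Or.inr hBU', h.attrs_subset hBα, fun c hc hcβ hcB => by
          rcases hc with hc | hc
          · by_cases hcd : c = d₁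
            · exact hcd ▸ hBd'
            · exact hBd'.trans hβ (hd₁.2.2 c hc hcβ hcd)
          · exact hB'.2.2 c hc hcβ hcB⟩
      exact hBy (hop _ hUU' hyUU' B hBC hUU'C hBfirst')

/-- The output attributes in the bag of `t`, each counted if one of its copies is there. -/
def outputBag (G : CopyTree V N) (H : Hypergraph V) (α : AggOrdering V ι) (t : N) : Set V :=
  {y | y ∈ outputAttrs H α ∧ ∃ F ∈ H.edgeSet, y ∈ F ∧ (y, G.label y F) ∈ G.bag t}

theorem outputBag_subset {t : N} : outputBag G H α t ⊆ G.base.bag t := by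
  rintro y ⟨-, F, -, -, h⟩
  exact CopyTree.mem_base_bag.2 ⟨_, h⟩

/-- The part below `r` of an AGHD that is compatible with `β` decomposes the query given by `H, α`;
`H'` has additional edges of output attributes. -/
structure IsValidBelow (G : CopyTree V N) (H₀ : Hypergraph V) (α₀ β : AggOrdering V ι)
    (H H' : Hypergraph V) (α : AggOrdering V ι) (r : N) : Prop where
  admissible : IsAdmissible H α
  same : SameInner α H H'
  sameFirst : SameFirst H α β
  edges : H.edgeSet ⊆ H₀.edgeSet
  -- Semiring attributes thus have a single copy in the whole tree.
  semiring : ∀ a ∈ α.semiringAttrs, a ∉ α₀.productAttrs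
  extra : ∀ F ∈ H'.edgeSet, F ∈ H.edgeSet ∨ F ⊆ outputBag G H α r
  node : ∀ F ∈ H.edgeSet, ∃ t, G.AncestorOrEq r t ∧ ∀ a ∈ F, (a, G.label a F) ∈ G.bag t
  -- An output attribute that was a product attribute of `α₀` may have several copies, but then all
  -- of those used by edges of `H` occur at `r`. Merging them keeps the occurrences connected.
  output : ∀ y ∈ outputAttrs H α, y ∉ α₀.productAttrs ∨
    ∀ F ∈ H.edgeSet, y ∈ F → (y, G.label y F) ∈ G.bag r
  -- This applies to every connected set of semiring attributes, not only to components, because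
  -- later components are smaller sets of this kind.
  before : ∀ y ∈ outputAttrs H α, ∀ D ⊆ α.semiringAttrs, IsConnectedSet H.Adj D →
    (∃ x ∈ D, H.Adj x y) → ∀ d ∈ D, ¬ β.Precedes d y
  below : ∀ c ∈ α.semiringAttrs, ∀ t, c ∈ G.base.bag t → G.AncestorOrEq r t

theorem IsValidBelow.root (hH : IsAdmissible H₀ α₀) (hG : G.IsAGHD H₀ α₀)
    (hf : SameFirst H₀ α₀ β) (hαβ : α₀.attrs = β.attrs) :
    IsValidBelow G H₀ α₀ β H₀ H₀ α₀ G.root where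
  admissible := hH
  same := .refl α₀ H₀
  sameFirst := hf
  edges := subset_rfl
  semiring _ := notMem_productAttrs hH.nodup
  extra _ hF := Or.inl hF
  node F hF := by
    obtain ⟨t, -, ht⟩ := hG.exists_node hF
    exact ⟨t, G.root_ancestorOrEq t, ht⟩
  output y hy := Or.inl fun h => hy.2 (productAttrs_subset h)
  before y hy _ _ _ _ _ _ hd := hy.2 (hαβ ▸ hd.right_mem)
  below _ _ t _ := G.root_ancestorOrEq t

namespace IsValidBelow

variable (h : IsValidBelow G H₀ α₀ β H H' α r) (hG : G.IsAGHD H₀ α₀) (hβ : (β.map Prod.fst).Nodup)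
  (hcomp : G.Compatible β)

include h

omit h in
theorem mem_base_bag {t : N} {c : V} (ht : ∀ a ∈ F, (a, G.label a F) ∈ G.bag t) (hc : c ∈ F) :
    c ∈ G.base.bag t := CopyTree.mem_base_bag.2 ⟨_, ht c hc⟩

include hG

/-- The running intersection property for the output attributes. -/
theorem isGHD (hr : ∀ C, IsQueryComponent H α C → ∃ t, G.AncestorOrEq r t ∧
      interfaceEdge H α C ⊆ outputBag G H α t) :
    ∃ g : BagTree V N, IsGHD (outputHypergraph H' α) g ∧ ∀ t, g.bag t ⊆ G.base.bag t := by
  classical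
  let g : BagTree V N :=
    { tree := G.tree
      isTree := G.isTree
      bag := fun t => if G.AncestorOrEq r t then outputBag G H α t else ∅ }
  have hg : ∀ t, G.AncestorOrEq r t → g.bag t = outputBag G H α t := fun t ht => if_pos ht
  have hg' : ∀ t y, y ∈ g.bag t ↔ G.AncestorOrEq r t ∧ y ∈ outputBag G H α t := by
    intro t y
    by_cases ht : G.AncestorOrEq r t
    · rw [hg t ht, and_iff_right ht]
    · simp [g, ht]
  refine ⟨g, ⟨isConnectedSet_univ G.isTree, fun t _ y hy => ?_, fun F hF => ?_, fun y hy => ?_⟩,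
    fun t y hy => outputBag_subset ((hg' t y).1 hy).2⟩
  · have := ((hg' t y).1 hy).2.1
    rwa [h.same.outputAttrs_eq] at this
  · rcases hF with ⟨hF, hFo⟩ | ⟨C, hC, rfl⟩
    · rcases h.extra F hF with hF | hF
      · obtain ⟨t, ht, hFt⟩ := h.node F hF
        exact ⟨t, trivial, fun y hy => (hg' t y).2
          ⟨ht, h.same.outputAttrs_eq ▸ hFo hy, F, hF, hy, hFt y hy⟩⟩
      · exact ⟨r, trivial, by rwa [hg r (G.ancestorOrEq_refl r)]⟩
    · have hC' := (h.same.isQueryComponent_iff h.admissible).1 hC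
      obtain ⟨t, ht, hsub⟩ := hr C hC'
      rw [← h.same.interfaceEdge_eq (h.admissible.component_subset_attrs hC')]
      exact ⟨t, trivial, by rwa [hg t ht]⟩
  · change y ∈ outputAttrs H' α at hy
    rw [← h.same.outputAttrs_eq] at hy
    change IsConnectedSet G.tree.Adj _
    have hrun : ∀ F ∈ H.edgeSet, y ∈ F → IsConnectedSet G.tree.Adj
        ({t | G.AncestorOrEq r t} ∩ {t | t ∈ Set.univ ∧ (y, G.label y F) ∈ G.bag t}) := by
      intro F hF hyF
      obtain ⟨t, ht, hFt⟩ := h.node F hF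
      exact (G.isConnectedSet_descendants r).inter G.isTree (hG.connected (h.edges hF) hyF)
        ⟨t, ht, trivial, hFt y hyF⟩
    obtain ⟨F₀, hF₀, hyF₀⟩ := h.admissible.cover y hy.1
    rcases h.output y hy with hyp | hyp
    · convert hrun F₀ hF₀ hyF₀ using 1
      ext t
      constructor
      · rintro ⟨-, ht⟩
        obtain ⟨ht, -, F, hF, hyF, hFt⟩ := (hg' t y).1 ht
        exact ⟨ht, trivial, hG.1 y hyp F (h.edges hF) F₀ (h.edges hF₀) hyF hyF₀ ▸ hFt⟩
      · rintro ⟨ht, -, hFt⟩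
        exact ⟨trivial, (hg' t y).2 ⟨ht, hy, F₀, hF₀, hyF₀, hFt⟩⟩
    -- The occurrences of the different copies are subtrees that all contain `r`, so their union is
    -- connected.
    · have hrr := G.ancestorOrEq_refl r
      refine .of_center (a := r) (fun _ _ h => h.symm) (fun t ht => ?_)
        ⟨trivial, (hg' r y).2 ⟨hrr, hy, F₀, hF₀, hyF₀, hyp F₀ hF₀ hyF₀⟩⟩
      obtain ⟨ht, -, F, hF, hyF, hFt⟩ := (hg' t y).1 ht.2
      refine ((hrun F hF hyF).2 r ⟨hrr, trivial, hyp F hF hyF⟩ t ⟨ht, trivial, hFt⟩).subset ?_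
      rintro x ⟨hx, -, hFx⟩
      exact ⟨trivial, (hg' x y).2 ⟨hx, hy, F, hF, hyF, hFx⟩⟩

/-- The nodes with attributes of a component form a subtree. -/
theorem component_connected (hC : IsQueryComponent H α C) :
    IsConnectedSet G.tree.Adj {t | ∃ c ∈ C, c ∈ G.base.bag t} := by
  have hH := h.admissible
  have hCs := hH.subset_semiringAttrs hC
  set Z := {t | ∃ c ∈ C, c ∈ G.base.bag t} with hZ
  have hcon : ∀ c ∈ C, ∀ s t, c ∈ G.base.bag s → c ∈ G.base.bag t →
      ConnectedIn G.tree.Adj Z s t := by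
    intro c hc s t hs ht
    obtain ⟨i, hi⟩ := CopyTree.mem_base_bag.1 hs
    obtain ⟨j, hj⟩ := CopyTree.mem_base_bag.1 ht
    have hcp := h.semiring c (hCs hc)
    obtain ⟨F, hF, hcF, rfl⟩ := hG.exists_edge trivial hi
    obtain rfl := hG.copy_eq hcp trivial trivial hi hj
    exact ((hG.connected hF hcF).2 s ⟨trivial, hi⟩ t ⟨trivial, hj⟩).subset fun x hx =>
      ⟨c, hc, CopyTree.mem_base_bag.2 ⟨_, hx.2⟩⟩
  have hnode : ∀ c ∈ C, ∃ t, c ∈ G.base.bag t := by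
    intro c hc
    obtain ⟨F, hF, hcF⟩ := hH.cover c (hH.attrs_subset (semiringAttrs_subset (hCs hc)))
    obtain ⟨t, -, ht⟩ := h.node F hF
    exact ⟨t, mem_base_bag ht hcF⟩
  obtain ⟨c₀, hc₀⟩ := (hH.connected hC).1
  obtain ⟨z, hz⟩ := hnode c₀ hc₀
  refine .of_center (a := z) (fun _ _ h => h.symm) ?_ ⟨c₀, hc₀, hz⟩
  rintro t ⟨c, hc, ht⟩
  refine ((hH.connected hC).2 c₀ hc₀ c hc).mem_of_closed
    {c | ∀ t, c ∈ G.base.bag t → ConnectedIn G.tree.Adj Z z t} (fun t ht => hcon c₀ hc₀ z t hz ht)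
    (fun x hx hxC y hyC hxy t ht => ?_) t ht
  obtain ⟨F, hF, hxF, hyF⟩ := hxy
  obtain ⟨u, -, hu⟩ := h.node F hF
  exact ConnectedIn.trans (hx u (mem_base_bag hu hxF)) (hcon y hyC u t (mem_base_bag hu hyF) ht)

include hcomp

/-- An attribute that is not preceded by an attribute of the component occurs at the topmost node of
the component. -/
theorem mem_bag_top (hC : IsQueryComponent H α C) {z : N} (hz : ∃ c ∈ C, c ∈ G.base.bag z)
    (hztop : ∀ t, (∃ c ∈ C, c ∈ G.base.bag t) → G.AncestorOrEq z t) (hF : F ∈ H.edgeSet)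
    (hyF : y ∈ F) (hFC : (F ∩ C).Nonempty) (hyC : y ∉ C) (hy : ∀ d ∈ C, ¬ β.Precedes d y) :
    (y, G.label y F) ∈ G.bag z := by
  have hCs := h.admissible.subset_semiringAttrs hC
  obtain ⟨c, hcF, hcC⟩ := hFC
  obtain ⟨t, -, hFt⟩ := h.node F hF
  have hZ := hG.connected (h.edges hF) hyF
  obtain ⟨w, hw, hwtop⟩ := CopyTree.exists_top hZ
  have hyt : t ∈ {t | t ∈ Set.univ ∧ (y, G.label y F) ∈ G.bag t} := ⟨trivial, hFt y hyF⟩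
  have hwt := hwtop t hyt
  have hzt := hztop t ⟨c, hcC, mem_base_bag hFt hcF⟩
  -- If the topmost node `w` of the copy is above `z`, running intersection puts the copy at `z`. If
  -- `z` were strictly above `w`, compatibility would place some `d` of `C` before `y`.
  rcases hwt.total hzt with hwz | hzw
  · exact (hwz.mem_of_between hzt hZ hw hyt).2
  · by_cases hne : z = w
    · exact hne ▸ hw.2
    · obtain ⟨d, hdC, hdz⟩ := hz
      obtain ⟨j, hj⟩ := CopyTree.mem_base_bag.1 hdz
      have hdy : d ≠ y := fun h' => hyC (h' ▸ hdC)
      have hdβ := h.sameFirst.attrs_subset (semiringAttrs_subset (hCs hdC))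
      rcases hcomp d y hdy j _ z w
        ⟨hj, fun s hs => hztop s ⟨d, hdC, CopyTree.mem_base_bag.2 ⟨_, hs⟩⟩⟩
        ⟨hw.2, fun s hs => hwtop s ⟨trivial, hs⟩⟩ hne hzw with h' | h'
      · exact absurd hdβ h'
      · exact absurd h' (hy d hdC)

include hβ

/-- The new root `z` is the topmost node that meets `C`. The interface attributes reach it by the
invariant `before`, and a product front reaches it by rigidity. A front of semiring attributes needs
no such argument, since these have single copies. -/
theorem component (hC : IsQueryComponent H α C) : ∃ z, G.AncestorOrEq r z ∧
    interfaceEdge H α C ⊆ outputBag G H α z ∧ IsValidBelow G H₀ α₀ β (edgesMeeting H C)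
      (componentHypergraph H α C) (componentOrdering H α C) z := by
  have hH := h.admissible
  have hCs := hH.subset_semiringAttrs hC
  obtain ⟨z, hz, hztop⟩ := CopyTree.exists_top (h.component_connected hG hC)
  have hsC : (componentOrdering H α C).semiringAttrs ⊆ C \ componentFront H α C := by
    intro c hc
    have hc' := mem_semiringAttrs_restrict.1 hc
    exact ⟨(hH.mem_component_iff hC).2 ⟨((hH.mem_componentPlus_iff hC).1 hc'.2.1).1, hc'.1⟩, hc'.2.2⟩
  have hint : ∀ y ∈ interfaceEdge H α C, ∀ F ∈ H.edgeSet, y ∈ F → (F ∩ C).Nonempty →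
      (y, G.label y F) ∈ G.bag z := by
    intro y hy F hF hyF hFC
    obtain ⟨x, hxF, hxC⟩ := hFC
    exact h.mem_bag_top hG hcomp hC hz hztop hF hyF ⟨x, hxF, hxC⟩
      (fun hyC => hy.1.2 (semiringAttrs_subset (hCs hyC)))
      (h.before y hy.1 C hCs (hH.connected hC) ⟨x, hxC, F, hF, hxF, hyF⟩)
  have hrz : G.AncestorOrEq r z := by
    obtain ⟨c, hc, hcz⟩ := hz
    exact h.below c (hCs hc) z hcz
  have hint' : ∀ y ∈ interfaceEdge H α C, ∃ F ∈ (edgesMeeting H C).edgeSet, y ∈ F ∧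
      (y, G.label y F) ∈ G.bag z := by
    intro y hy
    obtain ⟨F, hF, hFC, hyF⟩ := mem_edgesMeeting_vertexSet.1 hy.2
    exact ⟨F, ⟨hF, hFC⟩, hyF, hint y hy F hF hyF hFC⟩
  refine ⟨z, hrz, fun y hy => ?_, hH.meeting hC, hH.sameInner_component hC,
    h.sameFirst.component hH.nodup, fun F hF => h.edges hF.1,
    fun a ha => h.semiring a (mem_semiringAttrs_restrict.1 ha).1, ?_, ?_, ?_, ?_, ?_⟩
  · obtain ⟨F, hF, h'⟩ := hint' y hy
    exact ⟨hy.1, F, hF.1, h'⟩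
  · rintro F (hF | rfl)
    · exact Or.inl hF
    · exact Or.inr fun y hy => ⟨(hH.mem_outputAttrs_component hC).2 (Or.inl hy), hint' y hy⟩
  · rintro F ⟨hF, c, hcF, hcC⟩
    obtain ⟨t, -, ht⟩ := h.node F hF
    exact ⟨t, hztop t ⟨c, hcC, mem_base_bag ht hcF⟩, ht⟩
  · intro y hy
    rcases (hH.mem_outputAttrs_component hC).1 hy with hy | hy
    · exact Or.inr fun F hF hyF => hint y hy F hF.1 hyF hF.2
    · by_cases hyC : y ∈ C
      · exact Or.inl (h.semiring y (hCs hyC))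
      · refine Or.inr fun F hF hyF => ?_
        obtain ⟨hF, x, hxF, hxC⟩ := hF
        refine h.mem_bag_top hG hcomp hC hz hztop hF hyF ⟨x, hxF, hxC⟩ hyC fun d hd => ?_
        -- Here the front is a single product attribute, hence disjoint from `C`, and `D = C` is
        -- allowed.
        refine h.sameFirst.not_precedes_front hβ hH hC hy (hH.connected hC) subset_rfl
          (fun c hc hcf => ?_) hxC ⟨F, hF, hxF, hyF⟩ hd
        rcases hH.componentFront_cases hC with ⟨a, ha, -, -⟩ | ⟨f, i, -, -, hfi, -⟩
        · rw [ha] at hy hcf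
          exact hyC (by rwa [hy, ← hcf])
        · exact hyC (hfi y hy).1
  · rintro y hy D hD hDc ⟨x, hx, hxy⟩ d hd
    have hDc' := hDc.mono_rel (r' := H.Adj) fun _ _ _ _ => edgesMeeting_adj
    rcases (hH.mem_outputAttrs_component hC).1 hy with hy | hy
    · exact h.before y hy.1 D (fun c hc => hCs (hsC (hD hc)).1) hDc' ⟨x, hx, edgesMeeting_adj hxy⟩
        d hd
    · exact h.sameFirst.not_precedes_front hβ hH hC hy hDc' (fun c hc => (hsC (hD hc)).1)
        (fun c hc => (hsC (hD hc)).2) hx (edgesMeeting_adj hxy) hd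
  · intro c hc t ht
    exact hztop t ⟨c, (hsC hc).1, ht⟩

omit h in
theorem exists_isGHD {l : List (Set V)} (h : IsValidBelow G H₀ α₀ β H H' α r)
    (hl : IsCharPosition H' α l) : ∃ g : BagTree V N, IsGHD (charHypergraph H' α l) g ∧
      ∀ t, g.bag t ⊆ G.base.bag t := by
  induction l generalizing H H' α r with
  | nil =>
    refine h.isGHD hG fun C hC => ?_
    obtain ⟨z, hrz, hz, -⟩ := h.component hG hβ hcomp hC
    exact ⟨z, hrz, hz⟩
  | cons C l ih =>
    have hC := (h.same.isQueryComponent_iff h.admissible).1 hl.1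
    have hCa := h.admissible.component_subset_attrs hC
    obtain ⟨z, -, -, hz⟩ := h.component hG hβ hcomp hC
    rw [charHypergraph, ← h.same.componentHypergraph_eq hCa,
      ← h.same.componentOrdering_eq h.admissible.nodup hCa]
    exact ih hz ((h.same.isCharPosition_cons h.admissible hC).1 hl)

end IsValidBelow

/-- Every position receives its own copy of the given tree with smaller bags, and these copies are
glued; every new bag then lies inside an old one. Numbering the finitely many nodes by `Fin n` puts
them into the lowest universe. -/
theorem CopyTree.IsValid.exists_isDecomposable {K : Type*} [CommMonoidWithZero K] [Nontrivial K]
    {O : OperatorSet ι K} [Finite N] (hH : IsAdmissible H α) (h : G.IsValid O H α) :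
    ∃ (N' : Type) (_ : Finite N') (G' : CopyTree V N'), G'.IsDecomposable H α ∧
      ∀ γ : Set V → ℝ, NodeMonotone H γ → G'.base.width γ ≤ G.base.width γ := by
  obtain ⟨hG, β, hβ, hαβ, hcomp⟩ := h
  have hvalid := IsValidBelow.root hH hG (hαβ.sameFirst hH hβ.1) hαβ.1
  choose g hg hsub using fun i : CharIndex H α =>
    IsValidBelow.exists_isGHD hG hβ.1 hcomp hvalid i.2
  have : Finite (CharIndex H α) := hH.finite_charPositions
  have : Finite (Σ _ : CharIndex H α, N) := inferInstance
  obtain ⟨n, ⟨e⟩⟩ := Finite.exists_equiv_fin (Σ _ : CharIndex H α, N)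
  obtain ⟨G', h1, -, h3⟩ := exists_gluing (M := fun _ => N) g hH hg e.symm
  refine ⟨Fin n, inferInstance, G', h1, fun γ hγ => ?_⟩
  have : Nonempty (Set.univ : Set (Fin n)) := ⟨⟨G'.root, trivial⟩⟩
  refine ciSup_le fun t => ?_
  obtain ⟨⟨i, s⟩, hs⟩ := e.surjective t.1
  rw [← hs, show e ⟨i, s⟩ = e.symm.symm ⟨i, s⟩ from rfl, h3]
  exact (hγ _ _ (hsub i s) fun a ha => hG.mem_vertexSet trivial ha).trans
    (le_ciSup (f := fun t : (Set.univ : Set N) => γ (G.base.bag t)) (Set.finite_range _).bddAbove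
      ⟨s, trivial⟩)

end Valid

theorem mainTheorem10 {V ι K : Type*} [CommMonoidWithZero K] [Nontrivial K]
    (O : OperatorSet ι K) (hidem : ∀ x : K, x * x = x)
    (H : Hypergraph V) (hfin : H.vertexSet.Finite)
    (hcover : ∀ a ∈ H.vertexSet, ∃ F ∈ H.edgeSet, a ∈ F)
    (α : AggOrdering V ι) (hα : α.IsOrderingOn H)
    (hlast : ∀ F ∈ H.edgeSet, ∀ p, (α.restrict F).getLast? = some p → p.2 ≠ AggOp.prod) :
    -- decomposable AGHDs are compatible with an equivalent ordering
    (∀ (N : Type*) [Finite N] (G : CopyTree V N), G.IsDecomposable H α →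
      ∃ β : AggOrdering V ι, β.IsOrderingOn H ∧ OrderEquiv O H α β ∧ G.Compatible β) ∧
    -- valid AGHDs can be made decomposable without increasing any width
    (∀ (N : Type*) [Finite N] (G : CopyTree V N), G.IsValid O H α →
      ∃ (N' : Type) (_ : Finite N') (G' : CopyTree V N'), G'.IsDecomposable H α ∧
        ∀ γ : Set V → ℝ, NodeMonotone H γ → G'.base.width γ ≤ G.base.width γ) ∧
    -- GHDs of the characteristic hypergraphs can be connected to form a decomposable AGHD
    (∀ (M : CharIndex H α → Type*) [∀ i, Finite (M i)] (g : ∀ i, BagTree V (M i)),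
      (∀ i, IsGHD (charHypergraph H α i.1) (g i)) →
      ∃ (_ : Finite (Σ i, M i)) (G : CopyTree V (Σ i, M i)), G.IsDecomposable H α ∧
        (∀ i (s t : M i), G.tree.Adj ⟨i, s⟩ ⟨i, t⟩ ↔ (g i).tree.Adj s t) ∧
        (∀ i (t : M i), G.base.bag ⟨i, t⟩ = (g i).bag t) ∧
        ∀ γ : Set V → ℝ, NodeMonotone H γ → G.base.width γ = ⨆ i, (g i).width γ) ∧
    -- every decomposable AGHD can be partitioned into GHDs of the characteristic hypergraphs
    (∀ (N : Type*) [Finite N] (G : CopyTree V N), G.IsDecomposable H α →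
      ∃ part : N → CharIndex H α,
        (∀ i, IsGHDOn (charHypergraph H α i.1) G.base (part ⁻¹' {i})) ∧
        ∀ γ : Set V → ℝ, NodeMonotone H γ →
          G.base.width γ = ⨆ i, G.base.widthOn γ (part ⁻¹' {i})) := by
  have hH : IsAdmissible H α := .of_last hfin hcover hα hlast
  refine ⟨fun N _ G h => h.exists_compatible O hidem hH, fun N _ G h => h.exists_isDecomposable hH,
    fun M _ g hg => ?_, fun N _ G h => ?_⟩
  · obtain ⟨hfin, G, h1, h2, h3, h4⟩ := exists_gluing_sigma g hH hg
    exact ⟨hfin, G, h1, h2, h3, fun γ _ => h4 γ⟩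
  · obtain ⟨part, h1, h2⟩ := h.exists_partition hH
    exact ⟨part, h1, fun γ _ => h2 γ⟩
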